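/- **Setting.** Let $\Omega\subset\mathbb R^3$ be open and let $\mathcal T$ be a conforming triangulation of $\overline\Omega$ by finitely many compact curved tetrahedra $T$ (each smoothly diffeomorphic, up to the boundary, to a 3-simplex; two elements meet in a common subsimplex or not at all; every facet not contained in $\partial\Omega$ belongs to exactly two elements). $\mathring{\mathscr F}$, $\mathring{\mathscr E}$ are the facets and edges not contained in $\partial\Omega$. Tensor fields are smooth on each element up to its boundary, possibly discontinuous across elements. $\mathrm{Regge}(\mathcal T)$ is the space of symmetric covariant 2-tensor fields $\sigma$ such that $\sigma(X,Y)$ is single-valued on every $F\in\mathring{\mathscr F}$ for $X,Y$ tangent to $F$; $\mathring{\mathrm{Regge}}(\mathcal T)$ is the subspace where these values vanish on all facets in $\partial\Omega$. Let $g\in\mathrm{Regge}(\mathcal T)$ be positive definite on every element. $\nabla$, $\mathcal R(X,Y,Z,W)=g(\nabla_X\nabla_YZ-\nabla_Y\nabla_XZ-\nabla_{[X,Y]}Z,W)$, $\star$, $\flat$, $\langle\cdot,\cdot\rangle$ and the volume form $\omega$ (standard orientation) are those of $g|_T$; $\omega_T,\omega_F,\omega_E$ are the induced volume forms; $\hat\varepsilon^{ijk}=\varepsilon^{ijk}/\sqrt{\det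 g}$; $g(X\times Y,Z)=\omega(X,Y,Z)$; $\tau:\sigma:\eta=\tau_{ij}\sigma^{jk}\eta_k{}^i$. For a facet $F$ of $T$, $\nu=\nu_F^T$ is the $g$-unit normal pointing into $T$; for an edge $E$ of $F$, $\mu=\mu_E^F$ is the $g$-unit vector tangent to $F$, orthogonal to $E$ and pointing into $F$; $\tau=\nu\times\mu$ is the unit tangent of $E$. $QX=X-g(X,\nu)\nu$; a subscript $F$ on a tensor slot means that the argument is projected by $Q$, a subscript $\nu$, $\mu$ or $\tau$ that this vector is inserted. $\mathbb S_FV=V_F-\mathrm{tr}(V_F)g_F$, $\mathrm{I\!I}^\nu(X,Y)=-g(\nabla_X\nu,Y)$, $\overline{\mathrm{I\!I}}^\nu=\mathbb S_F\mathrm{I\!I}^\nu$. The jump $[\![B]\!]$ of a $\nu$-dependent form across $F$ is the sum of its values from the two elements containing $F$, each with its inward normal. $[\![\sigma_{\nu\mu}]\!]^E_F=\sigma|_{T_+}(\nu_F^{T_+},\mu_E^F)+\sigma|_{T_-}(\nu_F^{T_-},\mu_E^F)$. $\Theta_E=2\pi-\sum_{T\supset E}\arccos g|_T(\mu_E^{F_+},\mu_E^{F_-})$,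 with $F_\pm$ the two facets of $T$ containing $E$. For a symmetric 2-tensor $U$ let $(\mathbb AU)(X,Y,Z,W)=\langle U,\star(X^\flat\wedge Y^\flat)\odot\star(W^\flat\wedge Z^\flat)\rangle$, where $a\odot b=\frac12(a\otimes b+b\otimes a)$. Let $g(L_\sigma X,Y)=\sigma(X,Y)$, $(L^{(1)}_\sigma A)(X,Y,Z,W)=A(L_\sigma X,Y,Z,W)$, $(SA)(X,Y,Z,W)=A(X,Z,Y,W)$, let $P$ be the skew-symmetrization in arguments 1, 3 and 2, 4, and $$\mathrm{INC}\,\sigma=-SP\nabla^2\sigma,\qquad (\mathrm{curl}\,\sigma)_{ij}=\hat\varepsilon^{pql}g_{lj}(\partial_p\sigma_{iq}-\Gamma^m_{pi}\sigma_{mq}),\qquad \mathrm{inc}\,\sigma=\mathrm{curl}\,(\mathrm{curl}\,\sigma)^T .$$ For a 2-tensor $A$ and a vector $u$ let $(A\times u)^{ij}=\hat\varepsilon^{jkl}A^i{}_ku_l$. For 4-tensor fields $A=\mathbb AU$ with $U\in\mathring{\mathrm{Regge}}(\mathcal T)$ (then $A_{F\nu\nu F}$ and $A_{\mu\nu\nu\mu}$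 are single-valued) and $\sigma\in\mathrm{Regge}(\mathcal T)$, put $N_F(\sigma)=\sigma_{\nu\nu}\mathrm{I\!I}^\nu+(\nabla\sigma)_{F\nu F}+\nabla(\nu\lrcorner\sigma)-(\nabla\sigma)_{\nu FF}$ and, for a sign $s\in\{1,-1\}$, $$\widetilde{\mathcal R\omega}(A)=\sum_T\int_T\langle\mathcal R,A\rangle\,\omega_T+4\sum_{F\in\mathring{\mathscr F}}\int_F\langle[\![\mathrm{I\!I}]\!],A_{F\nu\nu F}\rangle\,\omega_F+4\sum_{E\in\mathring{\mathscr E}}\int_E\Theta_EA_{\mu\nu\nu\mu}\,\omega_E,$$ $$a(g;\sigma,U)=\sum_T\int_T\big(\langle L^{(1)}_\sigma\mathcal R,A\rangle-\tfrac12\mathrm{tr}\,\sigma\,\langle\mathcal R,A\rangle\big)\omega_T+2\sum_{F\in\mathring{\mathscr F}}\int_F[\![\mathrm{I\!I}]\!]:\mathbb S_F(\sigma):A_{F\nu\nu F}\,\omega_F-2\sum_{E\in\mathring{\mathscr E}}\int_E\mathrm{tr}(\sigma_E)\,\Theta_E\,A_{\mu\nu\nu\mu}\,\omega_E,$$ $$b_s(g;\sigma,U)=2\sum_T\int_T\langle\nabla^2\sigma,SA\rangle\,\omega_T+2\sum_{F\in\mathring{\mathscr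 F}}\int_F\langle[\![N_F(\sigma)]\!],A_{F\nu\nu F}\rangle\,\omega_F+2s\sum_{E\in\mathring{\mathscr E}}\int_E\sum_{F\supset E}[\![\sigma_{\nu\mu}]\!]^E_F\,A_{\mu\nu\nu\mu}\,\omega_E,$$ $$\widetilde{\mathrm{INC}\,\sigma}_s(A)=\sum_T\Big(\int_T\langle\mathrm{INC}\,\sigma,A\rangle\,\omega_T-\int_{\partial T}\langle N_F(\sigma),A_{F\nu\nu F}\rangle\,\omega_{\partial T}\Big)-s\sum_{E\in\mathring{\mathscr E}}\sum_{F\supset E}\int_E[\![\sigma_{\nu\mu}]\!]^E_F\,A_{\mu\nu\nu\mu}\,\omega_E,\qquad \widetilde{\mathrm{inc}\,\sigma}_s(U)=\widetilde{\mathrm{INC}\,\sigma}_s(\mathbb AU).$$ **Proposition.** In each element, $\mathcal Q^{ij}=-\frac14\hat\varepsilon^{ikl}\hat\varepsilon^{jmn}\mathcal R_{klmn}$ is symmetric and is the unique symmetric 2-tensor with $\mathbb A\mathcal Q=\mathcal R$. For all $U\in\mathring{\mathrm{Regge}}(\mathcal T)$ the functional $\widetilde{\mathcal Q\omega}(U):=\frac14\widetilde{\mathcal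 R\omega}(\mathbb AU)$ is $$\widetilde{\mathcal Q\omega}(U)=\sum_T\int_T\langle\mathcal Q,U\rangle\,\omega_T-\sum_{F\in\mathring{\mathscr F}}\int_F\langle[\![\overline{\mathrm{I\!I}}]\!],U_F\rangle\,\omega_F+\sum_{E\in\mathring{\mathscr E}}\int_E\Theta_E\,U_{\tau\tau}\,\omega_E .$$ For all $\sigma\in\mathrm{Regge}(\mathcal T)$, $U\in\mathring{\mathrm{Regge}}(\mathcal T)$ and $s\in\{1,-1\}$, $$a(g;\sigma,U)=-2\sum_T\int_T\mathcal Q:\sigma:U\,\omega_T-2\sum_{F\in\mathring{\mathscr F}}\int_F[\![\mathrm{I\!I}]\!]:\mathbb S_F(\sigma):\mathbb S_F(U)\,\omega_F-2\sum_{E\in\mathring{\mathscr E}}\int_E\Theta_E\,\sigma_{\tau\tau}U_{\tau\tau}\,\omega_E,$$ $$b_s(g;\sigma,U)=-2\sum_T\int_T\langle\mathrm{inc}\,\sigma,U\rangle\,\omega_T+2\sum_{F\in\mathring{\mathscr F}}\int_F\langle[\![Q(\mathrm{curl}\,\sigma)^T\times\nu-\sigma_{\nu\nu}\overline{\mathrm{I\!I}}-\mathbb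 S_F\nabla(\nu\lrcorner\sigma)]\!],U_F\rangle\,\omega_F+2s\sum_{E\in\mathring{\mathscr E}}\int_E\sum_{F\supset E}[\![\sigma_{\nu\mu}]\!]^E_F\,U_{\tau\tau}\,\omega_E,$$ $$b_s(g;\sigma,U)=-2\,\widetilde{\mathrm{inc}\,\sigma}_s(U).$$ -/

import Mathlib

open MeasureTheory
open scoped Matrix ContDiff

noncomputable section

namespace Regge3D

/-! ### Tensor algebra in the coordinates of `ℝ³`

Tensors are given by their components in the coordinate frame `∂₀, ∂₁, ∂₂` of `ℝ³`. -/

/-- Points of `ℝ³`. -/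
abbrev Pt := EuclideanSpace ℝ (Fin 3)

/-- Components of a vector or of a covector at a point. -/
abbrev Vec := Fin 3 → ℝ

/-- Components of a tensor with two indices at a point. -/
abbrev Mat := Matrix (Fin 3) (Fin 3) ℝ

/-- Components of a covariant tensor with four indices at a point. -/
abbrev Ten4 := Fin 3 → Fin 3 → Fin 3 → Fin 3 → ℝ

/-- The value `B(X, Y)` of a bilinear form on two vectors. -/
def ev (B : Mat) (X Y : Vec) : ℝ := ∑ i, ∑ j, B i j * X i * Y j

/-- The permutation symbol `ε_{ijk}` on the indices `0, 1, 2`. -/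
def eps (i j k : Fin 3) : ℝ :=
  ((i.val : ℝ) - j.val) * ((j.val : ℝ) - k.val) * ((k.val : ℝ) - i.val) / 2

/-- The inner product of covariant 2-tensors, `B_{ij} C_{kl} h^{ik} h^{jl}`, where `h` is an inverse
metric: `h = g⁻¹` for the full inner product, and `h = invFacet g n` for that on a facet. -/
def ip (h B C : Mat) : ℝ := ∑ i, ∑ j, ∑ k, ∑ l, B i j * C k l * h i k * h j l

/-- The trace `h^{ij} B_{ij}`. -/
def tr (h B : Mat) : ℝ := ∑ i, ∑ j, h i j * B i j

/-- The triple product `τ : σ : η = τ_{ij} σ^{jk} η_k{}^i`, indices raised with `h`. -/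
def triple (h τ σ η : Mat) : ℝ := (τ * h * σ * h * η * h).trace

/-- The inner product of covariant 4-tensors. -/
def ip4 (h : Mat) (A B : Ten4) : ℝ :=
  ∑ i, ∑ j, ∑ k, ∑ l, ∑ a, ∑ b, ∑ c, ∑ d,
    A i j k l * h i a * h j b * h k c * h l d * B a b c d

/-- The covector `X♭`. -/
def flat (g : Mat) (X : Vec) : Vec := fun j => ∑ i, g i j * X i

/-- `φ ∧ η = φ ⊗ η - η ⊗ φ`. -/
def wedge (φ η : Vec) : Fin 3 → Fin 3 → ℝ := fun i j => φ i * η j - η i * φ j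

/-- The symmetric dyadic product `a ⊙ b = (a ⊗ b + b ⊗ a) / 2`. -/
def dyad (a b : Vec) : Mat := fun i j => (a i * b j + b i * a j) / 2

/-- The Hodge star of a 2-form in three dimensions,
`(⋆β)_j = (√det g / 2) β_{mn} g^{ma} g^{nb} ε_{abj}`. -/
def hodge2 (g : Mat) (β : Fin 3 → Fin 3 → ℝ) : Vec := fun j =>
  Real.sqrt g.det / 2 * ∑ m, ∑ n, ∑ a, ∑ b, β m n * g⁻¹ m a * g⁻¹ n b * eps a b j

/-- The `g`-cross product: `g(X × Y, Z) = ω(X, Y, Z)`, with `ω = √det g dx⁰ ∧ dx¹ ∧ dx²`. -/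
def cross (g : Mat) (X Y : Vec) : Vec := fun i =>
  ∑ l, ∑ a, ∑ b, g⁻¹ i l * (Real.sqrt g.det * eps a b l * X a * Y b)

/-- The cross product of a covariant 2-tensor with a vector,
`(A × u)^{ij} = ε̂^{jkl} A^i{}_k u_l` with `ε̂^{jkl} = ε_{jkl} / √det g`. -/
def tensorCross (g A : Mat) (u : Vec) : Mat := fun i j =>
  ∑ k, ∑ l, eps j k l / Real.sqrt g.det * (∑ a, g⁻¹ i a * A a k) * flat g u l

/-- Lowering both indices of a contravariant 2-tensor. -/
def lower (g C : Mat) : Mat := fun i j => ∑ a, ∑ b, g i a * g j b * C a b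

/-- The coordinate vector `∂ᵢ`. -/
def frame (i : Fin 3) : Vec := Pi.single i 1

/-- `(𝔸U)(X, Y, Z, W) = ⟨U, ⋆(X♭ ∧ Y♭) ⊙ ⋆(W♭ ∧ Z♭)⟩`, on the coordinate frame. -/
def AA (g U : Mat) : Ten4 := fun i j k l =>
  ip g⁻¹ U (dyad (hodge2 g (wedge (flat g (frame i)) (flat g (frame j))))
    (hodge2 g (wedge (flat g (frame l)) (flat g (frame k)))))

/-- `L_σ`, components `L^k{}_q = g^{kl} σ_{lq}`, that is `g(L_σ X, Y) = σ(Y, X)`. For symmetric `σ`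
this is `σ(X, Y)`; the order of the slots matters only for the second of two successive curls. -/
def endo (g σ : Mat) : Mat := g⁻¹ * σ

/-- `(L_σ^{(1)} A)(X, Y, Z, W) = A(L_σ X, Y, Z, W)`. -/
def actFirst (g σ : Mat) (A : Ten4) : Ten4 := fun i j k l => ∑ a, endo g σ a i * A a j k l

/-- `(SA)(X, Y, Z, W) = A(X, Z, Y, W)`. -/
def swap23 (A : Ten4) : Ten4 := fun i j k l => A i k j l

/-- The skew-symmetrization in the arguments 1, 3 and in the arguments 2, 4. -/
def skewP (A : Ten4) : Ten4 := fun i j k l =>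
  (A i j k l - A k j i l + A k l i j - A i l k j) / 4

/-! ### Differential operators of a metric `G` given on (a neighbourhood of) an element -/

/-- The partial derivative `∂ₖ f`. -/
def pd (k : Fin 3) (f : Pt → ℝ) (x : Pt) : ℝ := fderiv ℝ f x (EuclideanSpace.single k 1)

/-- The differential `df`, components `∂ₖ f`. -/
def diff (f : Pt → ℝ) (x : Pt) : Vec := fun k => pd k f x

/-- The Christoffel symbols `Γ^k_{ij}` of the Levi-Civita connection. -/
def christoffel (G : Pt → Mat) (x : Pt) (k i j : Fin 3) : ℝ :=
  ∑ l, (G x)⁻¹ k l / 2 * (pd i (fun y => G y j l) x + pd j (fun y => G y i l) x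
    - pd l (fun y => G y i j) x)

/-- The Riemann tensor `R_{ijkl} = g(R(∂ᵢ, ∂ⱼ)∂ₖ, ∂ₗ)` with
`R(X, Y)Z = ∇_X ∇_Y Z - ∇_Y ∇_X Z - ∇_{[X, Y]} Z`. -/
def riemann (G : Pt → Mat) (x : Pt) : Ten4 := fun i j k l =>
  ∑ m, G x m l * (pd i (fun y => christoffel G y m j k) x - pd j (fun y => christoffel G y m i k) x
    + ∑ p, (christoffel G x m i p * christoffel G x p j k
      - christoffel G x m j p * christoffel G x p i k))

/-- The curvature operator, `Q^{ij} = -(1/4) ε̂^{ikl} ε̂^{jmn} R_{klmn}` with both indices lowered. -/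
def curvOp (G : Pt → Mat) (x : Pt) : Mat :=
  lower (G x) (fun i j => -(1 / 4) * ∑ k, ∑ l, ∑ m, ∑ n,
    (eps i k l / Real.sqrt (G x).det) * (eps j m n / Real.sqrt (G x).det) * riemann G x k l m n)

/-- The covariant derivative of a vector field: `(∇_{∂ᵢ} X)^k`. -/
def covVec (G : Pt → Mat) (X : Pt → Vec) (x : Pt) (i k : Fin 3) : ℝ :=
  pd i (fun y => X y k) x + ∑ m, christoffel G x k i m * X x m

/-- The covariant derivative of a 1-form: `(∇_{∂ᵢ} α)(∂ⱼ)`. -/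
def covForm (G : Pt → Mat) (α : Pt → Vec) (x : Pt) (i j : Fin 3) : ℝ :=
  pd i (fun y => α y j) x - ∑ m, christoffel G x m i j * α x m

/-- The covariant derivative of a covariant 2-tensor: `(∇σ)(∂ₖ, ∂ᵢ, ∂ⱼ) = (∇_{∂ₖ} σ)(∂ᵢ, ∂ⱼ)`. -/
def cov2 (G σ : Pt → Mat) (x : Pt) (k i j : Fin 3) : ℝ :=
  pd k (fun y => σ y i j) x - ∑ m, christoffel G x m k i * σ x m j
    - ∑ m, christoffel G x m k j * σ x i m

/-- The second covariant derivative `(∇²σ)(∂ₗ, ∂ₖ, ∂ᵢ, ∂ⱼ) = (∇_{∂ₗ}(∇σ))(∂ₖ, ∂ᵢ, ∂ⱼ)`. -/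
def cov2cov2 (G σ : Pt → Mat) (x : Pt) : Ten4 := fun l k i j =>
  pd l (fun y => cov2 G σ y k i j) x - ∑ m, christoffel G x m l k * cov2 G σ x m i j
    - ∑ m, christoffel G x m l i * cov2 G σ x k m j
    - ∑ m, christoffel G x m l j * cov2 G σ x k i m

/-- The exterior covariant derivative of a vector-valued 1-form `L`:
component `k` of `∇_{∂ₚ}(L ∂_q) - ∇_{∂_q}(L ∂ₚ)`. -/
def extCov (G L : Pt → Mat) (x : Pt) (k p q : Fin 3) : ℝ :=
  covVec G (fun y m => L y m q) x p k - covVec G (fun y m => L y m p) x q k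

/-- The covariant curl of a 2-tensor: `(curl σ)(X, Y) = ⟨(⋆ d^∇ L_σ)(Y), X⟩`, i.e. the row-wise curl
`(curl σ)_{ij} = ε̂^{pql} g_{lj} (∂ₚ σ_{iq} - Γ^m_{pi} σ_{mq})`. -/
def curl (G σ : Pt → Mat) (x : Pt) : Mat := fun i j =>
  ∑ k, G x i k * hodge2 (G x) (fun p q => extCov G (fun y => endo (G y) (σ y)) x k p q) j

/-- The three-dimensional covariant incompatibility operator `inc σ = curl (curl σ)ᵀ`. -/
def inc (G σ : Pt → Mat) (x : Pt) : Mat := curl G (fun y => (curl G σ y)ᵀ) x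

/-- The dimension-independent incompatibility operator `INC σ = -S P ∇²σ`. -/
def INC (G σ : Pt → Mat) (x : Pt) : Ten4 := fun i j k l =>
  -swap23 (skewP (cov2cov2 G σ x)) i j k l

/-! ### Geometry of a facet `{lam = 0}` of an element `{lam ≥ 0, …}` -/

/-- The inward `g`-normal: the `g`-gradient of a defining function `lam` that is positive inside the
element, divided by its `g`-length. -/
def normal (G : Pt → Mat) (lam : Pt → ℝ) (x : Pt) : Vec :=
  (Real.sqrt (ev (G x)⁻¹ (diff lam x) (diff lam x)))⁻¹ • ((G x)⁻¹ *ᵥ diff lam x)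

/-- The tangential projection `Q X = X - g(X, n) n`. -/
def proj (g : Mat) (n : Vec) : Mat := 1 - Matrix.vecMulVec n (flat g n)

/-- `B_F(X, Y) = B(QX, QY)`. -/
def restr (g : Mat) (n : Vec) (B : Mat) : Mat := (proj g n)ᵀ * B * proj g n

/-- The inverse of the metric induced on the facet, as the contravariant tensor
`g⁻¹ - n ⊗ n = ∑ τᵢ ⊗ τᵢ` for a `g`-orthonormal frame `τ₁, τ₂` of the facet. -/
def invFacet (g : Mat) (n : Vec) : Mat := g⁻¹ - Matrix.vecMulVec n n

/-- `𝕊_F V = V_F - tr(V_F) g_F`. -/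
def traceRev (g : Mat) (n : Vec) (V : Mat) : Mat :=
  restr g n V - tr (invFacet g n) (restr g n V) • restr g n g

/-- The second fundamental form `II^n(X, Y) = -g(∇_X n, Y)`. Only derivatives of `n` along the facet
enter, because of the projection of `X`. -/
def secondFF (G : Pt → Mat) (lam : Pt → ℝ) (x : Pt) : Mat :=
  restr (G x) (normal G lam x) (fun i j => -∑ k, covVec G (normal G lam) x i k * G x k j)

/-- `σ_{nn}`. -/
def sigmaNN (G σ : Pt → Mat) (lam : Pt → ℝ) (x : Pt) : ℝ :=
  ev (σ x) (normal G lam x) (normal G lam x)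

/-- `(∇σ)_{FnF}(X, Y) = (∇σ)(QX, n, QY)`. -/
def nablaFnF (G σ : Pt → Mat) (lam : Pt → ℝ) (x : Pt) : Mat :=
  restr (G x) (normal G lam x) (fun i j => ∑ a, cov2 G σ x i a j * normal G lam x a)

/-- `(∇σ)_{nFF}(X, Y) = (∇σ)(n, QX, QY)`. -/
def nablanFF (G σ : Pt → Mat) (lam : Pt → ℝ) (x : Pt) : Mat :=
  restr (G x) (normal G lam x) (fun i j => ∑ a, cov2 G σ x a i j * normal G lam x a)

/-- `∇(n ⌟ σ)` on tangential arguments, with `(n ⌟ σ)(Y) = σ(n, Y)`. -/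
def nablaContr (G σ : Pt → Mat) (lam : Pt → ℝ) (x : Pt) : Mat :=
  restr (G x) (normal G lam x)
    (fun i j => covForm G (fun y b => ∑ a, normal G lam y a * σ y a b) x i j)

/-- `A_{FnnF}(X, Y) = A(QX, n, n, QY)`. -/
def AFnnF (g : Mat) (n : Vec) (A : Ten4) : Mat :=
  restr g n (fun i j => ∑ a, ∑ b, A i a b j * n a * n b)

/-- `Q (curl σ)ᵀ × n`, with lowered indices. -/
def curlCross (G σ : Pt → Mat) (lam : Pt → ℝ) (x : Pt) : Mat :=
  lower (G x) (tensorCross (G x) ((proj (G x) (normal G lam x))ᵀ * (curl G σ x)ᵀ)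
    (normal G lam x))

/-- The density, with respect to the Euclidean area, of the area form `ω_F = n ⌟ ω` of the facet:
`√det g ⟨n, N⟩`, where `N` is the Euclidean unit normal of the facet. -/
def areaDensity (G : Pt → Mat) (lam : Pt → ℝ) (x : Pt) : ℝ :=
  Real.sqrt (G x).det * (∑ i, normal G lam x i * diff lam x i)
    / Real.sqrt (∑ i, diff lam x i ^ 2)

/-! ### Curved triangulations -/

/-- A member of a finite set of simplices (of vertex sets), if there is one. It is used to evaluate
quantities that are single-valued on a subsimplex from one of the adjacent elements. -/
def pick {V : Type*} (s : Finset (Finset V)) : Finset V :=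
  open Classical in if h : s.Nonempty then h.choose else ∅

/-- A conforming triangulation of the open set `Ω ⊆ ℝ³` by finitely many curved tetrahedra. An element
is named by the set of its four vertices; the compact set `carrier T` is the closed element itself,
and the barycentric coordinates `bary T v`, `v ∈ T`, which are smooth near `carrier T`, identify it
with the standard simplex diffeomorphically. -/
structure CurvedTriangulation (Ω : Set Pt) (V : Type*) [DecidableEq V] where
  cells : Finset (Finset V)
  card_cell : ∀ T ∈ cells, T.card = 4
  carrier : Finset V → Set Pt
  bary : Finset V → V → Pt → ℝ
  isCompact_carrier : ∀ T ∈ cells, IsCompact (carrier T)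
  smooth_bary : ∀ T ∈ cells, ∀ v ∈ T, ∀ x ∈ carrier T, ContDiffAt ℝ ∞ (bary T v) x
  sum_bary : ∀ T ∈ cells, ∀ x ∈ carrier T, ∀ᶠ y in nhds x, ∑ v ∈ T, bary T v y = 1
  bijOn_bary : ∀ T ∈ cells,
    Set.BijOn (fun x (v : {v // v ∈ T}) => bary T v x) (carrier T) (stdSimplex ℝ {v // v ∈ T})
  immersion_bary : ∀ T ∈ cells, ∀ x ∈ carrier T, ∀ X : Pt,
    (∀ v ∈ T, fderiv ℝ (bary T v) x X = 0) → X = 0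
  /-- Two elements meet in their common subsimplex (or not at all, if they share no vertex). -/
  inter_carrier : ∀ T ∈ cells, ∀ T' ∈ cells,
    carrier T ∩ carrier T' = {x ∈ carrier T | ∀ v ∈ T \ T', bary T v x = 0}
  /-- A common subsimplex is the same set in both elements. -/
  face_eq : ∀ T ∈ cells, ∀ T' ∈ cells, ∀ S ⊆ T ∩ T',
    {x ∈ carrier T | ∀ v ∈ T \ S, bary T v x = 0}
      = {x ∈ carrier T' | ∀ v ∈ T' \ S, bary T' v x = 0}
  iUnion_carrier : ⋃ T ∈ cells, carrier T = closure Ω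
  /-- A facet that is not contained in `∂Ω` belongs to exactly two elements. -/
  two_sides : ∀ T ∈ cells, ∀ F ∈ T.powersetCard 3,
    ¬ {x ∈ carrier T | ∀ v ∈ T \ F, bary T v x = 0} ⊆ frontier Ω →
      (cells.filter (fun T' => F ⊆ T')).card = 2

/-- A field of 2-tensors given on every element separately (by components). -/
abbrev PField (V : Type*) := Finset V → Pt → Mat

/-- A field of 4-tensors given on every element separately (by components). -/
abbrev PField4 (V : Type*) := Finset V → Pt → Ten4

namespace CurvedTriangulation

variable {Ω : Set Pt} {V : Type*} [DecidableEq V] (M : CurvedTriangulation Ω V)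

/-- The subsimplex of the element `T` with the vertex set `S ⊆ T`, as a subset of `ℝ³`. -/
def face (T S : Finset V) : Set Pt := {x ∈ M.carrier T | ∀ v ∈ T \ S, M.bary T v x = 0}

/-- The elements that contain a given subsimplex. -/
def star (S : Finset V) : Finset (Finset V) := M.cells.filter (fun T => S ⊆ T)

/-- All facets. -/
def facets : Finset (Finset V) := M.cells.biUnion (fun T => T.powersetCard 3)

/-- All edges (subsimplices of codimension two). -/
def edges : Finset (Finset V) := M.cells.biUnion (fun T => T.powersetCard 2)

/-- The subset of `ℝ³` that is a given subsimplex. -/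
def real (S : Finset V) : Set Pt := M.face (pick (M.star S)) S

open Classical in
/-- The interior facets: those that are not contained in `∂Ω`. -/
def intFacets : Finset (Finset V) := M.facets.filter (fun F => ¬ M.real F ⊆ frontier Ω)

open Classical in
/-- The interior edges: those that are not contained in `∂Ω`. -/
def intEdges : Finset (Finset V) := M.edges.filter (fun E => ¬ M.real E ⊆ frontier Ω)

/-- The facets that contain the edge `E`. -/
def facetsAt (E : Finset V) : Finset (Finset V) := M.facets.filter (fun F => E ⊆ F)

/-- The element from which single-valued quantities on a facet `F` or an edge `E` are evaluated. -/
def side (S : Finset V) : Finset V := pick (M.star S)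

/-- A facet of the element `T` that contains the edge `E`. -/
def facetOf (T E : Finset V) : Finset V := pick ((T.powersetCard 3).filter (fun F => E ⊆ F))

/-- The barycentric coordinate of `T` that vanishes on the facet `F` (`T \ F` is one vertex). -/
def wall (T F : Finset V) : Pt → ℝ := fun y => ∑ v ∈ T \ F, M.bary T v y

/-- The vector `X` is tangent at `x` to the subsimplex `S` of `T`. -/
def Tangent (T S : Finset V) (x : Pt) (X : Vec) : Prop :=
  ∀ v ∈ T \ S, ∑ k, diff (M.bary T v) x k * X k = 0

/-! #### The Regge spaces -/

/-- Symmetric 2-tensor fields that are smooth on every element up to its boundary, i.e. are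
restrictions of fields that are smooth near the element. -/
def IsSymTensor (σ : PField V) : Prop :=
  ∀ T ∈ M.cells, (∀ x, (σ T x).IsSymm) ∧
    ∀ x ∈ M.carrier T, ∀ i j, ContDiffAt ℝ ∞ (fun y => σ T y i j) x

/-- The Regge space: the tangential-tangential components are single-valued on interior facets. -/
def IsRegge (σ : PField V) : Prop :=
  M.IsSymTensor σ ∧
    ∀ F ∈ M.intFacets, ∀ T ∈ M.star F, ∀ T' ∈ M.star F, ∀ x ∈ M.face T F, ∀ X Y : Vec,
      M.Tangent T F x X → M.Tangent T F x Y → ev (σ T x) X Y = ev (σ T' x) X Y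

/-- The Regge space with vanishing tangential-tangential components on the boundary. -/
def IsReggeZero (σ : PField V) : Prop :=
  M.IsRegge σ ∧
    ∀ F ∈ M.facets, F ∉ M.intFacets → ∀ T ∈ M.star F, ∀ x ∈ M.face T F, ∀ X Y : Vec,
      M.Tangent T F x X → M.Tangent T F x Y → ev (σ T x) X Y = 0

/-- Regge metrics: the positive definite members of the Regge space. -/
def IsReggeMetric (g : PField V) : Prop :=
  M.IsRegge g ∧ ∀ T ∈ M.cells, ∀ x ∈ M.carrier T, (g T x).PosDef

/-! #### Normals, conormals, tangents, angles -/

variable (g : PField V)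

/-- `n_F^T`, the `g|_T`-normal of `F` that points into `T`. -/
def nor (T F : Finset V) (x : Pt) : Vec := normal (g T) (M.wall T F) x

/-- `μ_E^F`, the `g`-conormal of the edge `E` that points into the facet `F`, computed in the element
`T`: the normalized tangential part along `F` of the inward normal of the other facet
`E ∪ (T \ F)` of `T` that contains `E`. -/
def conor (T F E : Finset V) (x : Pt) : Vec :=
  let w := proj (g T x) (M.nor g T F x) *ᵥ M.nor g T (E ∪ (T \ F)) x
  (Real.sqrt (ev (g T x) w w))⁻¹ • w

/-- The tangent `τ = n × μ` of the edge `E`, computed in `T` with the facet `F`. -/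
def tang (T F E : Finset V) (x : Pt) : Vec :=
  cross (g T x) (M.nor g T F x) (M.conor g T F E x)

/-- The interior angle of `T` at the edge `E`. -/
def angle (T E : Finset V) (x : Pt) : ℝ :=
  Real.arccos (ev (g T x) (M.conor g T (facetOf T E) E x)
    (M.conor g T (E ∪ (T \ facetOf T E)) E x))

/-- The angle deficit `Θ_E`. -/
def deficit (E : Finset V) (x : Pt) : ℝ := 2 * Real.pi - ∑ T ∈ M.star E, M.angle g T E x

/-! #### Integrals with respect to the volume forms -/

/-- `∫_T f ω_T`. -/
def cellIntegral (T : Finset V) (f : Pt → ℝ) : ℝ :=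
  ∫ x in M.carrier T, f x * Real.sqrt (g T x).det

/-- `∫_F f ω_F`, with the area form of `g|_T`. -/
def facetIntegral (T F : Finset V) (f : Pt → ℝ) : ℝ :=
  ∫ x in M.face T F, f x * areaDensity (g T) (M.wall T F) x ∂μHE[2]

/-- `∫_E f ω_E`: the length density is `√g(t, t)`, `t` the Euclidean unit tangent of `E`. -/
def edgeIntegral (E : Finset V) (f : Pt → ℝ) : ℝ :=
  let T := M.side E
  let τ := M.tang g T (facetOf T E) E
  ∫ x in M.face T E, f x * Real.sqrt (ev (g T x) ((Real.sqrt (∑ i, τ x i ^ 2))⁻¹ • τ x)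
    ((Real.sqrt (∑ i, τ x i ^ 2))⁻¹ • τ x)) ∂μHE[1]

/-- `∫_F ⟨B, C⟩ ω_F`, where `B` is a form on `F` (such as a jump), and `C` is single-valued on `F` and
is given by its value from the element `M.side F`. -/
def facetPairing (F : Finset V) (B C : Pt → Mat) : ℝ :=
  M.facetIntegral g (M.side F) F
    (fun x => ip (invFacet (g (M.side F) x) (M.nor g (M.side F) F x)) (B x) (C x))

/-! #### Jumps -/

/-- The jump `⟦B⟧` across `F` of a form that depends on the inward normal: the sum over the elements
that contain `F`. -/
def jump (F : Finset V) (B : Finset V → Pt → Mat) (x : Pt) : Mat := ∑ T ∈ M.star F, B T x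

/-- `II^{n_F^T}`. -/
def II (F T : Finset V) (x : Pt) : Mat := secondFF (g T) (M.wall T F) x

/-- The trace-reversed second fundamental form `𝕊_F II = II - H g_F`. -/
def IIbar (F T : Finset V) (x : Pt) : Mat :=
  traceRev (g T x) (M.nor g T F x) (M.II g F T x)

/-- `⟦σ_{nμ}⟧_F^E = ∑_T σ|_T(n_F^T, μ_E^F)`, the sum over the elements that contain `F`. -/
def edgeJump (σ : PField V) (E F : Finset V) (x : Pt) : ℝ :=
  ∑ T ∈ M.star F, ev (σ T x) (M.nor g T F x) (M.conor g T F E x)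

/-- `A_{μnnμ}` on an edge. -/
def edgeVal (A : PField4 V) (E : Finset V) (x : Pt) : ℝ :=
  let T := M.side E
  let n := M.nor g T (facetOf T E) x
  let μ := M.conor g T (facetOf T E) E x
  ∑ i, ∑ j, ∑ k, ∑ l, A T x i j k l * μ i * n j * n k * μ l

/-- `U_{ττ}` on an edge. -/
def edgeTT (U : PField V) (E : Finset V) (x : Pt) : ℝ :=
  let T := M.side E
  ev (U T x) (M.tang g T (facetOf T E) E x) (M.tang g T (facetOf T E) E x)

/-- The trace `tr(σ_E)` of the restriction of `σ` to an edge, with respect to the metric of the edge;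
`g⁻¹ - n ⊗ n - μ ⊗ μ` is the inverse of the latter. -/
def edgeTrace (σ : PField V) (E : Finset V) (x : Pt) : ℝ :=
  let T := M.side E
  let n := M.nor g T (facetOf T E) x
  let μ := M.conor g T (facetOf T E) E x
  tr ((g T x)⁻¹ - Matrix.vecMulVec n n - Matrix.vecMulVec μ μ) (σ T x)

/-- `A_{FnnF}`, as seen from the element `T`. -/
def facetVal (A : PField4 V) (F T : Finset V) (x : Pt) : Mat :=
  AFnnF (g T x) (M.nor g T F x) (A T x)

/-- `U_F`, as seen from the element `T`. -/
def facetTT (U : PField V) (F T : Finset V) (x : Pt) : Mat :=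
  restr (g T x) (M.nor g T F x) (U T x)

/-- `𝕊_F(σ)`, as seen from the element `T`. -/
def facetRev (σ : PField V) (F T : Finset V) (x : Pt) : Mat :=
  traceRev (g T x) (M.nor g T F x) (σ T x)

/-! #### The functionals -/

/-- `𝔸U`, element by element. -/
def AAf (g U : PField V) : PField4 V := fun T x => AA (g T x) (U T x)

/-- The generalized densitized Riemann curvature
`∑_T ∫_T ⟨R, A⟩ + 4 ∑_F ∫_F ⟨⟦II⟧, A_{FnnF}⟩ + 4 ∑_E ∫_E Θ_E A_{μnnμ}`. -/
def riemannFunctional (A : PField4 V) : ℝ :=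
  ∑ T ∈ M.cells, M.cellIntegral g T (fun x => ip4 (g T x)⁻¹ (riemann (g T) x) (A T x))
    + 4 * ∑ F ∈ M.intFacets,
        M.facetPairing g F (M.jump F (M.II g F)) (M.facetVal g A F (M.side F))
    + 4 * ∑ E ∈ M.intEdges, M.edgeIntegral g E (fun x => M.deficit g E x * M.edgeVal g A E x)

/-- The form `a(g; σ, U)`. -/
def aForm (σ U : PField V) : ℝ :=
  let A := AAf g U
  ∑ T ∈ M.cells, M.cellIntegral g T (fun x =>
      ip4 (g T x)⁻¹ (actFirst (g T x) (σ T x) (riemann (g T) x)) (A T x)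
        - 1 / 2 * tr (g T x)⁻¹ (σ T x) * ip4 (g T x)⁻¹ (riemann (g T) x) (A T x))
    + 2 * ∑ F ∈ M.intFacets, M.facetIntegral g (M.side F) F (fun x =>
        triple (invFacet (g (M.side F) x) (M.nor g (M.side F) F x)) (M.jump F (M.II g F) x)
          (M.facetRev g σ F (M.side F) x) (M.facetVal g A F (M.side F) x))
    - 2 * ∑ E ∈ M.intEdges, M.edgeIntegral g E (fun x =>
        M.edgeTrace g σ E x * M.deficit g E x * M.edgeVal g A E x)

/-- `σ_{nn} II^n + (∇σ)_{FnF} + ∇(n ⌟ σ) - (∇σ)_{nFF}`, with the inward normal of `F` in `T`. -/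
def facetFlux (σ : PField V) (F T : Finset V) (x : Pt) : Mat :=
  sigmaNN (g T) (σ T) (M.wall T F) x • M.II g F T x
    + nablaFnF (g T) (σ T) (M.wall T F) x + nablaContr (g T) (σ T) (M.wall T F) x
    - nablanFF (g T) (σ T) (M.wall T F) x

/-- The form `b_s(g; σ, U)`; `s = ±1` is the sign of its edge term. With the inward normals used in
`edgeJump`, the sign `s = 1` is the one that occurs in the linearization of the angle deficit,
`dΘ_E/dt = (1/2) ∑_F ⟦(dg/dt)_{nμ}⟧_F^E`. -/
def bForm (s : ℝ) (σ U : PField V) : ℝ :=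
  let A := AAf g U
  2 * ∑ T ∈ M.cells, M.cellIntegral g T (fun x =>
      ip4 (g T x)⁻¹ (cov2cov2 (g T) (σ T) x) (swap23 (A T x)))
    + 2 * ∑ F ∈ M.intFacets,
        M.facetPairing g F (M.jump F (M.facetFlux g σ F)) (M.facetVal g A F (M.side F))
    + s * (2 * ∑ E ∈ M.intEdges, M.edgeIntegral g E (fun x =>
        (∑ F ∈ M.facetsAt E, M.edgeJump g σ E F x) * M.edgeVal g A E x))

/-- The generalized incompatibility of `σ` as a functional of 4-tensor fields `A`; `s = ±1` is the
sign in front of the edge terms, as in `bForm`. The integral over `∂T` is the sum of the integrals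
over the four facets of `T`. -/
def INCtilde (s : ℝ) (σ : PField V) (A : PField4 V) : ℝ :=
  ∑ T ∈ M.cells, (M.cellIntegral g T (fun x => ip4 (g T x)⁻¹ (INC (g T) (σ T) x) (A T x))
      - ∑ F ∈ T.powersetCard 3, M.facetIntegral g T F (fun x =>
          ip (invFacet (g T x) (M.nor g T F x)) (M.facetFlux g σ F T x) (M.facetVal g A F T x)))
    - s * ∑ E ∈ M.intEdges, ∑ F ∈ M.facetsAt E,
        M.edgeIntegral g E (fun x => M.edgeJump g σ E F x * M.edgeVal g A E x)

/-- The generalized three-dimensional incompatibility: `U ↦ INCtilde σ (𝔸U)`. -/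
def incTilde (s : ℝ) (σ U : PField V) : ℝ := M.INCtilde g s σ (AAf g U)

end CurvedTriangulation

end Regge3D

end

/-!
Apart from the identity `𝔸Q = R`, the claims compare sums of integrals over elements, facets and
edges. They follow from pointwise identities of the integrands and, for `b = -2 inc`, from regrouping
the facet and edge terms.

*Elements.* In three dimensions `𝔸U` is `U` contracted with two copies of the volume form, so pairing
a 4-tensor with `𝔸U` contracts it with `ε̂^{ijm} ε̂^{lkn} U_{mn}` (`ip4_AA`). For the Riemann tensor the
contraction is `4⟨Q, U⟩`. As the Riemann tensor is skew in each pair of arguments and symmetric under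
exchange of the pairs, it is recovered from `Q`, which gives `𝔸Q = R` (`AA_curvUp`, `AA_curvOp`); the
integrand of `a` then follows from the contraction rule for two permutation symbols
(`ip4_actFirst_AA`). Pairing `∇²σ` with `S𝔸U` gives `-⟨inc σ, U⟩`, because `ε̂` is covariantly
constant (`pd_starTensor`), so that two successive curls are two contractions of `∇²σ` with `ε̂`
(`inc_eq`). The skew-symmetrization in `INC` does not change the pairing with `𝔸U` (`ip4_INC_AA`).

*Facets and edges.* In a positively oriented orthonormal frame with last vector `n`, every facet
quantity becomes a matrix identity (`IsFrame`), and `X ↦ n × X` is the rotation by a right angle. This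
gives `(𝔸U)_{FnnF} = -𝕊_F U` (`IsFrame.AFnnF_eq`), the identity between `(∇σ)_{FnF} - (∇σ)_{nFF}` and
`Q (curl σ)ᵀ × n` (`IsFrame.ip_nabla_AFnnF`), and `(𝔸U)_{μnnμ} = U_{ττ}` (`AA_conormal`).

*Single-valuedness.* The coefficients of a jump live on the two sides of a facet, whereas the pairing
is evaluated on one chosen side. The two elements induce the same tangent plane on a common facet
(`fderiv_wall_eq_zero`): the barycentric coordinate of one element vanishes on the facet, hence is
stationary along the curves in the facet that the other element provides. Tangential-tangential
continuity then makes the facet metric, the area form and the pairing with `U` independent of the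
side, so every facet identity may be proved one side at a time
(`IsReggeMetric.facetPairing_facetVal`).

*Regrouping.* In `b = -2 inc`, the sum over the boundaries of the elements is rearranged into a sum
over facets. Boundary facets drop out since `U` vanishes there on tangential arguments, and on an
interior facet the integral of a jump is split into the integrals over its sides. Splitting is legitimate because the
integrands are continuous on a compact set of finite Hausdorff measure: a subsimplex is locally a
Lipschitz image of a part of a cube of its dimension (`face_measure_lt_top`). Edge integrals are split
in the same way.
-/

noncomputable section

namespace Regge3D

/-! ### The permutation symbol, the Hodge star and the operator `𝔸` -/

/-- The permutation symbol is a density: it transforms with the determinant. -/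
theorem eps_transform (M : Mat) (i j k : Fin 3) :
    ∑ a, ∑ b, ∑ c, M i a * M j b * M k c * eps a b c = M.det * eps i j k := by
  rw [Matrix.det_fin_three]
  fin_cases i <;> fin_cases j <;> fin_cases k <;>
    (simp [eps, Fin.sum_univ_three]; ring)

theorem eps_swap12 (i j k : Fin 3) : eps j i k = -eps i j k := by
  simp only [eps]; ring

theorem eps_cycle (i j k : Fin 3) : eps j k i = eps i j k := by
  simp only [eps]; ring

/-- Contraction of one pair of indices of two permutation symbols. -/
theorem eps_mul_eps (i m a c : Fin 3) :
    ∑ j, eps i j m * eps a j c =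
      (if i = a then 1 else 0) * (if m = c then 1 else 0)
        - (if i = c then 1 else 0) * (if m = a then 1 else 0) := by
  fin_cases i <;> fin_cases m <;> fin_cases a <;> fin_cases c <;>
    norm_num [eps, Fin.sum_univ_three]

theorem eps_mul_eps_two (n d : Fin 3) :
    ∑ l, ∑ k, eps l k n * eps l k d = 2 * if n = d then 1 else 0 := by
  fin_cases n <;> fin_cases d <;> norm_num [eps, Fin.sum_univ_three]

/-- What the pointwise algebra uses of a positive definite matrix. Unlike the definition of positive
definiteness this is visibly an open condition among symmetric matrices. -/
structure IsMetric (g : Mat) : Prop where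
  isSymm : g.IsSymm
  det_pos : 0 < g.det

theorem _root_.Matrix.PosDef.isMetric {g : Mat} (hg : g.PosDef) : IsMetric g :=
  ⟨by
    have h := hg.isHermitian
    rwa [Matrix.IsHermitian, Matrix.conjTranspose_eq_transpose_of_trivial] at h, hg.det_pos⟩

section metric
variable {g : Mat}

theorem inv_isSymm (hg : g.IsSymm) : (g⁻¹).IsSymm := by
  unfold Matrix.IsSymm; rw [Matrix.transpose_nonsing_inv, hg.eq]

theorem sqrt_det_pos (hg : IsMetric g) : 0 < Real.sqrt g.det := Real.sqrt_pos.2 hg.det_pos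

theorem inv_mul_self (hg : IsMetric g) : g⁻¹ * g = 1 :=
  Matrix.nonsing_inv_mul _ hg.det_pos.ne'.isUnit

theorem mul_inv_self (hg : IsMetric g) : g * g⁻¹ = 1 :=
  Matrix.mul_nonsing_inv _ hg.det_pos.ne'.isUnit

theorem sqrt_det_mul_det_inv (hg : IsMetric g) :
    Real.sqrt g.det * (g⁻¹).det = (Real.sqrt g.det)⁻¹ := by
  have h := sqrt_det_pos hg
  rw [Matrix.det_nonsing_inv, Ring.inverse_eq_inv']
  have h2 : g.det = Real.sqrt g.det * Real.sqrt g.det := (Real.mul_self_sqrt hg.det_pos.le).symm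
  have h3 : g.det ≠ 0 := hg.det_pos.ne'
  field_simp
  rw [sq, ← h2]

/-- Raising two indices of the volume form gives the contravariant permutation tensor with its last
index lowered. -/
theorem raise_vol (hg : IsMetric g) (m n j : Fin 3) :
    Real.sqrt g.det * ∑ a, ∑ b, g⁻¹ m a * g⁻¹ n b * eps a b j
      = ∑ l, eps m n l / Real.sqrt g.det * g l j := by
  have hs := hg.isSymm
  set f : Vec := fun c => ∑ a, ∑ b, g⁻¹ m a * g⁻¹ n b * eps a b c with hf
  have h1 : g⁻¹ *ᵥ f = fun k => (g⁻¹).det * eps m n k := by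
    funext k
    rw [← eps_transform]
    simp only [Matrix.mulVec, dotProduct, hf, Fin.sum_univ_three]
    ring
  have h2 : f = g *ᵥ (fun k => (g⁻¹).det * eps m n k) := by
    rw [← h1, Matrix.mulVec_mulVec, mul_inv_self hg, Matrix.one_mulVec]
  have h3 := congrFun h2 j
  change Real.sqrt g.det * f j = _
  rw [h3]
  simp only [Matrix.mulVec, dotProduct, Finset.mul_sum]
  refine Finset.sum_congr rfl fun l _ => ?_
  rw [div_eq_mul_inv, ← sqrt_det_mul_det_inv hg, hs.apply l j]
  ring

theorem hodge2_eq (hg : IsMetric g) (β : Fin 3 → Fin 3 → ℝ) (j : Fin 3) :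
    hodge2 g β j = ∑ p, ∑ q, β p q / 2 * ∑ l, eps p q l / Real.sqrt g.det * g l j := by
  simp only [hodge2, ← raise_vol hg]
  simp only [Finset.mul_sum]
  refine Finset.sum_congr rfl fun _ _ => Finset.sum_congr rfl fun _ _ =>
    Finset.sum_congr rfl fun _ _ => Finset.sum_congr rfl fun _ _ => ?_
  ring

theorem inv_mulVec_flat (hg : IsMetric g) (X : Vec) : g⁻¹ *ᵥ flat g X = X := by
  have h : flat g X = g *ᵥ X := by
    funext j
    simp only [flat, Matrix.mulVec, dotProduct]
    refine Finset.sum_congr rfl fun i _ => ?_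
    rw [hg.isSymm.apply]
  rw [h, Matrix.mulVec_mulVec, inv_mul_self hg, Matrix.one_mulVec]

/-- `⋆(X♭ ∧ Y♭) = ω(X, Y, ·)`. -/
theorem hodge2_wedge_flat (hg : IsMetric g) (X Y : Vec) (j : Fin 3) :
    hodge2 g (wedge (flat g X) (flat g Y)) j
      = Real.sqrt g.det * ∑ a, ∑ b, eps a b j * X a * Y b := by
  have hs := inv_isSymm hg.isSymm
  have hX : ∀ a, ∑ m, flat g X m * g⁻¹ m a = X a := fun a => by
    conv_rhs => rw [← inv_mulVec_flat hg X]
    simp only [Matrix.mulVec, dotProduct]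
    exact Finset.sum_congr rfl fun m _ => by rw [hs.apply m a, mul_comm]
  have hY : ∀ a, ∑ m, flat g Y m * g⁻¹ m a = Y a := fun a => by
    conv_rhs => rw [← inv_mulVec_flat hg Y]
    simp only [Matrix.mulVec, dotProduct]
    exact Finset.sum_congr rfl fun m _ => by rw [hs.apply m a, mul_comm]
  have key : ∀ a b, ∑ m, ∑ n, wedge (flat g X) (flat g Y) m n * g⁻¹ m a * g⁻¹ n b
      = X a * Y b - Y a * X b := by
    intro a b
    rw [← hX a, ← hY b, ← hX b, ← hY a]
    simp only [wedge, Fin.sum_univ_three]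
    ring
  have h1 : hodge2 g (wedge (flat g X) (flat g Y)) j = Real.sqrt g.det / 2 * ∑ a, ∑ b,
      (∑ m, ∑ n, wedge (flat g X) (flat g Y) m n * g⁻¹ m a * g⁻¹ n b) * eps a b j := by
    simp only [hodge2]
    congr 1
    generalize wedge (flat g X) (flat g Y) = β
    generalize g⁻¹ = h
    simp only [Finset.sum_mul]
    rw [Finset.sum_congr rfl fun m _ => Finset.sum_comm, Finset.sum_comm]
    refine Finset.sum_congr rfl fun a _ => ?_
    rw [Finset.sum_congr rfl fun m _ => Finset.sum_comm, Finset.sum_comm]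
  rw [h1]
  simp_rw [key]
  simp [Fin.sum_univ_three, eps]
  ring

theorem hodge2_wedge_frame (hg : IsMetric g) (i j k : Fin 3) :
    hodge2 g (wedge (flat g (frame i)) (flat g (frame j))) k = Real.sqrt g.det * eps i j k := by
  rw [hodge2_wedge_flat hg]
  congr 1
  simp [frame, Pi.single_apply]

theorem ip_dyad (h U : Mat) (hU : U.IsSymm) (α β : Vec) :
    ip h U (dyad α β) = ∑ m, ∑ n, U m n * (∑ c, h m c * α c) * ∑ d, h n d * β d := by
  have h10 := hU.apply 0 1
  have h20 := hU.apply 0 2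
  have h21 := hU.apply 1 2
  simp only [ip, dyad, Fin.sum_univ_three, h10, h20, h21]
  ring

/-- The components of `𝔸U` for symmetric `U`. -/
theorem AA_apply (hg : IsMetric g) {U : Mat} (hU : U.IsSymm) (i j k l : Fin 3) :
    AA g U i j k l = ∑ m, ∑ n, U m n * (∑ c, g⁻¹ m c * (Real.sqrt g.det * eps i j c))
      * ∑ d, g⁻¹ n d * (Real.sqrt g.det * eps l k d) := by
  simp only [AA, ip_dyad _ _ hU, hodge2_wedge_frame hg]

theorem sum_comm_four_two (F : Fin 3 → Fin 3 → Fin 3 → Fin 3 → Fin 3 → Fin 3 → ℝ) :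
    ∑ a, ∑ b, ∑ c, ∑ d, ∑ m, ∑ n, F a b c d m n
      = ∑ m, ∑ n, ∑ a, ∑ b, ∑ c, ∑ d, F a b c d m n := by
  have h : ∀ G : Fin 3 → Fin 3 → Fin 3 → Fin 3 → Fin 3 → ℝ,
      ∑ a, ∑ b, ∑ c, ∑ d, ∑ m, G a b c d m = ∑ m, ∑ a, ∑ b, ∑ c, ∑ d, G a b c d m := by
    intro G
    have h1 : ∀ a b c, ∑ d, ∑ m, G a b c d m = ∑ m, ∑ d, G a b c d m :=
      fun _ _ _ => Finset.sum_comm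
    have h2 : ∀ a b, ∑ c, ∑ m, ∑ d, G a b c d m = ∑ m, ∑ c, ∑ d, G a b c d m :=
      fun _ _ => Finset.sum_comm
    have h3 : ∀ a, ∑ b, ∑ m, ∑ c, ∑ d, G a b c d m = ∑ m, ∑ b, ∑ c, ∑ d, G a b c d m :=
      fun _ => Finset.sum_comm
    simp only [h1, h2, h3]
    exact Finset.sum_comm
  rw [h]
  exact Finset.sum_congr rfl fun m _ => h _

/-- The bookkeeping behind `ip4_AA`: indices raised on the two pairs separately. -/
theorem contract_four_two (r : ℝ) (h U : Mat) (P : Fin 3 → Fin 3 → Fin 3 → ℝ)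
    (i j k l : Fin 3) :
    ∑ a, ∑ b, ∑ c, ∑ d, r * h i a * h j b * h k c * h l d * (∑ m, ∑ n, U m n * P m a b * P n d c)
      = r * ∑ m, ∑ n, (∑ a, ∑ b, h i a * h j b * P m a b) * (∑ a, ∑ b, h l a * h k b * P n a b)
        * U m n := by
  have h1 : ∀ a b c d, r * h i a * h j b * h k c * h l d *
      (∑ m, ∑ n, U m n * P m a b * P n d c)
      = ∑ m, ∑ n, (r * U m n) * ((h i a * h j b * P m a b) * (h l d * h k c * P n d c)) := by
    intro a b c d
    simp only [Finset.mul_sum]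
    refine Finset.sum_congr rfl fun m _ => Finset.sum_congr rfl fun n _ => ?_
    ring
  have h2 : ∀ m n, ∑ a, ∑ b, ∑ c, ∑ d, (r * U m n) * ((h i a * h j b * P m a b) *
        (h l d * h k c * P n d c)) = r * ((∑ a, ∑ b, h i a * h j b * P m a b) *
          (∑ a, ∑ b, h l a * h k b * P n a b) * U m n) := by
    intro m n
    have h3 : ∑ c, ∑ d, h l d * h k c * P n d c = ∑ a, ∑ b, h l a * h k b * P n a b :=
      Finset.sum_comm
    rw [← h3]
    simp only [← Finset.mul_sum, ← Finset.sum_mul]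
    ring
  simp only [h1]
  refine (sum_comm_four_two _).trans ?_
  rw [Finset.mul_sum]
  refine Finset.sum_congr rfl fun m _ => ?_
  rw [Finset.mul_sum]
  exact Finset.sum_congr rfl fun n _ => h2 m n

theorem raise_vol_three (hg : IsMetric g) (i j m : Fin 3) :
    ∑ a, ∑ b, g⁻¹ i a * g⁻¹ j b * ∑ c, g⁻¹ m c * (Real.sqrt g.det * eps a b c)
      = eps i j m / Real.sqrt g.det := by
  rw [div_eq_inv_mul, ← sqrt_det_mul_det_inv hg, mul_assoc, ← eps_transform]
  simp only [Finset.mul_sum]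
  refine Finset.sum_congr rfl fun a _ => Finset.sum_congr rfl fun b _ =>
    Finset.sum_congr rfl fun c _ => ?_
  ring

/-- Pairing with `𝔸U` is a contraction with two contravariant permutation tensors. -/
theorem ip4_AA (hg : IsMetric g) {U : Mat} (hU : U.IsSymm) (B : Ten4) :
    ip4 g⁻¹ B (AA g U) = ∑ i, ∑ j, ∑ k, ∑ l, B i j k l * ∑ m, ∑ n,
      (eps i j m / Real.sqrt g.det) * (eps l k n / Real.sqrt g.det) * U m n := by
  unfold ip4
  refine Finset.sum_congr rfl fun i _ => Finset.sum_congr rfl fun j _ =>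
    Finset.sum_congr rfl fun k _ => Finset.sum_congr rfl fun l _ => ?_
  simp only [AA_apply hg hU, ← raise_vol_three hg]
  exact contract_four_two (B i j k l) g⁻¹ U
    (fun m a b => ∑ c, g⁻¹ m c * (Real.sqrt g.det * eps a b c)) i j k l

theorem ip4_swap23 (h : Mat) (A B : Ten4) : ip4 h A (swap23 B) = ip4 h (swap23 A) B := by
  unfold ip4 swap23
  refine Finset.sum_congr rfl fun i _ => ?_
  rw [Finset.sum_comm]
  refine Finset.sum_congr rfl fun k _ => Finset.sum_congr rfl fun j _ =>
    Finset.sum_congr rfl fun l _ => Finset.sum_congr rfl fun a _ => ?_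
  rw [Finset.sum_comm]
  refine Finset.sum_congr rfl fun k _ => Finset.sum_congr rfl fun j _ =>
    Finset.sum_congr rfl fun l _ => ?_
  ring

end metric

/-! ### Pairings of 4-tensors with `𝔸 U` -/

theorem lower_eq {g : Mat} (hg : g.IsSymm) (C : Mat) : lower g C = g * C * g := by
  have h10 := hg.apply 0 1
  have h20 := hg.apply 0 2
  have h21 := hg.apply 1 2
  ext i j
  simp only [lower, Matrix.mul_apply, Fin.sum_univ_three]
  rw [hg.apply j 0, hg.apply j 1, hg.apply j 2]
  ring

theorem ip_eq_trace (h B C : Mat) : ip h B C = (B * h * Cᵀ * hᵀ).trace := by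
  simp only [ip, Matrix.trace, Matrix.diag, Matrix.mul_apply, Matrix.transpose_apply,
    Fin.sum_univ_three]
  ring

theorem ip_lower {g : Mat} (hg : IsMetric g) (C U : Mat) :
    ip g⁻¹ (lower g C) U = ∑ m, ∑ n, C m n * U m n := by
  have hs := hg.isSymm
  rw [ip_eq_trace, lower_eq hs, (inv_isSymm hs).eq, Matrix.mul_assoc (g * C), mul_inv_self hg,
    Matrix.mul_one, Matrix.mul_assoc g, Matrix.mul_assoc g, Matrix.trace_mul_comm,
    Matrix.mul_assoc, inv_mul_self hg, Matrix.mul_one]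
  simp [Matrix.trace, Matrix.mul_apply]

/-- The contravariant curvature operator of an algebraic curvature tensor. -/
def curvUp (g : Mat) (R : Ten4) : Mat := fun i j => -(1 / 4) * ∑ k, ∑ l, ∑ m, ∑ n,
  (eps i k l / Real.sqrt g.det) * (eps j m n / Real.sqrt g.det) * R k l m n

theorem curvOp_eq (G : Pt → Mat) (x : Pt) :
    curvOp G x = lower (G x) (curvUp (G x) (riemann G x)) := rfl

section cell
variable {g : Mat}

/-- The element integrand of the generalized curvature. No symmetry of `R` is needed. -/
theorem ip4_AA_curvature (hg : IsMetric g) {U : Mat} (hU : U.IsSymm) (R : Ten4) :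
    ip4 g⁻¹ R (AA g U) = 4 * ip g⁻¹ (lower g (curvUp g R)) U := by
  rw [ip4_AA hg hU, ip_lower hg]
  simp only [Finset.mul_sum]
  refine (sum_comm_four_two _).trans ?_
  refine Finset.sum_congr rfl fun m _ => Finset.sum_congr rfl fun n _ => ?_
  simp only [curvUp, Finset.mul_sum, Finset.sum_mul]
  refine Finset.sum_congr rfl fun i _ => Finset.sum_congr rfl fun j _ =>
    Finset.sum_congr rfl fun k _ => Finset.sum_congr rfl fun l _ => ?_
  rw [eps_swap12 k l n, eps_cycle n k l, eps_cycle m i j]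
  ring

theorem AA_apply_raised (hg : IsMetric g) {U : Mat} (hU : U.IsSymm) (i j k l : Fin 3) :
    AA g U i j k l = ∑ c, ∑ d, (g⁻¹ * U * g⁻¹) c d * (Real.sqrt g.det * eps i j c)
      * (Real.sqrt g.det * eps l k d) := by
  have hs := inv_isSymm hg.isSymm
  rw [AA_apply hg hU]
  simp only [Matrix.mul_apply, Fin.sum_univ_three]
  rw [hs.apply 0 1, hs.apply 0 2, hs.apply 1 2]
  ring

theorem sqrt_det_mul_eps_div (hg : IsMetric g) (a b : ℝ) :
    Real.sqrt g.det * a * (b / Real.sqrt g.det) = a * b := by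
  have := (sqrt_det_pos hg).ne'
  field_simp

theorem AA_contract_last (hg : IsMetric g) {U : Mat} (hU : U.IsSymm) (i j n : Fin 3) :
    ∑ k, ∑ l, AA g U i j k l * (eps l k n / Real.sqrt g.det)
      = 2 * ∑ c, (g⁻¹ * U * g⁻¹) c n * (Real.sqrt g.det * eps i j c) := by
  have h1 : ∀ k l, AA g U i j k l * (eps l k n / Real.sqrt g.det)
      = ∑ d, (∑ c, (g⁻¹ * U * g⁻¹) c d * (Real.sqrt g.det * eps i j c))
        * (eps l k n * eps l k d) := by
    intro k l
    rw [AA_apply_raised hg hU, Finset.sum_comm, Finset.sum_mul]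
    refine Finset.sum_congr rfl fun d _ => ?_
    rw [Finset.sum_mul, Finset.sum_mul]
    refine Finset.sum_congr rfl fun c _ => ?_
    have := sqrt_det_mul_eps_div hg (eps l k d) (eps l k n)
    linear_combination (g⁻¹ * U * g⁻¹) c d * (Real.sqrt g.det * eps i j c) * this
  simp only [h1]
  have h2 : ∀ f : Fin 3 → ℝ, ∑ k, ∑ l, ∑ d, f d * (eps l k n * eps l k d) = 2 * f n := by
    intro f
    rw [Finset.sum_comm]
    have : ∀ d, ∑ l, ∑ k, f d * (eps l k n * eps l k d) = f d * (2 * if n = d then 1 else 0) :=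
      fun d => by rw [← eps_mul_eps_two]; simp only [Finset.mul_sum]
    rw [Finset.sum_congr rfl fun l _ => Finset.sum_comm, Finset.sum_comm]
    simp only [this]
    simp [mul_comm]
  exact h2 fun d => ∑ c, (g⁻¹ * U * g⁻¹) c d * (Real.sqrt g.det * eps i j c)

/-- The curvature operator of `𝔸U` is `U`, so `𝔸` is injective on symmetric tensors. -/
theorem curvUp_AA (hg : IsMetric g) {U : Mat} (hU : U.IsSymm) :
    curvUp g (AA g U) = g⁻¹ * U * g⁻¹ := by
  have hs : (g⁻¹ * U * g⁻¹).IsSymm := by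
    unfold Matrix.IsSymm
    rw [Matrix.transpose_mul, Matrix.transpose_mul, (inv_isSymm hg.isSymm).eq, hU.eq,
      Matrix.mul_assoc]
  ext m n
  have h1 : curvUp g (AA g U) m n = 1 / 4 * ∑ i, ∑ j, (eps i j m / Real.sqrt g.det) *
      ∑ k, ∑ l, AA g U i j k l * (eps l k n / Real.sqrt g.det) := by
    simp only [curvUp, Finset.mul_sum]
    refine Finset.sum_congr rfl fun i _ => Finset.sum_congr rfl fun j _ =>
      Finset.sum_congr rfl fun k _ => Finset.sum_congr rfl fun l _ => ?_
    rw [eps_swap12 k l n, eps_cycle n k l, eps_cycle m i j]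
    ring
  rw [h1]
  simp only [AA_contract_last hg hU]
  set C := g⁻¹ * U * g⁻¹
  have h2 : ∀ i j, (eps i j m / Real.sqrt g.det) * (2 * ∑ c, C c n * (Real.sqrt g.det * eps i j c))
      = ∑ c, 2 * C c n * (eps i j m * eps i j c) := by
    intro i j
    simp only [Finset.mul_sum]
    refine Finset.sum_congr rfl fun c _ => ?_
    have := sqrt_det_mul_eps_div hg (eps i j c) (eps i j m)
    linear_combination 2 * C c n * this
  simp only [h2]
  have h3 : ∑ i, ∑ j, ∑ c, 2 * C c n * (eps i j m * eps i j c)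
      = ∑ c, 2 * C c n * ∑ i, ∑ j, eps i j m * eps i j c := by
    rw [Finset.sum_congr rfl fun l _ => Finset.sum_comm, Finset.sum_comm]
    simp only [Finset.mul_sum]
  rw [h3]
  simp only [eps_mul_eps_two]
  simp
  ring

theorem lower_raise (hg : IsMetric g) (U : Mat) : lower g (g⁻¹ * U * g⁻¹) = U := by
  rw [lower_eq hg.isSymm, Matrix.mul_assoc, Matrix.mul_assoc, inv_mul_self hg,
    Matrix.mul_one, ← Matrix.mul_assoc, mul_inv_self hg, Matrix.one_mul]

theorem raise_lower (hg : IsMetric g) (C : Mat) : g⁻¹ * lower g C * g⁻¹ = C := by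
  rw [lower_eq hg.isSymm, Matrix.mul_assoc, Matrix.mul_assoc, mul_inv_self hg,
    Matrix.mul_one, ← Matrix.mul_assoc, inv_mul_self hg, Matrix.one_mul]

theorem lower_isSymm (hg : g.IsSymm) {C : Mat} (hC : C.IsSymm) : (lower g C).IsSymm := by
  rw [lower_eq hg]
  unfold Matrix.IsSymm
  rw [Matrix.transpose_mul, Matrix.transpose_mul, hg.eq, hC.eq, Matrix.mul_assoc]

theorem curvUp_isSymm {R : Ten4} (h : ∀ i j k l, R i j k l = R k l i j) :
    (curvUp g R).IsSymm := by
  ext i j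
  simp only [Matrix.transpose_apply, curvUp]
  congr 1
  have h1 : ∀ k l, ∑ m, ∑ n, (eps j k l / Real.sqrt g.det) * (eps i m n / Real.sqrt g.det)
      * R k l m n = ∑ m, ∑ n, (eps i m n / Real.sqrt g.det) * (eps j k l / Real.sqrt g.det)
      * R m n k l := fun k l => Finset.sum_congr rfl fun m _ => Finset.sum_congr rfl fun n _ => by
    rw [h k l m n]; ring
  simp only [h1]
  rw [Finset.sum_congr rfl fun k _ => Finset.sum_comm, Finset.sum_comm]
  refine Finset.sum_congr rfl fun m _ => ?_
  rw [Finset.sum_congr rfl fun k _ => Finset.sum_comm, Finset.sum_comm]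

/-- A skew form in three dimensions is the dual of a vector. -/
theorem skew_eq_eps {β : Fin 3 → Fin 3 → ℝ} (h : ∀ i j, β i j = -β j i) (i j : Fin 3) :
    β i j = ∑ c, eps i j c * (1 / 2 * ∑ a, ∑ b, eps c a b * β a b) := by
  have h0 : β 0 0 = 0 := by linarith [h 0 0]
  have h1 : β 1 1 = 0 := by linarith [h 1 1]
  have h2 : β 2 2 = 0 := by linarith [h 2 2]
  have h3 := h 1 0
  have h4 := h 2 0
  have h5 := h 2 1
  fin_cases i <;> fin_cases j <;>
    (simp [eps, Fin.sum_univ_three, h0, h1, h2, h3, h4, h5]; try ring)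

/-- An algebraic curvature tensor is recovered from its curvature operator. -/
theorem AA_curvUp (hg : IsMetric g) {R : Ten4} (h1 : ∀ i j k l, R i j k l = -R j i k l)
    (h2 : ∀ i j k l, R i j k l = -R i j l k) (h3 : ∀ i j k l, R i j k l = R k l i j) :
    AA g (lower g (curvUp g R)) = R := by
  have hs := (sqrt_det_pos hg).ne'
  funext i j k l
  rw [AA_apply_raised hg (lower_isSymm hg.isSymm (curvUp_isSymm h3)), raise_lower hg]
  have e1 := skew_eq_eps (β := fun i j => R i j k l) (fun i j => h1 i j k l) i j
  have e2 := fun a b => skew_eq_eps (β := fun k l => R a b k l) (fun k l => h2 a b k l) k l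
  have e3 : ∀ c, ∑ a, ∑ b, eps c a b * R a b k l = ∑ d, eps k l d *
      ∑ a, ∑ b, eps c a b * (1 / 2 * ∑ p, ∑ q, eps d p q * R a b p q) := by
    intro c
    simp only [e2 _ _]
    simp only [Finset.mul_sum]
    rw [Finset.sum_congr rfl fun k _ => Finset.sum_comm, Finset.sum_comm]
    refine Finset.sum_congr rfl fun d _ => Finset.sum_congr rfl fun a _ =>
      Finset.sum_congr rfl fun b _ => Finset.sum_congr rfl fun p _ =>
      Finset.sum_congr rfl fun q _ => ?_
    ring
  simp only [e3] at e1
  refine Eq.trans ?_ e1.symm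
  refine Finset.sum_congr rfl fun c _ => ?_
  rw [Finset.mul_sum, Finset.mul_sum]
  refine Finset.sum_congr rfl fun d _ => ?_
  have e4 : curvUp g R c d * Real.sqrt g.det * Real.sqrt g.det = -(1 / 4) *
      ∑ a, ∑ b, ∑ p, ∑ q, eps c a b * eps d p q * R a b p q := by
    simp only [curvUp, Finset.mul_sum, Finset.sum_mul]
    refine Finset.sum_congr rfl fun a _ => Finset.sum_congr rfl fun b _ =>
      Finset.sum_congr rfl fun p _ => Finset.sum_congr rfl fun q _ => ?_
    field_simp
  have e5 : ∑ a, ∑ b, eps c a b * (1 / 2 * ∑ p, ∑ q, eps d p q * R a b p q)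
      = 1 / 2 * ∑ a, ∑ b, ∑ p, ∑ q, eps c a b * eps d p q * R a b p q := by
    simp only [Finset.mul_sum]
    refine Finset.sum_congr rfl fun a _ => Finset.sum_congr rfl fun b _ =>
      Finset.sum_congr rfl fun p _ => Finset.sum_congr rfl fun q _ => ?_
    ring
  rw [e5, eps_swap12 k l d]
  linear_combination (-eps i j c * eps k l d) * e4

/-- The integrand of the form `a` on an element. -/
theorem ip4_actFirst_AA (hg : IsMetric g) {Q σ U : Mat} (hQ : Q.IsSymm) (hσ : σ.IsSymm)
    (hU : U.IsSymm) :
    ip4 g⁻¹ (actFirst g σ (AA g Q)) (AA g U) - 1 / 2 * tr g⁻¹ σ * ip4 g⁻¹ (AA g Q) (AA g U)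
      = -2 * triple g⁻¹ Q σ U := by
  have hi := inv_isSymm hg.isSymm
  rw [ip4_AA_curvature hg hU (AA g Q), curvUp_AA hg hQ, lower_raise hg]
  set C := g⁻¹ * Q * g⁻¹ with hC
  have hCs : C.IsSymm := by
    unfold Matrix.IsSymm
    rw [hC, Matrix.transpose_mul, Matrix.transpose_mul, hi.eq, hQ.eq, Matrix.mul_assoc]
  set L := endo g σ with hL
  have h1 : ip4 g⁻¹ (actFirst g σ (AA g Q)) (AA g U) = ∑ i, ∑ j, ∑ m, ∑ n,
      (eps i j m / Real.sqrt g.det) * U m n * ∑ a, L a i *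
        ∑ k, ∑ l, AA g Q a j k l * (eps l k n / Real.sqrt g.det) := by
    rw [ip4_AA hg hU]
    refine Finset.sum_congr rfl fun i _ => Finset.sum_congr rfl fun j _ => ?_
    simp only [actFirst, Finset.mul_sum, Finset.sum_mul]
    rw [Finset.sum_congr rfl fun k _ => Finset.sum_comm, Finset.sum_comm]
    refine Finset.sum_congr rfl fun m _ => ?_
    rw [Finset.sum_congr rfl fun k _ => Finset.sum_comm, Finset.sum_comm]
    refine Finset.sum_congr rfl fun n _ => ?_
    rw [Finset.sum_congr rfl fun k _ => Finset.sum_comm, Finset.sum_comm]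
    refine Finset.sum_congr rfl fun a _ => Finset.sum_congr rfl fun k _ =>
      Finset.sum_congr rfl fun l _ => ?_
    ring
  have h2 : ∀ i j m n, (eps i j m / Real.sqrt g.det) * U m n * ∑ a, L a i *
        ∑ k, ∑ l, AA g Q a j k l * (eps l k n / Real.sqrt g.det)
      = ∑ a, ∑ c, 2 * L a i * C c n * U m n * (eps i j m * eps a j c) := by
    intro i j m n
    simp only [AA_contract_last hg hQ, Finset.mul_sum]
    refine Finset.sum_congr rfl fun a _ => Finset.sum_congr rfl fun c _ => ?_
    have := sqrt_det_mul_eps_div hg (eps a j c) (eps i j m)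
    linear_combination 2 * L a i * C c n * U m n * this
  have h3 : ∀ i, ∑ j, ∑ m, ∑ n, ∑ a, ∑ c, 2 * L a i * C c n * U m n * (eps i j m * eps a j c)
      = ∑ m, ∑ n, ∑ a, ∑ c, 2 * L a i * C c n * U m n *
        ((if i = a then 1 else 0) * (if m = c then 1 else 0)
        - (if i = c then 1 else 0) * (if m = a then 1 else 0)) := by
    intro i
    simp only [← eps_mul_eps, Finset.mul_sum]
    rw [Finset.sum_comm]
    refine Finset.sum_congr rfl fun m _ => ?_
    rw [Finset.sum_comm]
    refine Finset.sum_congr rfl fun n _ => ?_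
    rw [Finset.sum_comm]
    refine Finset.sum_congr rfl fun a _ => ?_
    rw [Finset.sum_comm]
  have h4 : ip4 g⁻¹ (actFirst g σ (AA g Q)) (AA g U)
      = 2 * L.trace * (C * Uᵀ).trace - 2 * (L * C * U).trace := by
    rw [h1]
    simp only [h2, h3]
    simp [mul_sub, Finset.sum_sub_distrib, Matrix.trace, Matrix.mul_apply, Fin.sum_univ_three]
    rw [hU.apply 0 1, hU.apply 0 2, hU.apply 1 2, hCs.apply 0 1, hCs.apply 0 2, hCs.apply 1 2]
    ring
  have h5 : ip g⁻¹ Q U = (C * Uᵀ).trace := by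
    have := ip_lower hg C U
    rw [hC, lower_raise hg, ← hC] at this
    rw [this]
    simp [Matrix.trace, Matrix.mul_apply]
  have h6 : tr g⁻¹ σ = L.trace := by
    simp only [hL, endo, tr, Matrix.trace, Matrix.diag, Matrix.mul_apply, Fin.sum_univ_three]
    rw [hσ.apply 0 1, hσ.apply 0 2, hσ.apply 1 2]
  have h7 : triple g⁻¹ Q σ U = (L * C * U).trace := by
    have e : (Q * g⁻¹ * σ * g⁻¹ * U * g⁻¹)ᵀ = g⁻¹ * (U * (L * (C * g))) := by
      have : C * g = g⁻¹ * Q := by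
        rw [hC, Matrix.mul_assoc, inv_mul_self hg, Matrix.mul_one]
      rw [this, hL]
      simp only [Matrix.transpose_mul, hi.eq, hQ.eq, hσ.eq, hU.eq, endo, Matrix.mul_assoc]
    rw [triple, ← Matrix.trace_transpose, e, Matrix.trace_mul_comm]
    simp only [← Matrix.mul_assoc]
    rw [Matrix.mul_assoc _ g, mul_inv_self hg, Matrix.mul_one, Matrix.mul_assoc,
      Matrix.trace_mul_comm]
  rw [h4, h5, h6, h7]
  ring

/-- The twice contracted second derivative which is the contravariant incompatibility. -/
def incUp (g : Mat) (T : Ten4) : Mat := fun m n => ∑ r, ∑ s, ∑ p, ∑ q,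
  (eps r s n / Real.sqrt g.det) * (eps p q m / Real.sqrt g.det) * T r p s q

/-- The element integrand of the form `b`. -/
theorem ip4_swap23_AA (hg : IsMetric g) {U : Mat} (hU : U.IsSymm) (T : Ten4) :
    ip4 g⁻¹ T (swap23 (AA g U)) = -ip g⁻¹ (lower g (incUp g T)) U := by
  rw [ip4_swap23, ip4_AA hg hU, ip_lower hg]
  simp only [Finset.mul_sum, incUp, Finset.sum_mul]
  refine (sum_comm_four_two _).trans ?_
  rw [Finset.sum_comm]
  simp only [← Finset.sum_neg_distrib]
  refine Finset.sum_congr rfl fun m _ => Finset.sum_congr rfl fun n _ =>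
    Finset.sum_congr rfl fun i _ => Finset.sum_congr rfl fun j _ =>
    Finset.sum_congr rfl fun k _ => Finset.sum_congr rfl fun l _ => ?_
  rw [eps_swap12 k l m, hU.apply n m, swap23]
  ring

theorem sum_skew_first {E : Ten4} (hE : ∀ i j k l, E i j k l = -E j i k l) (X : Ten4) :
    ∑ i, ∑ j, ∑ k, ∑ l, X j i k l * E i j k l = -∑ i, ∑ j, ∑ k, ∑ l, X i j k l * E i j k l := by
  rw [Finset.sum_comm]
  simp only [← Finset.sum_neg_distrib]
  refine Finset.sum_congr rfl fun i _ => Finset.sum_congr rfl fun j _ =>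
    Finset.sum_congr rfl fun k _ => Finset.sum_congr rfl fun l _ => ?_
  rw [hE]; ring

theorem sum_skew_last {E : Ten4} (hE : ∀ i j k l, E i j k l = -E i j l k) (X : Ten4) :
    ∑ i, ∑ j, ∑ k, ∑ l, X i j l k * E i j k l = -∑ i, ∑ j, ∑ k, ∑ l, X i j k l * E i j k l := by
  simp only [← Finset.sum_neg_distrib]
  refine Finset.sum_congr rfl fun i _ => Finset.sum_congr rfl fun j _ => ?_
  rw [Finset.sum_comm]
  refine Finset.sum_congr rfl fun k _ => Finset.sum_congr rfl fun l _ => ?_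
  rw [hE]; ring

/-- The skew-symmetrization in `INC` may be dropped against `𝔸U`, which is itself skew in the first
and in the last pair of arguments. -/
theorem ip4_INC_AA (hg : IsMetric g) {U : Mat} (hU : U.IsSymm) (T : Ten4) :
    ip4 g⁻¹ (fun i j k l => -swap23 (skewP T) i j k l) (AA g U)
      = -ip4 g⁻¹ T (swap23 (AA g U)) := by
  rw [ip4_swap23, ip4_AA hg hU, ip4_AA hg hU]
  set E : Ten4 := fun i j k l => ∑ m, ∑ n,
      (eps i j m / Real.sqrt g.det) * (eps l k n / Real.sqrt g.det) * U m n with hE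
  have hE1 : ∀ i j k l, E i j k l = -E j i k l := by
    intro i j k l
    simp only [hE, ← Finset.sum_neg_distrib]
    refine Finset.sum_congr rfl fun m _ => Finset.sum_congr rfl fun n _ => ?_
    rw [eps_swap12 i j]; ring
  have hE2 : ∀ i j k l, E i j k l = -E i j l k := by
    intro i j k l
    simp only [hE, ← Finset.sum_neg_distrib]
    refine Finset.sum_congr rfl fun m _ => Finset.sum_congr rfl fun n _ => ?_
    rw [eps_swap12 l k]; ring
  change ∑ i, ∑ j, ∑ k, ∑ l, -swap23 (skewP T) i j k l * E i j k l
    = -∑ i, ∑ j, ∑ k, ∑ l, swap23 T i j k l * E i j k l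
  have e1 := sum_skew_first hE1 (swap23 T)
  have e2 := sum_skew_last hE2 (swap23 T)
  have e3 := sum_skew_first hE1 (fun i j k l => swap23 T i j l k)
  simp only [e2, neg_neg] at e3
  have e4 : ∀ i j k l, -swap23 (skewP T) i j k l * E i j k l = -(1 / 4) *
      (swap23 T i j k l * E i j k l - swap23 T j i k l * E i j k l
        + swap23 T j i l k * E i j k l - swap23 T i j l k * E i j k l) := by
    intro i j k l
    simp only [swap23, skewP]
    ring
  simp only [e4, ← Finset.mul_sum, Finset.sum_add_distrib, Finset.sum_sub_distrib]
  rw [e1, e2, e3]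
  ring

end cell

/-! ### Symmetries of the Riemann tensor -/

section pd
variable {x : Pt} {f f' : Pt → ℝ}

theorem pd_congr (k : Fin 3) (h : f =ᶠ[nhds x] f') : pd k f x = pd k f' x := by
  rw [pd, pd, h.fderiv_eq]

theorem pd_add (k : Fin 3) (hf : DifferentiableAt ℝ f x) (hf' : DifferentiableAt ℝ f' x) :
    pd k (fun y => f y + f' y) x = pd k f x + pd k f' x := by
  simp only [pd]; rw [fderiv_fun_add hf hf']; rfl

theorem pd_sub (k : Fin 3) (hf : DifferentiableAt ℝ f x) (hf' : DifferentiableAt ℝ f' x) :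
    pd k (fun y => f y - f' y) x = pd k f x - pd k f' x := by
  simp only [pd]; rw [fderiv_fun_sub hf hf']; rfl

theorem pd_mul (k : Fin 3) (hf : DifferentiableAt ℝ f x) (hf' : DifferentiableAt ℝ f' x) :
    pd k (fun y => f y * f' y) x = pd k f x * f' x + f x * pd k f' x := by
  simp only [pd]; rw [fderiv_fun_mul hf hf']
  simp [mul_comm]; ring

theorem pd_const_mul (k : Fin 3) (c : ℝ) (hf : DifferentiableAt ℝ f x) :
    pd k (fun y => c * f y) x = c * pd k f x := by
  simp only [pd]; rw [fderiv_const_mul hf]; rfl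

theorem pd_sum (k : Fin 3) {F : Fin 3 → Pt → ℝ} (hF : ∀ i, DifferentiableAt ℝ (F i) x) :
    pd k (fun y => ∑ i, F i y) x = ∑ i, pd k (F i) x := by
  simp only [pd]; rw [fderiv_fun_sum fun i _ => hF i]; simp

theorem pd_comp (k : Fin 3) {φ : ℝ → ℝ} {φ' : ℝ} (hφ : HasDerivAt φ φ' (f x))
    (hf : DifferentiableAt ℝ f x) : pd k (fun y => φ (f y)) x = φ' * pd k f x := by
  have h := hφ.comp_hasFDerivAt x hf.hasFDerivAt
  simp only [pd]
  rw [show (fun y => φ (f y)) = φ ∘ f from rfl, h.fderiv]; simp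

theorem contDiffAt_pd {n m : ℕ∞ω} (k : Fin 3) (hf : ContDiffAt ℝ n f x) (h : m + 1 ≤ n) :
    ContDiffAt ℝ m (pd k f) x :=
  (hf.fderiv_right h).clm_apply contDiffAt_const

theorem _root_.ContDiffAt.pd (k : Fin 3) (hf : ContDiffAt ℝ ∞ f x) :
    ContDiffAt ℝ ∞ (Regge3D.pd k f) x :=
  contDiffAt_pd k hf (by simp)

theorem _root_.ContDiffAt.diffAt (hf : ContDiffAt ℝ ∞ f x) : DifferentiableAt ℝ f x :=
  hf.differentiableAt (by simp)

theorem pd_comm (i j : Fin 3) (hf : ContDiffAt ℝ ∞ f x) :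
    pd i (pd j f) x = pd j (pd i f) x := by
  have h : ∀ k l, pd k (pd l f) x = fderiv ℝ (fderiv ℝ f) x (EuclideanSpace.single k 1)
      (EuclideanSpace.single l 1) := by
    intro k l
    have hd : DifferentiableAt ℝ (fderiv ℝ f) x :=
      (hf.fderiv_right (m := 1) (by norm_cast)).differentiableAt (by simp)
    change fderiv ℝ (fun y => fderiv ℝ f y (EuclideanSpace.single l 1)) x _ = _
    rw [fderiv_clm_apply hd (differentiableAt_const _)]
    simp
  rw [h, h]
  exact (hf.isSymmSndFDerivAt (by simp only [minSmoothness_of_isRCLikeNormedField]; norm_cast)) _ _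

end pd

/-- `G` is a symmetric field which near `x` is a metric of class `C^n`. -/
structure MetricAt (n : ℕ∞ω) (G : Pt → Mat) (x : Pt) : Prop where
  isSymm : ∀ y, (G y).IsSymm
  smooth : ∀ i j, ContDiffAt ℝ n (fun y => G y i j) x
  det_pos : 0 < (G x).det

/-- The Christoffel symbols of the first kind. -/
def christoffelLow (G : Pt → Mat) (x : Pt) (l i j : Fin 3) : ℝ :=
  1 / 2 * (pd i (fun y => G y j l) x + pd j (fun y => G y i l) x - pd l (fun y => G y i j) x)

section levi
variable {G : Pt → Mat} {x : Pt} {n : ℕ∞ω}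

theorem MetricAt.isMetric (h : MetricAt n G x) : IsMetric (G x) := ⟨h.isSymm x, h.det_pos⟩

theorem MetricAt.mono {m : ℕ∞ω} (h : MetricAt n G x) (hm : m ≤ n) : MetricAt m G x :=
  ⟨h.isSymm, fun i j => (h.smooth i j).of_le hm, h.det_pos⟩

theorem contDiffAt_det (h : ∀ i j, ContDiffAt ℝ n (fun y => G y i j) x) :
    ContDiffAt ℝ n (fun y => (G y).det) x := by
  simp only [Matrix.det_fin_three]
  have := h
  fun_prop

theorem contDiffAt_inv (h : ∀ i j, ContDiffAt ℝ n (fun y => G y i j) x) (hd : (G x).det ≠ 0)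
    (i j : Fin 3) : ContDiffAt ℝ n (fun y => (G y)⁻¹ i j) x := by
  have h1 : ContDiffAt ℝ n (fun y => ((G y).det)⁻¹) x := (contDiffAt_det h).fun_inv hd
  have h2 : ContDiffAt ℝ n (fun y => (G y).adjugate i j) x := by
    simp only [Matrix.adjugate_fin_three]
    fin_cases i <;> fin_cases j <;> simp <;> fun_prop
  simp only [Matrix.inv_def, Matrix.smul_apply, Ring.inverse_eq_inv', smul_eq_mul]
  exact h1.mul h2

theorem MetricAt.eventually (h : MetricAt 1 G x) : ∀ᶠ y in nhds x, MetricAt 1 G y := by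
  have h1 : ∀ᶠ y in nhds x, ∀ i j, ContDiffAt ℝ 1 (fun y => G y i j) y := by
    simp only [Filter.eventually_all]
    exact fun i j => (h.smooth i j).eventually (by simp)
  have h2 : ∀ᶠ y in nhds x, 0 < (G y).det :=
    (contDiffAt_det h.smooth).continuousAt.eventually (lt_mem_nhds h.det_pos)
  filter_upwards [h1, h2] with y hy1 hy2
  exact ⟨h.isSymm, hy1, hy2⟩

theorem MetricAt.contDiffAt_inv (h : MetricAt n G x) (i j : Fin 3) :
    ContDiffAt ℝ n (fun y => (G y)⁻¹ i j) x :=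
  Regge3D.contDiffAt_inv h.smooth h.det_pos.ne' i j

theorem MetricAt.contDiffAt_christoffelLow (h : MetricAt ∞ G x) (l i j : Fin 3) :
    ContDiffAt ℝ ∞ (fun y => christoffelLow G y l i j) x := by
  unfold christoffelLow
  exact contDiffAt_const.mul ((((h.smooth _ _).pd _).add ((h.smooth _ _).pd _)).sub
    ((h.smooth _ _).pd _))

theorem christoffel_eq (G : Pt → Mat) (x : Pt) (k i j : Fin 3) :
    christoffel G x k i j = ∑ l, (G x)⁻¹ k l * christoffelLow G x l i j := by
  simp only [christoffel, christoffelLow]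
  exact Finset.sum_congr rfl fun l _ => by ring

theorem MetricAt.contDiffAt_christoffel (h : MetricAt ∞ G x) (k i j : Fin 3) :
    ContDiffAt ℝ ∞ (fun y => christoffel G y k i j) x := by
  simp only [christoffel_eq]
  exact ContDiffAt.sum fun l _ => (h.contDiffAt_inv k l).mul (h.contDiffAt_christoffelLow l i j)

theorem pd_symm (hs : ∀ y, (G y).IsSymm) (k i j : Fin 3) (x : Pt) :
    pd k (fun y => G y i j) x = pd k (fun y => G y j i) x := by
  simp only [fun y => (hs y).apply i j]

theorem christoffelLow_symm (hs : ∀ y, (G y).IsSymm) (x : Pt) (l i j : Fin 3) :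
    christoffelLow G x l i j = christoffelLow G x l j i := by
  simp only [christoffelLow, pd_symm hs l i j]; ring

theorem christoffel_symm (hs : ∀ y, (G y).IsSymm) (x : Pt) (k i j : Fin 3) :
    christoffel G x k i j = christoffel G x k j i := by
  simp only [christoffel_eq, christoffelLow_symm hs x _ i j]

theorem lower_christoffel (h : MetricAt n G x) (l i j : Fin 3) :
    ∑ m, G x l m * christoffel G x m i j = christoffelLow G x l i j := by
  have h1 : (G x *ᵥ ((G x)⁻¹ *ᵥ fun l => christoffelLow G x l i j)) l
      = christoffelLow G x l i j := by
    rw [Matrix.mulVec_mulVec, mul_inv_self h.isMetric, Matrix.one_mulVec]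
  rw [← h1]
  simp only [christoffel_eq, Matrix.mulVec, dotProduct]

/-- Metric compatibility of the connection, in terms of the symbols of the first kind. -/
theorem pd_metric (hs : ∀ y, (G y).IsSymm) (x : Pt) (k i j : Fin 3) :
    pd k (fun y => G y i j) x = christoffelLow G x i k j + christoffelLow G x j k i := by
  simp only [christoffelLow, pd_symm hs k j i, pd_symm hs j k i]
  rw [pd_symm hs i k j]; ring

theorem pd_metric_christoffel (h : MetricAt n G x) (k i j : Fin 3) :
    pd k (fun y => G y i j) x
      = ∑ m, (G x m j * christoffel G x m k i + G x i m * christoffel G x m k j) := by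
  rw [pd_metric h.isSymm, ← lower_christoffel h, ← lower_christoffel h, add_comm,
    Finset.sum_add_distrib]
  congr 1
  exact Finset.sum_congr rfl fun m _ => by rw [(h.isSymm x).apply]

theorem pd_christoffelLow (h : MetricAt ∞ G x) (k l i j : Fin 3) :
    pd k (fun y => christoffelLow G y l i j) x = 1 / 2 * (pd k (pd i fun y => G y j l) x
      + pd k (pd j fun y => G y i l) x - pd k (pd l fun y => G y i j) x) := by
  have hd : ∀ a b c, DifferentiableAt ℝ (pd a fun y => G y b c) x :=
    fun a b c => ((h.smooth b c).pd a).diffAt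
  unfold christoffelLow
  rw [pd_const_mul k _ (((hd _ _ _).fun_add (hd _ _ _)).fun_sub (hd _ _ _)),
    pd_sub k ((hd _ _ _).fun_add (hd _ _ _)) (hd _ _ _), pd_add k (hd _ _ _) (hd _ _ _)]

/-- The derivative of the symbols of the second kind, with the upper index lowered. -/
theorem lower_pd_christoffel (h : MetricAt ∞ G x) (i j k l : Fin 3) :
    ∑ m, G x m l * pd i (fun y => christoffel G y m j k) x
      = pd i (fun y => christoffelLow G y l j k) x
        - ∑ m, (christoffelLow G x l i m + christoffelLow G x m i l) * christoffel G x m j k := by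
  have hG : ∀ a b, DifferentiableAt ℝ (fun y => G y a b) x := fun a b => (h.smooth a b).diffAt
  have hΓ : ∀ a b c, DifferentiableAt ℝ (fun y => christoffel G y a b c) x :=
    fun a b c => (h.contDiffAt_christoffel a b c).diffAt
  have h1 : pd i (fun y => ∑ m, G y l m * christoffel G y m j k) x
      = pd i (fun y => christoffelLow G y l j k) x :=
    pd_congr i ((h.mono (by norm_cast)).eventually.mono fun y hy => lower_christoffel hy l j k)
  rw [pd_sum i fun m => (hG l m).fun_mul (hΓ m j k)] at h1
  rw [← h1, ← Finset.sum_sub_distrib]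
  refine Finset.sum_congr rfl fun m _ => ?_
  rw [pd_mul i (hG l m) (hΓ m j k), pd_metric h.isSymm x i l m, (h.isSymm x).apply l m]
  ring

/-- The Riemann tensor in a form in which its symmetries are visible. -/
theorem riemann_eq (h : MetricAt ∞ G x) (i j k l : Fin 3) :
    riemann G x i j k l = 1 / 2 * (pd i (pd k fun y => G y j l) x - pd i (pd l fun y => G y j k) x
        - pd j (pd k fun y => G y i l) x + pd j (pd l fun y => G y i k) x)
      + ∑ m, ∑ p, G x m p * (christoffel G x p j l * christoffel G x m i k
        - christoffel G x p i l * christoffel G x m j k) := by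
  have h1 : riemann G x i j k l = ∑ m, G x m l * pd i (fun y => christoffel G y m j k) x
      - ∑ m, G x m l * pd j (fun y => christoffel G y m i k) x
      + ∑ p, ((∑ m, G x l m * christoffel G x m i p) * christoffel G x p j k
        - (∑ m, G x l m * christoffel G x m j p) * christoffel G x p i k) := by
    simp only [riemann, Fin.sum_univ_three, (h.isSymm x).apply l]
    ring
  rw [h1, lower_pd_christoffel h, lower_pd_christoffel h, pd_christoffelLow h,
    pd_christoffelLow h, pd_comm i j (h.smooth k l)]
  have h2 : ∀ m, ∑ p, G x m p * (christoffel G x p j l * christoffel G x m i k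
        - christoffel G x p i l * christoffel G x m j k) =
      christoffelLow G x m j l * christoffel G x m i k
        - christoffelLow G x m i l * christoffel G x m j k := by
    intro m
    simp only [← lower_christoffel h, Finset.sum_mul, ← Finset.sum_sub_distrib]
    exact Finset.sum_congr rfl fun p _ => by ring
  simp only [h2, lower_christoffel h, Fin.sum_univ_three]
  ring

theorem riemann_skew_first (h : MetricAt ∞ G x) (i j k l : Fin 3) :
    riemann G x i j k l = -riemann G x j i k l := by
  rw [riemann_eq h, riemann_eq h]
  simp only [Fin.sum_univ_three]
  ring

theorem riemann_pair_symm (h : MetricAt ∞ G x) (i j k l : Fin 3) :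
    riemann G x i j k l = riemann G x k l i j := by
  have hc : ∀ a b c d, pd a (pd b fun y => G y c d) x = pd b (pd a fun y => G y d c) x := by
    intro a b c d
    rw [pd_comm a b (h.smooth c d)]
    simp only [fun y => (h.isSymm y).apply c d]
  rw [riemann_eq h, riemann_eq h, hc i k, hc i l, hc j k, hc j l]
  simp only [Fin.sum_univ_three, fun p => christoffel_symm h.isSymm x p l j,
    fun p => christoffel_symm h.isSymm x p k i, fun p => christoffel_symm h.isSymm x p k j,
    fun p => christoffel_symm h.isSymm x p l i, (h.isSymm x).apply 0 1, (h.isSymm x).apply 0 2,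
    (h.isSymm x).apply 1 2]
  ring

theorem riemann_skew_last (h : MetricAt ∞ G x) (i j k l : Fin 3) :
    riemann G x i j k l = -riemann G x i j l k := by
  rw [riemann_pair_symm h, riemann_skew_first h, riemann_pair_symm h l k]

theorem curvOp_isSymm (h : MetricAt ∞ G x) : (curvOp G x).IsSymm :=
  lower_isSymm (h.isSymm x) (curvUp_isSymm (riemann_pair_symm h))

theorem AA_curvOp (h : MetricAt ∞ G x) : AA (G x) (curvOp G x) = riemann G x :=
  AA_curvUp h.isMetric (riemann_skew_first h) (riemann_skew_last h) (riemann_pair_symm h)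

theorem AA_eq_riemann_iff (h : MetricAt ∞ G x) {W : Mat} (hW : W.IsSymm) :
    AA (G x) W = riemann G x ↔ W = curvOp G x := by
  constructor
  · intro hA
    rw [curvOp_eq, ← hA, curvUp_AA h.isMetric hW, lower_raise h.isMetric]
  · rintro rfl
    exact AA_curvOp h

end levi

/-! ### The curl and the incompatibility operator as covariant derivatives -/

/-- The tensor `ε̂^{pql} g_{lj}`, which turns a 2-form into its Hodge star. -/
def starTensor (g : Mat) (p q j : Fin 3) : ℝ := ∑ l, eps p q l / Real.sqrt g.det * g l j

theorem starTensor_swap (g : Mat) (p q j : Fin 3) : starTensor g q p j = -starTensor g p q j := by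
  simp only [starTensor, eps_swap12 p q, ← Finset.sum_neg_distrib]
  exact Finset.sum_congr rfl fun l _ => by ring

section curl
variable {G σ : Pt → Mat} {x : Pt} {n : ℕ∞ω}

/-- The covariant derivative of the vector field `L_σ ∂_q`, lowered with the metric. -/
theorem lower_covVec_endo (h : MetricAt 1 G x)
    (hσ : ∀ i j, DifferentiableAt ℝ (fun y => σ y i j) x) (i p q : Fin 3) :
    ∑ k, G x i k * covVec G (fun y m => endo (G y) (σ y) m q) x p k
      = cov2 G σ x p i q + ∑ m, christoffel G x m p q * σ x i m := by
  have hG : ∀ a b, DifferentiableAt ℝ (fun y => G y a b) x :=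
    fun a b => (h.smooth a b).differentiableAt (by simp)
  have hL : ∀ a b, DifferentiableAt ℝ (fun y => endo (G y) (σ y) a b) x := by
    intro a b
    simp only [endo, Matrix.mul_apply]
    exact DifferentiableAt.fun_sum fun m _ =>
      ((h.contDiffAt_inv a m).differentiableAt (by simp)).fun_mul (hσ m b)
  have hgl : ∀ y, MetricAt 1 G y → ∀ a, ∑ k, G y a k * endo (G y) (σ y) k q = σ y a q := by
    intro y hy a
    rw [← Matrix.mul_apply, endo, ← Matrix.mul_assoc, mul_inv_self hy.isMetric, Matrix.one_mul]
  have h1 : pd p (fun y => ∑ k, G y i k * endo (G y) (σ y) k q) x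
      = pd p (fun y => σ y i q) x := pd_congr p (h.eventually.mono fun y hy => hgl y hy i)
  rw [pd_sum p fun k => (hG i k).fun_mul (hL k q)] at h1
  simp only [pd_mul p (hG i _) (hL _ q), pd_metric h.isSymm x p i, Finset.sum_add_distrib] at h1
  have h2 : ∑ k, christoffelLow G x k p i * endo (G x) (σ x) k q
      = ∑ m, christoffel G x m p i * σ x m q := by
    simp only [← lower_christoffel h, ← hgl x h, Finset.mul_sum, Finset.sum_mul]
    rw [Finset.sum_comm]
    refine Finset.sum_congr rfl fun m _ => Finset.sum_congr rfl fun k _ => ?_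
    rw [(h.isSymm x).apply k m]; ring
  have h3 : ∑ k, G x i k * ∑ m, christoffel G x k p m * endo (G x) (σ x) m q
      = ∑ m, christoffelLow G x i p m * endo (G x) (σ x) m q := by
    simp only [← lower_christoffel h, Finset.mul_sum, Finset.sum_mul]
    rw [Finset.sum_comm]
    refine Finset.sum_congr rfl fun m _ => Finset.sum_congr rfl fun k _ => ?_
    ring
  simp only [covVec, mul_add, Finset.sum_add_distrib, h3, cov2]
  simp only [add_mul, Finset.sum_add_distrib] at h1
  linarith

/-- The curl is a contraction of `∇σ`: the Christoffel symbols of the form index cancel, as they are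
symmetric. -/
theorem curl_eq (h : MetricAt 1 G x)
    (hσ : ∀ i j, DifferentiableAt ℝ (fun y => σ y i j) x) (i j : Fin 3) :
    curl G σ x i j = ∑ p, ∑ q, starTensor (G x) p q j * cov2 G σ x p i q := by
  have h1 : curl G σ x i j = ∑ p, ∑ q, 1 / 2 * starTensor (G x) p q j *
      ((cov2 G σ x p i q + ∑ m, christoffel G x m p q * σ x i m)
        - (cov2 G σ x q i p + ∑ m, christoffel G x m q p * σ x i m)) := by
    simp only [← lower_covVec_endo h hσ, curl, hodge2_eq h.isMetric, Finset.mul_sum]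
    rw [Finset.sum_comm]
    refine Finset.sum_congr rfl fun p _ => ?_
    rw [Finset.sum_comm]
    refine Finset.sum_congr rfl fun q _ => ?_
    rw [← Finset.sum_sub_distrib, Finset.mul_sum]
    refine Finset.sum_congr rfl fun k _ => ?_
    rw [← Finset.mul_sum, ← Finset.mul_sum, extCov, starTensor]
    ring
  have h2 : ∀ p q, 1 / 2 * starTensor (G x) p q j *
      ((cov2 G σ x p i q + ∑ m, christoffel G x m p q * σ x i m)
        - (cov2 G σ x q i p + ∑ m, christoffel G x m q p * σ x i m))
      = 1 / 2 * (starTensor (G x) p q j * cov2 G σ x p i q)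
        + 1 / 2 * (starTensor (G x) q p j * cov2 G σ x q i p) := by
    intro p q
    simp only [fun m => christoffel_symm h.isSymm x m q p, starTensor_swap (G x) p q]
    ring
  rw [h1]
  simp only [h2, Finset.sum_add_distrib]
  rw [Finset.sum_comm (f := fun p q => 1 / 2 * (starTensor (G x) q p j * cov2 G σ x q i p))]
  simp only [← Finset.mul_sum]
  ring

/-- A linear map, acting as a derivation, multiplies the volume form by its trace. -/
theorem eps_trace (Γ : Fin 3 → Fin 3 → ℝ) (a b m : Fin 3) :
    ∑ l, (Γ a l * eps l b m + Γ b l * eps a l m + Γ m l * eps a b l)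
      = (∑ l, Γ l l) * eps a b m := by
  fin_cases a <;> fin_cases b <;> fin_cases m <;> (simp [eps, Fin.sum_univ_three]; try ring)

theorem pd_det (h : MetricAt 1 G x) (k : Fin 3) :
    pd k (fun y => (G y).det) x = 2 * (∑ m, christoffel G x m k m) * (G x).det := by
  have hG : ∀ a b, DifferentiableAt ℝ (fun y => G y a b) x :=
    fun a b => (h.smooth a b).differentiableAt (by simp)
  have h3 : ∀ a b c d e f, DifferentiableAt ℝ (fun y => G y a b * G y c d * G y e f) x :=
    fun a b c d e f => ((hG a b).fun_mul (hG c d)).fun_mul (hG e f)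
  have hp : ∀ a b c d e f, pd k (fun y => G y a b * G y c d * G y e f) x
      = (pd k (fun y => G y a b) x * G x c d + G x a b * pd k (fun y => G y c d) x) * G x e f
        + G x a b * G x c d * pd k (fun y => G y e f) x := by
    intro a b c d e f
    rw [pd_mul k ((hG a b).fun_mul (hG c d)) (hG e f), pd_mul k (hG a b) (hG c d)]
  simp only [Matrix.det_fin_three]
  rw [pd_sub, pd_add, pd_add, pd_sub, pd_sub] <;> try fun_prop
  simp only [hp, pd_metric_christoffel h k, Fin.sum_univ_three, (h.isSymm x).apply 0 1,
    (h.isSymm x).apply 0 2, (h.isSymm x).apply 1 2]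
  ring

theorem hasDerivAt_inv_sqrt {t : ℝ} (ht : 0 < t) :
    HasDerivAt (fun t => (Real.sqrt t)⁻¹) (-((Real.sqrt t)⁻¹ / (2 * t))) t := by
  have hs := Real.sqrt_pos.2 ht
  have h := (Real.hasDerivAt_sqrt ht.ne').fun_inv hs.ne'
  have h2 : Real.sqrt t ^ 2 = t := Real.sq_sqrt ht.le
  have e : -((Real.sqrt t)⁻¹ / (2 * t)) = -(1 / (2 * Real.sqrt t)) / Real.sqrt t ^ 2 := by
    rw [h2]
    field_simp
  rw [e]
  exact h

theorem pd_inv_sqrt_det (h : MetricAt 1 G x) (k : Fin 3) :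
    pd k (fun y => (Real.sqrt (G y).det)⁻¹) x
      = -(Real.sqrt (G x).det)⁻¹ * ∑ m, christoffel G x m k m := by
  rw [pd_comp k (f := fun y => (G y).det) (hasDerivAt_inv_sqrt h.det_pos)
    ((contDiffAt_det h.smooth).differentiableAt (by simp)), pd_det h]
  have := h.det_pos.ne'
  field_simp

theorem contDiffAt_starTensor (h : MetricAt n G x) (p q j : Fin 3) :
    ContDiffAt ℝ n (fun y => starTensor (G y) p q j) x := by
  have hs : ContDiffAt ℝ n (fun y => (Real.sqrt (G y).det)⁻¹) x :=
    ((contDiffAt_det h.smooth).sqrt h.det_pos.ne').fun_inv (Real.sqrt_pos.2 h.det_pos).ne'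
  simp only [starTensor, div_eq_mul_inv]
  exact ContDiffAt.sum fun l _ => (contDiffAt_const.mul hs).mul (h.smooth l j)

/-- The tensor `ε̂^{pql} g_{lj}` is covariantly constant. -/
theorem pd_starTensor (h : MetricAt 1 G x) (k a b i : Fin 3) :
    pd k (fun y => starTensor (G y) a b i) x
      = ∑ m, (christoffel G x m k i * starTensor (G x) a b m
        - christoffel G x a k m * starTensor (G x) m b i
        - christoffel G x b k m * starTensor (G x) a m i) := by
  have hG : ∀ a b, DifferentiableAt ℝ (fun y => G y a b) x :=
    fun a b => (h.smooth a b).differentiableAt (by simp)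
  have hs : DifferentiableAt ℝ (fun y => (Real.sqrt (G y).det)⁻¹) x :=
    (((contDiffAt_det h.smooth).sqrt h.det_pos.ne').fun_inv
      (Real.sqrt_pos.2 h.det_pos).ne').differentiableAt (by simp)
  have e : (fun y => starTensor (G y) a b i)
      = fun y => ∑ l, eps a b l * ((Real.sqrt (G y).det)⁻¹ * G y l i) := by
    funext y
    simp only [starTensor]
    exact Finset.sum_congr rfl fun l _ => by ring
  rw [e, pd_sum k fun l => (hs.fun_mul (hG l i)).const_mul _]
  simp only [pd_const_mul k _ (hs.fun_mul (hG _ i)), pd_mul k hs (hG _ i), pd_inv_sqrt_det h,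
    pd_metric_christoffel h k, starTensor, div_eq_mul_inv]
  have t := fun m => eps_trace (fun c l => christoffel G x c k l) a b m
  have t0 := t 0
  have t1 := t 1
  have t2 := t 2
  simp only [Fin.sum_univ_three] at t0 t1 t2 ⊢
  generalize (Real.sqrt (G x).det)⁻¹ = r
  linear_combination r * G x 0 i * t0 + r * G x 1 i * t1 + r * G x 2 i * t2

theorem contDiffAt_cov2 (h : MetricAt ∞ G x) (hσ : ∀ i j, ContDiffAt ℝ ∞ (fun y => σ y i j) x)
    (k i j : Fin 3) : ContDiffAt ℝ ∞ (fun y => cov2 G σ y k i j) x := by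
  unfold cov2
  exact (((hσ i j).pd k).sub (ContDiffAt.sum fun m _ =>
    (h.contDiffAt_christoffel _ _ _).mul (hσ _ _))).sub (ContDiffAt.sum fun m _ =>
    (h.contDiffAt_christoffel _ _ _).mul (hσ _ _))

theorem eventually_curl_eq (h : MetricAt ∞ G x)
    (hσ : ∀ i j, ContDiffAt ℝ ∞ (fun y => σ y i j) x) (i j : Fin 3) :
    (fun y => curl G σ y i j) =ᶠ[nhds x]
      fun y => ∑ p, ∑ q, starTensor (G y) p q j * cov2 G σ y p i q := by
  have h1 : ∀ᶠ y in nhds x, ∀ i j, DifferentiableAt ℝ (fun z => σ z i j) y := by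
    simp only [Filter.eventually_all]
    exact fun i j => (((hσ i j).of_le (m := 1) (by norm_cast)).eventually (by simp)).mono
      fun y hy => hy.differentiableAt (by simp)
  filter_upwards [(h.mono (by norm_cast)).eventually, h1] with y hy1 hy2
  exact curl_eq hy1 hy2 i j

theorem contDiffAt_curl (h : MetricAt ∞ G x)
    (hσ : ∀ i j, ContDiffAt ℝ ∞ (fun y => σ y i j) x) (i j : Fin 3) :
    ContDiffAt ℝ ∞ (fun y => curl G σ y i j) x := by
  refine ContDiffAt.congr_of_eventuallyEq ?_ (eventually_curl_eq h hσ i j)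
  exact ContDiffAt.sum fun p _ => ContDiffAt.sum fun q _ =>
    (contDiffAt_starTensor h p q j).mul (contDiffAt_cov2 h hσ p i q)

/-- The covariant derivative passes through the curl. -/
theorem cov2_curl_transpose (h : MetricAt ∞ G x)
    (hσ : ∀ i j, ContDiffAt ℝ ∞ (fun y => σ y i j) x) (r i s : Fin 3) :
    cov2 G (fun y => (curl G σ y)ᵀ) x r i s
      = ∑ p, ∑ q, starTensor (G x) p q i * cov2cov2 G σ x r p s q := by
  have h1 : MetricAt 1 G x := h.mono (by norm_cast)
  have hC : ∀ p q i, DifferentiableAt ℝ (fun y => starTensor (G y) p q i) x :=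
    fun p q i => (contDiffAt_starTensor h p q i).diffAt
  have hN : ∀ p q i, DifferentiableAt ℝ (fun y => cov2 G σ y p q i) x :=
    fun p q i => (contDiffAt_cov2 h hσ p q i).diffAt
  have e1 : pd r (fun y => (curl G σ y)ᵀ i s) x
      = ∑ p, ∑ q, (pd r (fun y => starTensor (G y) p q i) x * cov2 G σ x p s q
        + starTensor (G x) p q i * pd r (fun y => cov2 G σ y p s q) x) := by
    refine (pd_congr r (eventually_curl_eq h hσ s i)).trans ?_
    rw [pd_sum r fun p =>
      DifferentiableAt.fun_sum fun q _ => (hC p q i).fun_mul (hN p s q)]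
    refine Finset.sum_congr rfl fun p _ => ?_
    rw [pd_sum r fun q => (hC p q i).fun_mul (hN p s q)]
    exact Finset.sum_congr rfl fun q _ => pd_mul r (hC p q i) (hN p s q)
  have e2 : ∀ a b, (curl G σ x)ᵀ a b
      = ∑ p, ∑ q, starTensor (G x) p q a * cov2 G σ x p b q := fun a b =>
    curl_eq h1 (fun i j => (hσ i j).diffAt) b a
  simp only [cov2cov2]
  rw [cov2, e1]
  simp only [e2, pd_starTensor h1]
  generalize starTensor (G x) = C
  generalize cov2 G σ x = N
  generalize christoffel G x = Γ
  simp only [Fin.sum_univ_three]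
  ring

/-- The incompatibility operator is a contraction of the second covariant derivative. -/
theorem inc_eq (h : MetricAt ∞ G x) (hσ : ∀ i j, ContDiffAt ℝ ∞ (fun y => σ y i j) x) :
    inc G σ x = lower (G x) (incUp (G x) (cov2cov2 G σ x)) := by
  ext i j
  have h1 := curl_eq (σ := fun y => (curl G σ y)ᵀ) (h.mono (by norm_cast))
    (fun i j => (contDiffAt_curl h hσ j i).diffAt) i j
  refine h1.trans ?_
  have hs := h.isSymm x
  have h2 : lower (G x) (incUp (G x) (cov2cov2 G σ x)) i j = ∑ r, ∑ s, ∑ p, ∑ q, ∑ a, ∑ b,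
      G x i a * G x j b * ((eps r s b / Real.sqrt (G x).det) *
        (eps p q a / Real.sqrt (G x).det) * cov2cov2 G σ x r p s q) := by
    simp only [lower, incUp, Finset.mul_sum]
    exact (sum_comm_four_two _).symm
  rw [h2]
  simp only [cov2_curl_transpose h hσ, starTensor]
  refine Finset.sum_congr rfl fun r _ => Finset.sum_congr rfl fun s _ => ?_
  rw [Finset.mul_sum]
  refine Finset.sum_congr rfl fun p _ => ?_
  rw [Finset.mul_sum]
  refine Finset.sum_congr rfl fun q _ => ?_
  simp only [Fin.sum_univ_three, hs.apply i, hs.apply j]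
  ring

end curl

/-! ### Orthonormal frames adapted to a facet -/

/-- The Euclidean cross product, as a covector. -/
def crossCov (X Y : Vec) : Vec := fun l => ∑ a, ∑ b, eps a b l * X a * Y b

theorem crossCov_eq (X Y : Vec) :
    crossCov X Y = ![X 1 * Y 2 - X 2 * Y 1, X 2 * Y 0 - X 0 * Y 2, X 0 * Y 1 - X 1 * Y 0] := by
  funext l
  fin_cases l <;> (simp [crossCov, eps, Fin.sum_univ_three]; ring)

theorem cross_eq (g : Mat) (X Y : Vec) :
    cross g X Y = Real.sqrt g.det • (g⁻¹ *ᵥ crossCov X Y) := by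
  funext i
  simp only [cross, crossCov, Pi.smul_apply, Matrix.mulVec, dotProduct, smul_eq_mul,
    Finset.mul_sum]
  refine Finset.sum_congr rfl fun l _ => Finset.sum_congr rfl fun a _ =>
    Finset.sum_congr rfl fun b _ => ?_
  ring

theorem ev_eq (B : Mat) (X Y : Vec) : ev B X Y = X ⬝ᵥ (B *ᵥ Y) := by
  simp only [ev, dotProduct, Matrix.mulVec, Finset.mul_sum]
  exact Finset.sum_congr rfl fun i _ => Finset.sum_congr rfl fun j _ => by ring

theorem ev_comm {B : Mat} (hB : B.IsSymm) (X Y : Vec) : ev B X Y = ev B Y X := by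
  simp only [ev, Fin.sum_univ_three, hB.apply 0 1, hB.apply 0 2, hB.apply 1 2]
  ring

theorem flat_eq {g : Mat} (hg : g.IsSymm) (X : Vec) : flat g X = g *ᵥ X := by
  funext j
  simp only [flat, Matrix.mulVec, dotProduct]
  exact Finset.sum_congr rfl fun i _ => by rw [hg.apply]

/-- Lagrange's identity for a symmetric form. -/
theorem ev_adjugate_crossCov {g : Mat} (hg : g.IsSymm) (X Y : Vec) :
    ev g.adjugate (crossCov X Y) (crossCov X Y)
      = ev g X X * ev g Y Y - ev g X Y ^ 2 := by
  simp only [crossCov_eq, ev, Matrix.adjugate_fin_three, Fin.sum_univ_three]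
  simp [hg.apply 0 1, hg.apply 0 2, hg.apply 1 2]
  ring

theorem adjugate_eq_det_smul_inv {g : Mat} (hg : IsMetric g) : g.adjugate = g.det • g⁻¹ := by
  rw [Matrix.inv_def, smul_smul, Ring.inverse_eq_inv', mul_inv_cancel₀ hg.det_pos.ne', one_smul]

theorem ev_smul_matrix (c : ℝ) (B : Mat) (X Y : Vec) : ev (c • B) X Y = c * ev B X Y := by
  simp only [ev, Finset.mul_sum, Matrix.smul_apply, smul_eq_mul]
  exact Finset.sum_congr rfl fun i _ => Finset.sum_congr rfl fun j _ => by ring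

theorem ev_smul_smul (c d : ℝ) (B : Mat) (X Y : Vec) :
    ev B (c • X) (d • Y) = c * d * ev B X Y := by
  simp only [ev, Finset.mul_sum, Pi.smul_apply, smul_eq_mul]
  exact Finset.sum_congr rfl fun i _ => Finset.sum_congr rfl fun j _ => by ring

theorem ev_inv_mulVec {g : Mat} (hg : IsMetric g) (α β : Vec) :
    ev g (g⁻¹ *ᵥ α) (g⁻¹ *ᵥ β) = ev g⁻¹ α β := by
  rw [ev_eq, ev_eq, Matrix.mulVec_mulVec, mul_inv_self hg, Matrix.one_mulVec]
  conv_lhs => rw [← (inv_isSymm hg.isSymm).eq, Matrix.mulVec_transpose, ← Matrix.dotProduct_mulVec]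

theorem ev_cross_self {g : Mat} (hg : IsMetric g) (X Y : Vec) :
    ev g (cross g X Y) (cross g X Y) = ev g X X * ev g Y Y - ev g X Y ^ 2 := by
  rw [cross_eq, ev_smul_smul, ev_inv_mulVec hg, Real.mul_self_sqrt hg.det_pos.le,
    ← ev_smul_matrix, ← adjugate_eq_det_smul_inv hg, ev_adjugate_crossCov hg.isSymm]

theorem ev_cross_right {g : Mat} (hg : IsMetric g) (X Y Z : Vec) :
    ev g Z (cross g X Y) = Real.sqrt g.det * (Z ⬝ᵥ crossCov X Y) := by
  rw [cross_eq, ev_eq, Matrix.mulVec_smul, Matrix.mulVec_mulVec, mul_inv_self hg,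
    Matrix.one_mulVec, dotProduct_smul, smul_eq_mul]

/-- A positively oriented `g`-orthonormal frame, the columns of `E`, with last vector `n`. -/
structure IsFrame (g : Mat) (n : Vec) (E : Mat) : Prop where
  isMetric : IsMetric g
  orthonormal : Eᵀ * g * E = 1
  sqrt_mul_det : Real.sqrt g.det * E.det = 1
  col_two : ∀ i, E i 2 = n i

theorem ev_eq_mul (B E : Mat) (i j : Fin 3) :
    (Eᵀ * B * E) i j = ev B (fun k => E k i) (fun k => E k j) := by
  simp only [ev, Matrix.mul_apply, Matrix.transpose_apply, Fin.sum_univ_three]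
  ring

/-- Two orthonormal vectors `n`, `μ` are completed to a frame by `n × μ`. -/
theorem isFrame_of_orthonormal {g : Mat} (hg : IsMetric g) {n μ : Vec} (hn : ev g n n = 1)
    (hμ : ev g μ μ = 1) (hnμ : ev g n μ = 0) :
    IsFrame g n (Matrix.of fun i j => ![μ i, cross g n μ i, n i] j) := by
  set E : Mat := Matrix.of fun i j => ![μ i, cross g n μ i, n i] j with hE
  have e0 : (fun k => E k 0) = μ := rfl
  have e1 : (fun k => E k 1) = cross g n μ := rfl
  have e2 : (fun k => E k 2) = n := rfl
  have hτ : ev g (cross g n μ) (cross g n μ) = 1 := by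
    rw [ev_cross_self hg, hn, hμ, hnμ]; norm_num
  have h1 : ev g n (cross g n μ) = 0 := by
    rw [ev_cross_right hg, crossCov_eq]
    simp only [dotProduct, Fin.sum_univ_three]
    simp; right; ring
  have h2 : ev g μ (cross g n μ) = 0 := by
    rw [ev_cross_right hg, crossCov_eq]
    simp only [dotProduct, Fin.sum_univ_three]
    simp; right; ring
  refine ⟨hg, ?_, ?_, fun i => rfl⟩
  · ext i j
    rw [ev_eq_mul]
    fin_cases i <;> fin_cases j <;>
      simp only [Fin.zero_eta, Fin.mk_one, Fin.reduceFinMk, e0, e1, e2, hn, hμ, hτ, h1, h2, hnμ,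
        ev_comm hg.isSymm (cross g n μ), ev_comm hg.isSymm μ n, Matrix.one_apply] <;> simp
  · rw [← hτ, ev_cross_right hg, crossCov_eq, Matrix.det_fin_three E]
    congr 1
    simp only [dotProduct, Fin.sum_univ_three, hE]
    simp
    ring

theorem exists_ne_zero_orthogonal (ℓ : Vec) : ∃ u : Vec, u ≠ 0 ∧ ℓ ⬝ᵥ u = 0 := by
  by_cases h : ℓ 0 = 0
  · exact ⟨![1, 0, 0], fun h => by simpa using congrFun h 0, by simp [h, dotProduct,
      Fin.sum_univ_three]⟩
  · refine ⟨![ℓ 1, -ℓ 0, 0], fun h' => h (by simpa using congrFun h' 1), ?_⟩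
    simp [dotProduct, Fin.sum_univ_three]; ring

theorem ev_self_pos {g : Mat} (hg : g.PosDef) {X : Vec} (hX : X ≠ 0) : 0 < ev g X X := by
  rw [ev_eq]
  simpa using hg.dotProduct_mulVec_pos hX

theorem ev_normalize {g : Mat} (hg : g.PosDef) {X : Vec} (hX : X ≠ 0) :
    ev g ((Real.sqrt (ev g X X))⁻¹ • X) ((Real.sqrt (ev g X X))⁻¹ • X) = 1 := by
  have h := ev_self_pos hg hX
  rw [ev_smul_smul, ← mul_inv, Real.mul_self_sqrt h.le, inv_mul_cancel₀ h.ne']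

theorem exists_isFrame {g : Mat} (hg : g.PosDef) {n : Vec} (hn : ev g n n = 1) :
    ∃ E, IsFrame g n E := by
  obtain ⟨u, hu, hgu⟩ := exists_ne_zero_orthogonal (flat g n)
  refine ⟨_, isFrame_of_orthonormal hg.isMetric hn (ev_normalize hg hu) ?_⟩
  have h : ev g n u = 0 := by
    rw [← hgu]
    simp only [ev, flat, dotProduct, Fin.sum_univ_three]
    ring
  have h2 := ev_smul_smul 1 (Real.sqrt (ev g u u))⁻¹ g n u
  rw [one_smul, h, mul_zero] at h2
  exact h2

/-- The projection onto the span of the first two frame vectors. -/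
def planeProj : Mat := Matrix.diagonal ![1, 1, 0]

section frame
variable {g E : Mat} {n : Vec}

theorem IsFrame.mul_transpose (h : IsFrame g n E) : E * Eᵀ = g⁻¹ := by
  have h1 : E * (Eᵀ * g) = 1 := mul_eq_one_comm.1 h.orthonormal
  rw [← Matrix.mul_assoc] at h1
  rw [← Matrix.mul_one (E * Eᵀ), ← mul_inv_self h.isMetric, ← Matrix.mul_assoc, h1,
    Matrix.one_mul]

theorem IsFrame.eq_of_conj_eq (h : IsFrame g n E) {B C : Mat}
    (hBC : Eᵀ * B * E = Eᵀ * C * E) : B = C := by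
  have h1 : E * (Eᵀ * g) = 1 := mul_eq_one_comm.1 h.orthonormal
  have h2 : (g * E) * Eᵀ = 1 := by
    rw [Matrix.mul_assoc, h.mul_transpose, mul_inv_self h.isMetric]
  have h3 : ∀ B, (g * E) * (Eᵀ * B * E) * (Eᵀ * g) = B := by
    intro B
    calc (g * E) * (Eᵀ * B * E) * (Eᵀ * g) = ((g * E) * Eᵀ) * B * (E * (Eᵀ * g)) := by
          simp only [Matrix.mul_assoc]
      _ = B := by rw [h1, h2, Matrix.one_mul, Matrix.mul_one]
  rw [← h3 B, ← h3 C, hBC]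

theorem IsFrame.flat_mul (h : IsFrame g n E) (c : Fin 3) :
    ∑ l, flat g n l * E l c = if c = 2 then 1 else 0 := by
  have h1 := congrFun (congrFun h.orthonormal 2) c
  rw [ev_eq_mul] at h1
  have h2 : ∑ l, flat g n l * E l c = ev g (fun k => E k 2) (fun k => E k c) := by
    simp only [h.col_two, ev, flat, Fin.sum_univ_three]
    ring
  rw [h2, h1, Matrix.one_apply]
  simp only [eq_comm]

theorem IsFrame.proj_mul (h : IsFrame g n E) : proj g n * E = E * planeProj := by
  rw [proj, Matrix.sub_mul, Matrix.one_mul]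
  ext i j
  have h1 : (Matrix.vecMulVec n (flat g n) * E) i j = n i * if j = 2 then 1 else 0 := by
    rw [← h.flat_mul j, Matrix.mul_apply, Finset.mul_sum]
    exact Finset.sum_congr rfl fun k _ => by simp only [Matrix.vecMulVec_apply]; ring
  rw [Matrix.sub_apply, h1, planeProj, Matrix.mul_diagonal]
  have := h.col_two i
  fin_cases j <;> simp [this]

theorem IsFrame.restr_conj (h : IsFrame g n E) (B : Mat) :
    Eᵀ * restr g n B * E = planeProj * (Eᵀ * B * E) * planeProj := by
  have h1 : Eᵀ * (proj g n)ᵀ = planeProj * Eᵀ := by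
    rw [← Matrix.transpose_mul, h.proj_mul, Matrix.transpose_mul, planeProj,
      Matrix.diagonal_transpose]
  calc Eᵀ * restr g n B * E = (Eᵀ * (proj g n)ᵀ) * B * (proj g n * E) := by
        simp only [restr, Matrix.mul_assoc]
    _ = _ := by rw [h1, h.proj_mul]; simp only [Matrix.mul_assoc]

theorem IsFrame.invFacet_eq (h : IsFrame g n E) : invFacet g n = E * planeProj * Eᵀ := by
  rw [invFacet, ← h.mul_transpose]
  ext i j
  simp [planeProj, Matrix.mul_apply, Matrix.vecMulVec_apply, Fin.sum_univ_three,
    Matrix.diagonal_apply, h.col_two]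

theorem IsFrame.ip_invFacet (h : IsFrame g n E) (B C : Mat) :
    ip (invFacet g n) B C = ∑ i, ∑ j, if i = 2 ∨ j = 2 then 0 else
      (Eᵀ * B * E) i j * (Eᵀ * C * E) i j := by
  have h1 : ip (invFacet g n) B C
      = ((Eᵀ * B * E) * planeProj * (Eᵀ * C * E)ᵀ * planeProj).trace := by
    rw [ip_eq_trace, h.invFacet_eq]
    have : B * (E * planeProj * Eᵀ) * Cᵀ * (E * planeProj * Eᵀ)ᵀ
        = (B * E * planeProj * Eᵀ * Cᵀ * E * planeProj) * Eᵀ := by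
      simp only [Matrix.transpose_mul, Matrix.transpose_transpose, planeProj,
        Matrix.diagonal_transpose, Matrix.mul_assoc]
    rw [this, Matrix.trace_mul_comm]
    simp only [Matrix.transpose_mul, Matrix.transpose_transpose, Matrix.mul_assoc]
  rw [h1]
  generalize Eᵀ * B * E = B'
  generalize Eᵀ * C * E = C'
  simp [planeProj, Matrix.trace, Matrix.mul_apply, Fin.sum_univ_three, Matrix.diagonal_apply]

theorem IsFrame.tr_invFacet (h : IsFrame g n E) (B : Mat) :
    tr (invFacet g n) B = (Eᵀ * B * E) 0 0 + (Eᵀ * B * E) 1 1 := by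
  rw [h.invFacet_eq, ev_eq_mul, ev_eq_mul]
  simp [tr, ev, planeProj, Matrix.mul_apply, Fin.sum_univ_three, Matrix.diagonal_apply]
  ring

theorem IsFrame.traceRev_conj (h : IsFrame g n E) (V : Mat) :
    Eᵀ * traceRev g n V * E = planeProj * (Eᵀ * V * E) * planeProj
      - ((Eᵀ * V * E) 0 0 + (Eᵀ * V * E) 1 1) • planeProj := by
  have h1 : planeProj * planeProj = planeProj := by
    rw [planeProj, Matrix.diagonal_mul_diagonal]
    congr 1; funext i; fin_cases i <;> simp
  rw [traceRev, Matrix.mul_sub, Matrix.sub_mul, h.restr_conj, h.tr_invFacet, h.restr_conj,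
    Matrix.mul_smul, Matrix.smul_mul, h.restr_conj, h.orthonormal, Matrix.mul_one, h1]
  congr 2
  simp [planeProj]

theorem IsFrame.sum_eps_mul (h : IsFrame g n E) (i j k : Fin 3) :
    ∑ a, ∑ b, ∑ c, (Real.sqrt g.det * eps a b c) * E a i * E b j * E c k = eps i j k := by
  have h1 := eps_transform Eᵀ i j k
  rw [Matrix.det_transpose] at h1
  have h2 : ∑ a, ∑ b, ∑ c, (Real.sqrt g.det * eps a b c) * E a i * E b j * E c k
      = Real.sqrt g.det * ∑ a, ∑ b, ∑ c, Eᵀ i a * Eᵀ j b * Eᵀ k c * eps a b c := by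
    simp only [Finset.mul_sum, Matrix.transpose_apply]
    refine Finset.sum_congr rfl fun a _ => Finset.sum_congr rfl fun b _ =>
      Finset.sum_congr rfl fun c _ => ?_
    ring
  rw [h2, h1, ← mul_assoc, h.sqrt_mul_det, one_mul]

theorem IsFrame.eps_div (h : IsFrame g n E) (i j k : Fin 3) :
    eps i j k / Real.sqrt g.det = ∑ a, ∑ b, ∑ c, E i a * E j b * E k c * eps a b c := by
  have := (sqrt_det_pos h.isMetric).ne'
  rw [eps_transform, div_eq_iff this, mul_right_comm, mul_comm E.det, h.sqrt_mul_det, one_mul]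

/-- `(𝔸U)(X, n, n, Y) = U(X × n, Y × n)`: the tensor `U` evaluated on rotated arguments. -/
theorem AFnnF_arg (hg : IsMetric g) {U : Mat} (hU : U.IsSymm) (X Y n : Vec) :
    ∑ i, ∑ a, ∑ b, ∑ j, AA g U i a b j * X i * n a * n b * Y j
      = ev U (cross g X n) (cross g Y n) := by
  have h1 : ∀ Z : Vec, cross g Z n
      = fun m => ∑ i, ∑ a, (∑ c, g⁻¹ m c * (Real.sqrt g.det * eps i a c)) * Z i * n a := by
    intro Z
    funext m
    simp only [cross]
    simp only [Finset.sum_mul]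
    rw [Finset.sum_comm]
    refine Finset.sum_congr rfl fun i _ => ?_
    rw [Finset.sum_comm]
    refine Finset.sum_congr rfl fun a _ => Finset.sum_congr rfl fun c _ => ?_
    ring
  rw [h1, h1]
  simp only [AA_apply hg hU]
  set P : Fin 3 → Fin 3 → Fin 3 → ℝ :=
    fun m i a => ∑ c, g⁻¹ m c * (Real.sqrt g.det * eps i a c)
  have h2 : ∀ i a b j, (∑ p, ∑ q, U p q * P p i a * P q j b) * X i * n a * n b * Y j
      = ∑ p, ∑ q, U p q * (P p i a * X i * n a) * (P q j b * Y j * n b) := by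
    intro i a b j
    simp only [Finset.sum_mul]
    refine Finset.sum_congr rfl fun p _ => Finset.sum_congr rfl fun q _ => ?_
    ring
  have h3 : ∀ p q, ∑ i, ∑ a, ∑ b, ∑ j, U p q * (P p i a * X i * n a) * (P q j b * Y j * n b)
      = U p q * (∑ i, ∑ a, P p i a * X i * n a) * ∑ i, ∑ a, P q i a * Y i * n a := by
    intro p q
    rw [Finset.sum_comm (f := fun i a => P q i a * Y i * n a)]
    simp only [← Finset.mul_sum, ← Finset.sum_mul]
  change ∑ i, ∑ a, ∑ b, ∑ j, (∑ p, ∑ q, U p q * P p i a * P q j b) * X i * n a * n b * Y j = _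
  simp only [h2]
  refine (sum_comm_four_two _).trans ?_
  exact Finset.sum_congr rfl fun p _ => Finset.sum_congr rfl fun q _ => h3 p q

theorem IsFrame.cross_col (h : IsFrame g n E) (p m : Fin 3) :
    cross g (fun i => E i p) n m = ∑ r, eps p 2 r * E m r := by
  have h1 : ∀ l, crossCov (fun i => E i p) n l = ∑ a, ∑ b, eps a b l * E a p * E b 2 := by
    intro l
    simp only [crossCov, h.col_two]
  have h2 : ∑ r, eps p 2 r * E m r = ∑ r, (∑ a, ∑ b, ∑ c,
      (Real.sqrt g.det * eps a b c) * E a p * E b 2 * E c r) * E m r :=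
    Finset.sum_congr rfl fun r _ => by rw [h.sum_eps_mul]
  rw [cross_eq, ← h.mul_transpose, h2]
  simp only [Pi.smul_apply, smul_eq_mul, Matrix.mulVec, dotProduct, h1,
    Matrix.mul_apply, Matrix.transpose_apply]
  generalize eps = e
  simp only [Fin.sum_univ_three]
  ring

theorem IsFrame.AFnnF_conj (h : IsFrame g n E) {U : Mat} (hU : U.IsSymm) :
    Eᵀ * AFnnF g n (AA g U) * E = planeProj * (Matrix.of fun p q => ∑ r, ∑ s,
      eps p 2 r * eps q 2 s * (Eᵀ * U * E) r s) * planeProj := by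
  refine (h.restr_conj _).trans ?_
  congr 2
  ext p q
  have h1 := AFnnF_arg h.isMetric hU (fun i => E i p) (fun i => E i q) n
  have h2 : (Eᵀ * (show Mat from fun i j => ∑ a, ∑ b, AA g U i a b j * n a * n b) * E) p q
      = ∑ i, ∑ a, ∑ b, ∑ j, AA g U i a b j * E i p * n a * n b * E j q := by
    generalize AA g U = A
    rw [ev_eq_mul]
    simp only [ev, Finset.sum_mul]
    refine Finset.sum_congr rfl fun i _ => ?_
    rw [Finset.sum_comm]
    refine Finset.sum_congr rfl fun a _ => ?_
    rw [Finset.sum_comm]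
    refine Finset.sum_congr rfl fun b _ => Finset.sum_congr rfl fun j _ => ?_
    ring
  rw [h2, h1, Matrix.of_apply]
  simp only [ev_eq_mul, ev, h.cross_col, Fin.sum_univ_three]
  ring

/-- On a facet `(𝔸U)_{FnnF} = -𝕊_F U`. -/
theorem IsFrame.AFnnF_eq (h : IsFrame g n E) {U : Mat} (hU : U.IsSymm) :
    AFnnF g n (AA g U) = -traceRev g n U := by
  apply h.eq_of_conj_eq
  rw [h.AFnnF_conj hU, Matrix.mul_neg, Matrix.neg_mul, h.traceRev_conj]
  have hV : (Eᵀ * U * E).IsSymm := by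
    unfold Matrix.IsSymm
    rw [Matrix.transpose_mul, Matrix.transpose_mul, Matrix.transpose_transpose, hU.eq,
      Matrix.mul_assoc]
  have h10 := hV.apply 0 1
  generalize Eᵀ * U * E = V at *
  ext i j
  fin_cases i <;> fin_cases j <;>
    simp [planeProj, Matrix.mul_apply, Fin.sum_univ_three, Matrix.diagonal_apply, eps, h10] <;>
    ring

/-- `𝕊_F` is self-adjoint. -/
theorem IsFrame.ip_traceRev (h : IsFrame g n E) (B U : Mat) :
    ip (invFacet g n) B (traceRev g n U) = ip (invFacet g n) (traceRev g n B) (restr g n U) := by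
  rw [h.ip_invFacet, h.ip_invFacet, h.traceRev_conj, h.traceRev_conj, h.restr_conj]
  generalize Eᵀ * U * E = V
  generalize Eᵀ * B * E = C
  simp [planeProj, Fin.sum_univ_three, Matrix.diagonal_apply]
  ring

end frame

/-! ### The flux through a facet -/

theorem ip_add_left (h B B' C : Mat) : ip h (B + B') C = ip h B C + ip h B' C := by
  simp only [ip_eq_trace, Matrix.add_mul, Matrix.trace_add]

theorem ip_sub_left (h B B' C : Mat) : ip h (B - B') C = ip h B C - ip h B' C := by
  simp only [ip_eq_trace, Matrix.sub_mul, Matrix.trace_sub]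

theorem ip_smul_left (h : Mat) (c : ℝ) (B C : Mat) : ip h (c • B) C = c * ip h B C := by
  simp only [ip_eq_trace, Matrix.smul_mul, Matrix.trace_smul, smul_eq_mul]

theorem ip_neg_right (h B C : Mat) : ip h B (-C) = -ip h B C := by
  simp only [ip_eq_trace, Matrix.transpose_neg, Matrix.mul_neg, Matrix.neg_mul, Matrix.trace_neg]

theorem ip_zero_right (h B : Mat) : ip h B 0 = 0 := by
  simp [ip_eq_trace]

theorem ip_sum_left {ι : Type*} (s : Finset ι) (h : Mat) (B : ι → Mat) (C : Mat) :
    ip h (∑ i ∈ s, B i) C = ∑ i ∈ s, ip h (B i) C := by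
  simp only [ip_eq_trace, Finset.sum_mul, Matrix.trace_sum]

section frame
variable {g E : Mat} {n : Vec}

theorem IsFrame.conj_apply_normal (h : IsFrame g n E) (N : Fin 3 → Fin 3 → Fin 3 → ℝ)
    (p q : Fin 3) :
    (Eᵀ * (show Mat from fun i j => ∑ a, N i a j * n a) * E) p q
      = ∑ i, ∑ a, ∑ j, N i a j * E i p * E a 2 * E j q := by
  rw [ev_eq_mul]
  simp only [ev, ← h.col_two, Finset.sum_mul]
  refine Finset.sum_congr rfl fun i _ => ?_
  rw [Finset.sum_comm]
  refine Finset.sum_congr rfl fun a _ => Finset.sum_congr rfl fun j _ => ?_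
  ring

/-- The components in the frame of a contraction with `ε̂^{pql} g_{lj}`. -/
theorem IsFrame.starTensor_conj (h : IsFrame g n E) (p q j' : Fin 3) :
    ∑ j, starTensor g p q j * E j j' = ∑ a, ∑ b, E p a * E q b * eps a b j' := by
  have h1 : ∀ l, ∑ j, g l j * E j j' = (g * E) l j' := fun l => rfl
  have h2 : ∀ c, ∑ l, E l c * (g * E) l j' = if c = j' then 1 else 0 := by
    intro c
    have := congrFun (congrFun h.orthonormal c) j'
    rw [Matrix.mul_assoc, Matrix.mul_apply, Matrix.one_apply] at this
    rw [← this]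
    rfl
  have h3 : ∑ j, starTensor g p q j * E j j'
      = ∑ l, eps p q l / Real.sqrt g.det * (g * E) l j' := by
    simp only [← h1, starTensor, Finset.sum_mul, Finset.mul_sum]
    rw [Finset.sum_comm]
    exact Finset.sum_congr rfl fun l _ => Finset.sum_congr rfl fun j _ => by ring
  have h4 : ∀ a b, E p a * E q b * eps a b j'
      = ∑ c, E p a * E q b * eps a b c * ∑ l, E l c * (g * E) l j' := by
    intro a b
    simp [h2]
  rw [h3]
  simp only [h4, h.eps_div]
  generalize g * E = F
  generalize eps = e
  simp only [Fin.sum_univ_three]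
  ring

theorem IsFrame.tensorCross_eq (h : IsFrame g n E) (A : Mat) :
    tensorCross g A n = E * ((Eᵀ * A * E) * Matrix.of fun k j => eps j k 2) * Eᵀ := by
  have h0 : g⁻¹ * A = E * (Eᵀ * A) := by rw [← h.mul_transpose, Matrix.mul_assoc]
  have h1 : ∀ j k, ∑ l, eps j k l / Real.sqrt g.det * flat g n l
      = ∑ a, ∑ b, E j a * E k b * eps a b 2 := by
    intro j k
    have h2 : ∀ a b, E j a * E k b * eps a b 2
        = ∑ c, E j a * E k b * eps a b c * ∑ l, flat g n l * E l c := by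
      intro a b
      simp [h.flat_mul]
    simp only [h2, h.eps_div]
    generalize flat g n = F
    generalize eps = e
    simp only [Fin.sum_univ_three]
    ring
  ext i j
  have h3 : tensorCross g A n i j = ∑ k, (g⁻¹ * A) i k *
      ∑ l, eps j k l / Real.sqrt g.det * flat g n l := by
    simp only [tensorCross, Matrix.mul_apply, Finset.mul_sum]
    refine Finset.sum_congr rfl fun k _ => Finset.sum_congr rfl fun l _ => ?_
    rw [Finset.sum_mul, Finset.sum_mul]
    exact Finset.sum_congr rfl fun a _ => by ring
  rw [h3, h0]
  simp only [h1]
  have h4 : E * (Eᵀ * A * E * Matrix.of fun k j => eps j k 2) * Eᵀ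
      = E * (Eᵀ * A) * (E * (Matrix.of fun k j => eps j k 2) * Eᵀ) := by
    simp only [Matrix.mul_assoc]
  rw [h4, Matrix.mul_apply]
  refine Finset.sum_congr rfl fun k _ => ?_
  congr 1
  generalize eps = e
  simp only [Matrix.mul_apply, Fin.sum_univ_three, Matrix.of_apply, Matrix.transpose_apply]
  ring

/-- The components in the frame of `Q (curl σ)ᵀ × n`, where `N` stands for `∇σ`. -/
theorem IsFrame.curlCross_conj (h : IsFrame g n E) (N : Fin 3 → Fin 3 → Fin 3 → ℝ) {C : Mat}
    (hC : ∀ i j, C i j = ∑ p, ∑ q, starTensor g p q j * N p i q) :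
    Eᵀ * lower g (tensorCross g ((proj g n)ᵀ * Cᵀ) n) * E
      = planeProj * (Matrix.of fun i k => ∑ a, ∑ b, eps a b i *
          ∑ p, ∑ c, ∑ q, N p c q * E p a * E c k * E q b) *
        Matrix.of fun k j => eps j k 2 := by
  have h1 : Eᵀ * (proj g n)ᵀ = planeProj * Eᵀ := by
    rw [← Matrix.transpose_mul, h.proj_mul, Matrix.transpose_mul, planeProj,
      Matrix.diagonal_transpose]
  have h2 : ∀ X : Mat, Eᵀ * lower g (E * X * Eᵀ) * E = X := by
    intro X
    have e : Eᵀ * lower g (E * X * Eᵀ) * E = (Eᵀ * g * E) * X * (Eᵀ * g * E) := by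
      rw [lower_eq h.isMetric.isSymm]
      simp only [Matrix.mul_assoc]
    rw [e, h.orthonormal, Matrix.one_mul, Matrix.mul_one]
  rw [h.tensorCross_eq, h2]
  congr 1
  rw [← Matrix.mul_assoc Eᵀ, h1, Matrix.mul_assoc, Matrix.mul_assoc]
  congr 1
  ext j k
  have h3 : (Eᵀ * (Cᵀ * E)) j k = ∑ c, ∑ p, ∑ q, N p c q * E c k *
      ∑ i, starTensor g p q i * E i j := by
    simp only [Matrix.mul_apply, Matrix.transpose_apply, hC]
    generalize starTensor g = S
    simp only [Fin.sum_univ_three]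
    ring
  rw [h3, Matrix.of_apply]
  simp only [h.starTensor_conj]
  generalize eps = e
  simp only [Fin.sum_univ_three]
  ring

/-- The part of the facet flux that contains `∇σ` is dual to the curl: this is the facet term
`(∇σ)_{FnF} - (∇σ)_{nFF}` against `(𝔸U)_{FnnF}`, with `N` standing for `∇σ`. -/
theorem IsFrame.ip_nabla_AFnnF (h : IsFrame g n E) (N : Fin 3 → Fin 3 → Fin 3 → ℝ)
    (hN : ∀ k i j, N k i j = N k j i) {C U : Mat} (hU : U.IsSymm)
    (hC : ∀ i j, C i j = ∑ p, ∑ q, starTensor g p q j * N p i q) :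
    ip (invFacet g n) (restr g n (fun i j => ∑ a, N i a j * n a)) (AFnnF g n (AA g U))
      - ip (invFacet g n) (restr g n (fun i j => ∑ a, N a i j * n a)) (AFnnF g n (AA g U))
      = ip (invFacet g n) (lower g (tensorCross g ((proj g n)ᵀ * Cᵀ) n)) (restr g n U) := by
  set T : Fin 3 → Fin 3 → Fin 3 → ℝ :=
    fun a k b => ∑ p, ∑ c, ∑ q, N p c q * E p a * E c k * E q b with hT
  have hTs : ∀ a k b, T a k b = T a b k := by
    intro a k b
    simp only [hT]
    refine Finset.sum_congr rfl fun p _ => ?_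
    rw [Finset.sum_comm]
    refine Finset.sum_congr rfl fun c _ => Finset.sum_congr rfl fun q _ => ?_
    rw [hN p q c]; ring
  have e1 : Eᵀ * restr g n (fun i j => ∑ a, N i a j * n a) * E
      = planeProj * (Matrix.of fun p q => T p 2 q) * planeProj := by
    refine (h.restr_conj _).trans ?_
    congr 2
    ext p q
    exact h.conj_apply_normal N p q
  have e2 : Eᵀ * restr g n (fun i j => ∑ a, N a i j * n a) * E
      = planeProj * (Matrix.of fun p q => T 2 p q) * planeProj := by
    refine (h.restr_conj _).trans ?_
    congr 2
    ext p q
    refine (h.conj_apply_normal (fun i a j => N a i j) p q).trans ?_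
    simp only [Matrix.of_apply, hT]
    rw [Finset.sum_comm]
    refine Finset.sum_congr rfl fun i _ => Finset.sum_congr rfl fun a _ =>
      Finset.sum_congr rfl fun j _ => ?_
    ring
  have e3 := h.curlCross_conj N hC
  have e4 : (Matrix.of fun i k => ∑ a, ∑ b, eps a b i *
      ∑ p, ∑ c, ∑ q, N p c q * E p a * E c k * E q b)
      = Matrix.of fun i k => ∑ a, ∑ b, eps a b i * T a k b := rfl
  rw [e4] at e3
  rw [h.ip_invFacet, h.ip_invFacet, h.ip_invFacet, h.AFnnF_conj hU, h.restr_conj]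
  simp only [e1, e2, e3]
  have hV : (Eᵀ * U * E).IsSymm := by
    unfold Matrix.IsSymm
    rw [Matrix.transpose_mul, Matrix.transpose_mul, Matrix.transpose_transpose, hU.eq,
      Matrix.mul_assoc]
  have h10 := hV.apply 0 1
  generalize Eᵀ * U * E = V at *
  clear_value T
  clear e1 e2 e3 e4 hT
  simp [planeProj, Fin.sum_univ_three, Matrix.diagonal_apply, Matrix.mul_apply, eps, h10,
    hTs 0 2, hTs 1 2, hTs 1 1 0, hTs 2 1 0]
  ring

end frame

section facet
variable {G σ : Pt → Mat} {lam : Pt → ℝ} {x : Pt}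

theorem cov2_symm (hσ : ∀ y, (σ y).IsSymm) (k i j : Fin 3) :
    cov2 G σ x k i j = cov2 G σ x k j i := by
  simp only [cov2, fun y => (hσ y).apply i j, fun m => (hσ x).apply i m,
    fun m => (hσ x).apply m j]
  ring

/-- The facet terms of `b` as seen from one element. -/
theorem ip_flux_AFnnF (h : MetricAt ∞ G x) (hg : (G x).PosDef)
    (hn : ev (G x) (normal G lam x) (normal G lam x) = 1) (hσ : ∀ y, (σ y).IsSymm)
    (hσd : ∀ i j, ContDiffAt ℝ ∞ (fun y => σ y i j) x) {U : Mat} (hU : U.IsSymm) :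
    ip (invFacet (G x) (normal G lam x))
      (sigmaNN G σ lam x • secondFF G lam x + nablaFnF G σ lam x + nablaContr G σ lam x
        - nablanFF G σ lam x) (AFnnF (G x) (normal G lam x) (AA (G x) U))
      = ip (invFacet (G x) (normal G lam x))
        (curlCross G σ lam x
          - sigmaNN G σ lam x • traceRev (G x) (normal G lam x) (secondFF G lam x)
          - traceRev (G x) (normal G lam x) (nablaContr G σ lam x))
        (restr (G x) (normal G lam x) U) := by
  obtain ⟨E, hE⟩ := exists_isFrame hg hn
  have h1 := hE.ip_nabla_AFnnF (fun k i j => cov2 G σ x k i j) (fun k i j => cov2_symm hσ k i j)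
    hU (C := curl G σ x) (fun i j => curl_eq (h.mono (by norm_cast)) (fun i j => (hσd i j).diffAt)
      i j)
  have h2 : ∀ B, ip (invFacet (G x) (normal G lam x)) B
      (AFnnF (G x) (normal G lam x) (AA (G x) U)) = -ip (invFacet (G x) (normal G lam x))
        (traceRev (G x) (normal G lam x) B) (restr (G x) (normal G lam x) U) := by
    intro B
    rw [hE.AFnnF_eq hU, ip_neg_right, hE.ip_traceRev]
  simp only [ip_sub_left, ip_add_left, ip_smul_left]
  rw [h2 (secondFF G lam x), h2 (nablaContr G σ lam x), curlCross, ← h1, nablaFnF, nablanFF]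
  ring

end facet

/-! ### Normals, induced metrics and conormals -/

section normal
variable {G : Pt → Mat} {lam : Pt → ℝ} {x : Pt}

theorem ev_inv_self_pos {g : Mat} (hg : g.PosDef) {ℓ : Vec} (hℓ : ℓ ≠ 0) : 0 < ev g⁻¹ ℓ ℓ :=
  ev_self_pos hg.inv hℓ

theorem ev_normal_self (hg : (G x).PosDef) (hℓ : diff lam x ≠ 0) :
    ev (G x) (normal G lam x) (normal G lam x) = 1 := by
  have h := ev_inv_self_pos hg hℓ
  rw [normal, ev_smul_smul, ev_inv_mulVec hg.isMetric, ← mul_inv, Real.mul_self_sqrt h.le,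
    inv_mul_cancel₀ h.ne']

theorem mulVec_normal (hg : (G x).PosDef) :
    G x *ᵥ normal G lam x = (Real.sqrt (ev (G x)⁻¹ (diff lam x) (diff lam x)))⁻¹ • diff lam x := by
  rw [normal, Matrix.mulVec_smul, Matrix.mulVec_mulVec, mul_inv_self hg.isMetric,
    Matrix.one_mulVec]

theorem ev_normal (hg : (G x).PosDef) (X : Vec) : ev (G x) X (normal G lam x)
    = (Real.sqrt (ev (G x)⁻¹ (diff lam x) (diff lam x)))⁻¹ * (X ⬝ᵥ diff lam x) := by
  rw [ev_eq, mulVec_normal hg, dotProduct_smul, smul_eq_mul]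

theorem ev_normal_eq_zero_iff (hg : (G x).PosDef) (hℓ : diff lam x ≠ 0) (X : Vec) :
    ev (G x) X (normal G lam x) = 0 ↔ diff lam x ⬝ᵥ X = 0 := by
  have h := Real.sqrt_pos.2 (ev_inv_self_pos hg hℓ)
  rw [ev_normal hg, mul_eq_zero, dotProduct_comm]
  simp [h.ne']

theorem normal_dotProduct_diff (hg : (G x).PosDef) (hℓ : diff lam x ≠ 0) :
    ∑ i, normal G lam x i * diff lam x i = Real.sqrt (ev (G x)⁻¹ (diff lam x) (diff lam x)) := by
  have h := ev_inv_self_pos hg hℓ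
  have h2 := Real.sqrt_pos.2 h
  have h3 := ev_normal hg (normal G lam x) (lam := lam)
  rw [ev_normal_self hg hℓ] at h3
  field_simp at h3
  exact h3.symm

/-- The area density depends only on the cofactor matrix of the metric. -/
theorem areaDensity_eq (hg : (G x).PosDef) (hℓ : diff lam x ≠ 0) :
    areaDensity G lam x = Real.sqrt (ev (G x).adjugate (diff lam x) (diff lam x))
      / Real.sqrt (∑ i, diff lam x i ^ 2) := by
  rw [areaDensity, normal_dotProduct_diff hg hℓ, ← Real.sqrt_mul hg.det_pos.le,
    ← ev_smul_matrix, ← adjugate_eq_det_smul_inv hg.isMetric]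

end normal

section consistency
variable {g g' : Mat} {n n' : Vec}

theorem invFacet_isSymm (hg : g.IsSymm) (n : Vec) : (invFacet g n).IsSymm := by
  unfold Matrix.IsSymm
  rw [invFacet, Matrix.transpose_sub, (inv_isSymm hg).eq, Matrix.transpose_vecMulVec]

theorem invFacet_mul_metric (hg : IsMetric g) (n : Vec) : invFacet g n * g = proj g n := by
  rw [invFacet, Matrix.sub_mul, inv_mul_self hg, proj, Matrix.vecMulVec_mul, flat_eq hg.isSymm]
  congr 2
  rw [← Matrix.mulVec_transpose, hg.isSymm.eq]

theorem proj_mulVec (hg : g.IsSymm) (n X : Vec) : proj g n *ᵥ X = X - ev g X n • n := by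
  have h : flat g n ⬝ᵥ X = ev g X n := by
    rw [flat_eq hg, ev_eq, dotProduct_comm]
  rw [proj, Matrix.sub_mulVec, Matrix.one_mulVec, Matrix.vecMulVec_mulVec, h]
  funext i
  simp [mul_comm]

/-- The columns of the inverse facet metric are tangential. -/
theorem ev_invFacet_mulVec (hg : IsMetric g) (hn : ev g n n = 1) (α : Vec) :
    ev g (invFacet g n *ᵥ α) n = 0 := by
  have h1 : g *ᵥ (invFacet g n *ᵥ α) = α - (n ⬝ᵥ α) • (g *ᵥ n) := by
    rw [invFacet, Matrix.sub_mulVec, Matrix.mulVec_sub, Matrix.mulVec_mulVec, mul_inv_self hg,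
      Matrix.one_mulVec, Matrix.vecMulVec_mulVec]
    simp [Matrix.mulVec_smul]
  rw [ev_comm hg.isSymm, ev_eq, h1, dotProduct_sub, dotProduct_smul, ← ev_eq, hn]
  simp

theorem mulVec_eq_iff_forall {A B : Mat} (h : ∀ v, A *ᵥ v = B *ᵥ v) : A = B :=
  Matrix.mulVec_injective (funext h)

/-- The inverse facet metric is determined by the restriction of the metric to the tangent plane. -/
theorem invFacet_congr (hg : IsMetric g) (hg' : IsMetric g') (hn : ev g n n = 1)
    (hn' : ev g' n' n' = 1) (hker : ∀ X, ev g X n = 0 ↔ ev g' X n' = 0)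
    (hgg' : ∀ X Y, ev g X n = 0 → ev g Y n = 0 → ev g X Y = ev g' X Y) :
    invFacet g n = invFacet g' n' := by
  have hs := invFacet_isSymm hg.isSymm n
  have hs' := invFacet_isSymm hg'.isSymm n'
  have t := ev_invFacet_mulVec hg hn
  have t' := fun α => (hker _).2 (ev_invFacet_mulVec hg' hn' α)
  -- `h g h' = h g' h'` for the two inverse metrics `h`, `h'`, since their columns are tangential;
  -- the left side is `h'` and the right side is `h`.
  have e1 : invFacet g n * g * invFacet g' n' = invFacet g' n' := by
    refine mulVec_eq_iff_forall fun v => ?_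
    rw [invFacet_mul_metric hg, ← Matrix.mulVec_mulVec, proj_mulVec hg.isSymm, t' v, zero_smul,
      sub_zero]
  have e2 : invFacet g' n' * g' * invFacet g n = invFacet g n := by
    refine mulVec_eq_iff_forall fun v => ?_
    rw [invFacet_mul_metric hg', ← Matrix.mulVec_mulVec, proj_mulVec hg'.isSymm,
      (hker _).1 (t v), zero_smul, sub_zero]
  have e3 : invFacet g n * g * invFacet g' n' = invFacet g n * g' * invFacet g' n' := by
    ext i j
    have hc : ∀ b : Mat, (invFacet g n * b * invFacet g' n') i j
        = ev b (invFacet g n *ᵥ Pi.single i 1) (invFacet g' n' *ᵥ Pi.single j 1) := by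
      intro b
      rw [Matrix.mulVec_single_one, Matrix.mulVec_single_one]
      simp only [ev, Matrix.mul_apply, Fin.sum_univ_three, Matrix.col_apply]
      rw [hs.apply 0 i, hs.apply 1 i, hs.apply 2 i]
      ring
    rw [hc, hc, hgg' _ _ (t _) (t' _)]
  calc invFacet g n = (invFacet g' n' * g' * invFacet g n)ᵀ := by rw [e2, hs.eq]
    _ = invFacet g n * g' * invFacet g' n' := by
      rw [Matrix.transpose_mul, Matrix.transpose_mul, hs.eq, hs'.eq, hg'.isSymm.eq,
        Matrix.mul_assoc]
    _ = invFacet g' n' := by rw [← e3, e1]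

theorem ip_invFacet_congr (hg : IsMetric g) (hn : ev g n n = 1) {C C' : Mat}
    (hC : ∀ X Y, ev g X n = 0 → ev g Y n = 0 → ev C X Y = ev C' X Y) (B : Mat) :
    ip (invFacet g n) B C = ip (invFacet g n) B C' := by
  have h : ∀ D, ip (invFacet g n) B D = ∑ i, ∑ j, B i j *
      ev D (invFacet g n *ᵥ Pi.single i 1) (invFacet g n *ᵥ Pi.single j 1) := by
    intro D
    have hs := invFacet_isSymm hg.isSymm n
    simp only [ip, ev, Matrix.mulVec_single_one, Matrix.col_apply, Finset.mul_sum]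
    refine Finset.sum_congr rfl fun i _ => Finset.sum_congr rfl fun j _ =>
      Finset.sum_congr rfl fun k _ => Finset.sum_congr rfl fun l _ => ?_
    rw [hs.apply k i, hs.apply l j]; ring
  rw [h, h]
  refine Finset.sum_congr rfl fun i _ => Finset.sum_congr rfl fun j _ => ?_
  rw [hC _ _ (ev_invFacet_mulVec hg hn _) (ev_invFacet_mulVec hg hn _)]

theorem ev_restr (hg : g.IsSymm) (B : Mat) {X Y : Vec} (hX : ev g X n = 0)
    (hY : ev g Y n = 0) : ev (restr g n B) X Y = ev B X Y := by
  have h : ∀ Z, ev g Z n = 0 → proj g n *ᵥ Z = Z := fun Z hZ => by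
    rw [proj_mulVec hg, hZ, zero_smul, sub_zero]
  rw [ev_eq, restr, ← Matrix.mulVec_mulVec, ← Matrix.mulVec_mulVec, h Y hY,
    Matrix.dotProduct_mulVec, Matrix.vecMul_transpose, h X hX, ev_eq]

theorem ip_invFacet_restr (hg : IsMetric g) (hn : ev g n n = 1) (B C : Mat) :
    ip (invFacet g n) B (restr g n C) = ip (invFacet g n) B C :=
  ip_invFacet_congr hg hn (fun _ _ hX hY => ev_restr hg.isSymm C hX hY) B

theorem dotProduct_crossCov_single (ℓ : Vec) (i : Fin 3) :
    ℓ ⬝ᵥ crossCov ℓ (Pi.single i 1) = 0 := by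
  rw [crossCov_eq]
  fin_cases i <;> simp [dotProduct, Fin.sum_univ_three] <;> ring

theorem crossCov_crossCov_single (ℓ : Vec) (i j : Fin 3) :
    crossCov (crossCov ℓ (Pi.single i 1)) (crossCov ℓ (Pi.single j 1))
      = (∑ k, eps i j k * ℓ k) • ℓ := by
  simp only [crossCov_eq]
  funext l
  fin_cases i <;> fin_cases j <;> fin_cases l <;>
    simp [eps, Fin.sum_univ_three] <;> first | ring1 | (left; ring1)

/-- The cofactor form evaluated on the conormal of a plane depends only on the restriction of the
metric to the plane: it is the Gram determinant of two vectors of the plane. -/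
theorem ev_adjugate_congr (hg : g.IsSymm) (hg' : g'.IsSymm) {ℓ : Vec} (hℓ : ℓ ≠ 0)
    (hgg' : ∀ X Y, ℓ ⬝ᵥ X = 0 → ℓ ⬝ᵥ Y = 0 → ev g X Y = ev g' X Y) :
    ev g.adjugate ℓ ℓ = ev g'.adjugate ℓ ℓ := by
  have h1 : ∀ i j, (∑ k, eps i j k * ℓ k) ^ 2 * ev g.adjugate ℓ ℓ
      = (∑ k, eps i j k * ℓ k) ^ 2 * ev g'.adjugate ℓ ℓ := by
    intro i j
    have t := dotProduct_crossCov_single ℓ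
    have e := ev_adjugate_crossCov hg (crossCov ℓ (Pi.single i 1)) (crossCov ℓ (Pi.single j 1))
    have e' := ev_adjugate_crossCov hg' (crossCov ℓ (Pi.single i 1)) (crossCov ℓ (Pi.single j 1))
    rw [crossCov_crossCov_single, ev_smul_smul] at e e'
    rw [sq, e, e', hgg' _ _ (t i) (t i), hgg' _ _ (t j) (t j), hgg' _ _ (t i) (t j)]
  by_contra hne
  apply hℓ
  have h2 : ∀ i j, ∑ k, eps i j k * ℓ k = 0 := fun i j => by
    have := h1 i j
    rw [← sub_eq_zero, ← mul_sub, mul_eq_zero, sub_eq_zero] at this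
    simpa [hne] using this
  have a := h2 1 2
  have b := h2 2 0
  have c := h2 0 1
  simp [eps, Fin.sum_univ_three] at a b c
  norm_num at a b c
  funext i
  fin_cases i <;> simp [a, b, c]

/-- Covectors with the same kernel are proportional. -/
theorem exists_smul_of_ker_le {ℓ ℓ' : Vec} (hℓ : ℓ ≠ 0)
    (h : ∀ X, ℓ ⬝ᵥ X = 0 → ℓ' ⬝ᵥ X = 0) : ∃ c : ℝ, ℓ' = c • ℓ := by
  have hpos : ℓ ⬝ᵥ ℓ ≠ 0 := fun h0 => hℓ (dotProduct_self_eq_zero.1 h0)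
  refine ⟨(ℓ' ⬝ᵥ ℓ) / (ℓ ⬝ᵥ ℓ), ?_⟩
  funext i
  have h1 := h (Pi.single i 1 - (ℓ i / (ℓ ⬝ᵥ ℓ)) • ℓ) (by
    rw [dotProduct_sub, dotProduct_smul, dotProduct_single_one, smul_eq_mul,
      div_mul_cancel₀ _ hpos, sub_self])
  rw [dotProduct_sub, dotProduct_smul, dotProduct_single_one, smul_eq_mul, sub_eq_zero] at h1
  rw [h1, Pi.smul_apply, smul_eq_mul]
  ring

/-- The area density depends only on the tangent plane and on the metric restricted to it. -/
theorem areaDensity_congr {G G' : Pt → Mat} {lam lam' : Pt → ℝ} {x : Pt} (hg : (G x).PosDef)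
    (hg' : (G' x).PosDef) (hℓ : diff lam x ≠ 0) (hℓ' : diff lam' x ≠ 0)
    (hker : ∀ X, diff lam x ⬝ᵥ X = 0 → diff lam' x ⬝ᵥ X = 0)
    (hgg' : ∀ X Y, diff lam x ⬝ᵥ X = 0 → diff lam x ⬝ᵥ Y = 0 → ev (G x) X Y = ev (G' x) X Y) :
    areaDensity G lam x = areaDensity G' lam' x := by
  rw [areaDensity_eq hg hℓ, areaDensity_eq hg' hℓ',
    ev_adjugate_congr hg.isMetric.isSymm hg'.isMetric.isSymm hℓ hgg']
  obtain ⟨c, hc⟩ := exists_smul_of_ker_le hℓ hker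
  have hc0 : c ≠ 0 := fun h0 => hℓ' (by rw [hc, h0, zero_smul])
  have e1 : ∑ i, diff lam' x i ^ 2 = c ^ 2 * ∑ i, diff lam x i ^ 2 := by
    simp only [hc, Finset.mul_sum, Pi.smul_apply, smul_eq_mul, mul_pow]
  rw [e1, hc, ev_smul_smul, ← sq, Real.sqrt_mul (sq_nonneg c), Real.sqrt_mul (sq_nonneg c),
    mul_div_mul_left]
  exact (Real.sqrt_pos.2 (by positivity)).ne'

end consistency

section edge
variable {g : Mat}

theorem cross_swap (g : Mat) (X Y : Vec) : cross g Y X = -cross g X Y := by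
  have h : crossCov Y X = -crossCov X Y := by
    rw [crossCov_eq, crossCov_eq]
    funext l
    fin_cases l <;> (simp; ring)
  rw [cross_eq, cross_eq, h, Matrix.mulVec_neg, smul_neg]

/-- On an edge `(𝔸U)_{μnnμ} = U_{ττ}` with `τ = n × μ`. -/
theorem AA_conormal (hg : IsMetric g) {U : Mat} (hU : U.IsSymm) (n μ : Vec) :
    ∑ i, ∑ j, ∑ k, ∑ l, AA g U i j k l * μ i * n j * n k * μ l
      = ev U (cross g n μ) (cross g n μ) := by
  rw [AFnnF_arg hg hU, cross_swap g n μ, ← neg_one_smul ℝ (cross g n μ), ev_smul_smul]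
  norm_num

/-- On an edge `tr(σ_E) = σ_{ττ}` with `τ = n × μ`. -/
theorem tr_edge (hg : IsMetric g) {n μ : Vec} (hn : ev g n n = 1) (hμ : ev g μ μ = 1)
    (hnμ : ev g n μ = 0) (σ : Mat) :
    tr (g⁻¹ - Matrix.vecMulVec n n - Matrix.vecMulVec μ μ) σ
      = ev σ (cross g n μ) (cross g n μ) := by
  have hE := (isFrame_of_orthonormal hg hn hμ hnμ).mul_transpose
  have h : g⁻¹ - Matrix.vecMulVec n n - Matrix.vecMulVec μ μ
      = Matrix.vecMulVec (cross g n μ) (cross g n μ) := by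
    rw [← hE]
    ext i j
    simp [Matrix.mul_apply, Fin.sum_univ_three, Matrix.vecMulVec_apply]
  rw [h]
  simp only [tr, ev, Matrix.vecMulVec_apply]
  exact Finset.sum_congr rfl fun i _ => Finset.sum_congr rfl fun j _ => by ring

end edge

/-! ### Tangent spaces of the facets of a triangulation -/

theorem diff_dotProduct (f : Pt → ℝ) (x : Pt) (X : Vec) :
    diff f x ⬝ᵥ X = fderiv ℝ f x (WithLp.toLp 2 X) := by
  have h : (WithLp.toLp 2 X : Pt) = ∑ k, X k • EuclideanSpace.single k (1 : ℝ) := by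
    ext i
    simp [Fin.sum_univ_three]
    fin_cases i <;> simp
  rw [h, map_sum]
  simp only [dotProduct, diff, pd, map_smul, smul_eq_mul, mul_comm]

namespace CurvedTriangulation
variable {Ω : Set Pt} {V : Type*} [DecidableEq V] (M : CurvedTriangulation Ω V)
variable {T T' F E S : Finset V} {x : Pt}

/-- The map of an element to its barycentric coordinates. -/
def baryMap (T : Finset V) (y : Pt) : {v // v ∈ T} → ℝ := fun v => M.bary T v y

/-- The derivative of the barycentric coordinates. -/
def baryDeriv (T : Finset V) (x : Pt) : Pt →L[ℝ] ({v // v ∈ T} → ℝ) :=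
  ContinuousLinearMap.pi fun v => fderiv ℝ (M.bary T v) x

theorem hasStrictFDerivAt_baryMap (hT : T ∈ M.cells) (hx : x ∈ M.carrier T) :
    HasStrictFDerivAt (M.baryMap T) (M.baryDeriv T x) x :=
  hasStrictFDerivAt_pi.2 fun v =>
    (M.smooth_bary T hT v v.2 x hx).hasStrictFDerivAt (by simp)

theorem baryDeriv_injective (hT : T ∈ M.cells) (hx : x ∈ M.carrier T) :
    Function.Injective (M.baryDeriv T x) := by
  rw [injective_iff_map_eq_zero]
  intro X hX
  exact M.immersion_bary T hT x hx X fun v hv => congrFun hX ⟨v, hv⟩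

theorem sum_fderiv_bary (hT : T ∈ M.cells) (hx : x ∈ M.carrier T) (X : Pt) :
    ∑ v ∈ T, fderiv ℝ (M.bary T v) x X = 0 := by
  have h1 : fderiv ℝ (fun y => ∑ v ∈ T, M.bary T v y) x = 0 := by
    rw [Filter.EventuallyEq.fderiv_eq (M.sum_bary T hT x hx)]
    exact fderiv_const_apply 1
  rw [fderiv_fun_sum fun v hv => (M.smooth_bary T hT v hv x hx).diffAt] at h1
  have h2 := congrArg (fun L : Pt →L[ℝ] ℝ => L X) h1
  simpa using h2

/-- The derivative of the barycentric coordinates is onto the functions of sum zero. -/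
theorem exists_fderiv_bary_eq (hT : T ∈ M.cells) (hx : x ∈ M.carrier T) (c : V → ℝ)
    (hc : ∑ v ∈ T, c v = 0) : ∃ X : Pt, ∀ v ∈ T, fderiv ℝ (M.bary T v) x X = c v := by
  set s : ({v // v ∈ T} → ℝ) →ₗ[ℝ] ℝ := ∑ v, LinearMap.proj v with hs
  set L : Pt →ₗ[ℝ] ({v // v ∈ T} → ℝ) := (M.baryDeriv T x).toLinearMap with hL
  have hsapply : ∀ f, s f = ∑ v, f v := fun f => by simp [hs]
  have hle : LinearMap.range L ≤ LinearMap.ker s := by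
    rintro _ ⟨X, rfl⟩
    rw [LinearMap.mem_ker, hsapply, ← M.sum_fderiv_bary hT hx X]
    exact Finset.sum_coe_sort T fun v => fderiv ℝ (M.bary T v) x X
  have hcard : Fintype.card {v // v ∈ T} = 4 := by
    rw [Fintype.card_coe, M.card_cell T hT]
  -- The derivative is injective on `ℝ³`, and the functions of sum zero form a hyperplane in `ℝ⁴`.
  have hr : Module.finrank ℝ (LinearMap.range L) = 3 := by
    rw [LinearMap.finrank_range_of_inj (M.baryDeriv_injective hT hx)]
    simp
  have hk : Module.finrank ℝ (LinearMap.ker s) ≤ 3 := by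
    have h1 := s.finrank_range_add_finrank_ker
    rw [Module.finrank_pi, hcard] at h1
    have hne : (T : Finset V).Nonempty := by
      rw [← Finset.card_pos, M.card_cell T hT]; norm_num
    obtain ⟨v, hv⟩ := hne
    have h2 : LinearMap.range s = ⊤ := by
      rw [LinearMap.range_eq_top]
      intro r
      refine ⟨Pi.single ⟨v, hv⟩ r, ?_⟩
      rw [hsapply, Finset.sum_pi_single']
      simp
    rw [h2, finrank_top, Module.finrank_self] at h1
    omega
  have heq := Submodule.eq_of_le_of_finrank_le hle (by rw [hr]; exact hk)
  have hmem : (fun v : {v // v ∈ T} => c v) ∈ LinearMap.ker s := by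
    rw [LinearMap.mem_ker, hsapply, ← hc]
    exact Finset.sum_coe_sort T c
  rw [← heq] at hmem
  obtain ⟨X, hX⟩ := hmem
  exact ⟨X, fun v hv => congrFun hX ⟨v, hv⟩⟩

theorem exists_fderiv_bary_eq_ite (hT : T ∈ M.cells) (hx : x ∈ M.carrier T) {u w : V}
    (hu : u ∈ T) (hw : w ∈ T) : ∃ X : Pt, ∀ v ∈ T,
      fderiv ℝ (M.bary T v) x X = (if v = u then 1 else 0) - if v = w then 1 else 0 := by
  refine M.exists_fderiv_bary_eq hT hx _ ?_
  rw [Finset.sum_sub_distrib, Finset.sum_ite_eq', Finset.sum_ite_eq', if_pos hu, if_pos hw,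
    sub_self]

theorem contDiffAt_wall (hT : T ∈ M.cells) (hx : x ∈ M.carrier T) (F : Finset V) :
    ContDiffAt ℝ ∞ (M.wall T F) x :=
  ContDiffAt.sum fun v hv => M.smooth_bary T hT v (Finset.mem_sdiff.1 hv).1 x hx

theorem fderiv_wall (hT : T ∈ M.cells) (hx : x ∈ M.carrier T) (F : Finset V) (X : Pt) :
    fderiv ℝ (M.wall T F) x X = ∑ v ∈ T \ F, fderiv ℝ (M.bary T v) x X := by
  have h : fderiv ℝ (M.wall T F) x = ∑ v ∈ T \ F, fderiv ℝ (M.bary T v) x :=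
    fderiv_fun_sum fun v hv =>
      (M.smooth_bary T hT v (Finset.mem_sdiff.1 hv).1 x hx).diffAt
  rw [h]; simp

/-- The coordinates that vanish on two different facets have independent differentials. -/
theorem exists_fderiv_wall (hT : T ∈ M.cells) (hx : x ∈ M.carrier T) {F F' : Finset V} {u w : V}
    (hF : T \ F = {u}) (hu : u ∈ T) (hw : w ∈ T) (hwF : w ∈ F) (huF' : u ∉ T \ F')
    (hwF' : w ∉ T \ F') :
    ∃ X : Pt, fderiv ℝ (M.wall T F) x X = 1 ∧ fderiv ℝ (M.wall T F') x X = 0 := by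
  obtain ⟨X, hX⟩ := M.exists_fderiv_bary_eq_ite hT hx hu hw
  refine ⟨X, ?_, ?_⟩
  · rw [M.fderiv_wall hT hx, hF, Finset.sum_singleton, hX u hu, if_pos rfl, if_neg, sub_zero]
    rintro rfl
    have : u ∈ T \ F := by rw [hF]; exact Finset.mem_singleton_self u
    exact (Finset.mem_sdiff.1 this).2 hwF
  · rw [M.fderiv_wall hT hx]
    refine Finset.sum_eq_zero fun v hv => ?_
    rw [hX v (Finset.mem_sdiff.1 hv).1, if_neg, if_neg, sub_self]
    · rintro rfl; exact hwF' hv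
    · rintro rfl; exact huF' hv

theorem sdiff_facet (hT : T ∈ M.cells) (hF : F ∈ T.powersetCard 3) : ∃ u, T \ F = {u} := by
  rw [Finset.mem_powersetCard] at hF
  rw [← Finset.card_eq_one, Finset.card_sdiff_of_subset hF.1, hF.2, M.card_cell T hT]

theorem diff_wall_ne_zero (hT : T ∈ M.cells) (hx : x ∈ M.carrier T)
    (hF : F ∈ T.powersetCard 3) : diff (M.wall T F) x ≠ 0 := by
  obtain ⟨u, hu⟩ := M.sdiff_facet hT hF
  have huT : u ∈ T := (Finset.mem_sdiff.1 (hu ▸ Finset.mem_singleton_self u)).1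
  have hF' := Finset.mem_powersetCard.1 hF
  obtain ⟨w, hw⟩ : F.Nonempty := by rw [← Finset.card_pos, hF'.2]; norm_num
  obtain ⟨X, hX, -⟩ := M.exists_fderiv_wall hT hx (F' := T) hu huT (hF'.1 hw) hw (by simp) (by simp)
  intro h0
  have := diff_dotProduct (M.wall T F) x (WithLp.ofLp X)
  rw [h0, zero_dotProduct, WithLp.toLp_ofLp, hX] at this
  exact zero_ne_one this

/-- The inverse of the barycentric coordinates near a point of an element: a linear map `A` to `ℝ³`
followed by a local diffeomorphism. -/
theorem exists_local_inverse (hT : T ∈ M.cells) (hx : x ∈ M.carrier T) :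
    ∃ (A : ({v // v ∈ T} → ℝ) →L[ℝ] Pt) (φ : Pt → Pt),
      (∀ X, A (M.baryDeriv T x X) = X) ∧
      HasStrictFDerivAt φ (ContinuousLinearMap.id ℝ Pt) (A (M.baryMap T x)) ∧
      ∀ᶠ y in nhds x, φ (A (M.baryMap T y)) = y := by
  obtain ⟨A₀, hA₀⟩ := (M.baryDeriv T x).toLinearMap.exists_leftInverse_of_injective
    (LinearMap.ker_eq_bot.2 (M.baryDeriv_injective hT hx))
  set A : ({v // v ∈ T} → ℝ) →L[ℝ] Pt := LinearMap.toContinuousLinearMap A₀ with hA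
  have hAX : ∀ X, A (M.baryDeriv T x X) = X := fun X => congrArg (fun L => L X) hA₀
  have h1 : HasStrictFDerivAt (fun y => A (M.baryMap T y))
      ((ContinuousLinearEquiv.refl ℝ Pt : Pt ≃L[ℝ] Pt) : Pt →L[ℝ] Pt) x := by
    have h := A.hasStrictFDerivAt.comp x (M.hasStrictFDerivAt_baryMap hT hx)
    have e : A.comp (M.baryDeriv T x)
        = ((ContinuousLinearEquiv.refl ℝ Pt : Pt ≃L[ℝ] Pt) : Pt →L[ℝ] Pt) := by
      ext1 X
      exact hAX X
    rw [e] at h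
    exact h
  exact ⟨A, h1.localInverse _ _ _, hAX, h1.to_localInverse, h1.eventually_left_inverse⟩

theorem continuousOn_baryMap (hT : T ∈ M.cells) : ContinuousOn (M.baryMap T) (M.carrier T) :=
  fun _ hx => (M.hasStrictFDerivAt_baryMap hT hx).continuousAt.continuousWithinAt

/-- Points of an element converge when their barycentric coordinates do. -/
theorem tendsto_of_tendsto_baryMap (hT : T ∈ M.cells) (hx : x ∈ M.carrier T) {ι : Type*}
    {l : Filter ι} {f : ι → Pt} (hf : ∀ᶠ t in l, f t ∈ M.carrier T)
    (h : Filter.Tendsto (fun t => M.baryMap T (f t)) l (nhds (M.baryMap T x))) :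
    Filter.Tendsto f l (nhds x) := by
  refine (M.isCompact_carrier T hT).tendsto_nhds_of_unique_mapClusterPt hf fun y hy hcl => ?_
  refine (M.bijOn_bary T hT).injOn hy hx ?_
  have h1 : MapClusterPt (M.baryMap T y) l (fun t => M.baryMap T (f t)) :=
    hcl.continuousAt_comp (M.hasStrictFDerivAt_baryMap hT hy).continuousAt
  exact eq_of_nhds_neBot ((h1.neBot).mono (inf_le_inf_left _ h))

theorem sum_baryMap (hT : T ∈ M.cells) (hx : x ∈ M.carrier T) : ∑ v ∈ T, M.bary T v x = 1 :=
  (M.sum_bary T hT x hx).self_of_nhds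

theorem bary_nonneg (hT : T ∈ M.cells) (hx : x ∈ M.carrier T) {v : V} (hv : v ∈ T) :
    0 ≤ M.bary T v x :=
  ((M.bijOn_bary T hT).mapsTo hx).1 ⟨v, hv⟩

/-- A function that vanishes on a face is stationary at `x` in the directions from `x` to the
vertices of the face. -/
theorem exists_direction (hT : T ∈ M.cells) (hx : x ∈ M.face T F) {w : V} (hwF : w ∈ F)
    (hwT : w ∈ T) {f : Pt → ℝ} (hf : DifferentiableAt ℝ f x) (h0 : ∀ y ∈ M.face T F, f y = 0) :
    ∃ X : Pt, (∀ v ∈ T, fderiv ℝ (M.bary T v) x X = (if v = w then 1 else 0) - M.bary T v x) ∧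
      fderiv ℝ f x X = 0 := by
  have hxT := hx.1
  obtain ⟨X, hX⟩ := M.exists_fderiv_bary_eq hT hxT
    (fun v => (if v = w then 1 else 0) - M.bary T v x) (by
      rw [Finset.sum_sub_distrib, Finset.sum_ite_eq', if_pos hwT, M.sum_baryMap hT hxT, sub_self])
  refine ⟨X, hX, ?_⟩
  obtain ⟨A, φ, hA, hφ, hinv⟩ := M.exists_local_inverse hT hxT
  set p : ℝ → ({v // v ∈ T} → ℝ) := fun t => M.baryMap T x + t • M.baryDeriv T x X with hp
  have hpv : ∀ t (v : {v // v ∈ T}), p t v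
      = M.bary T v x + t * ((if (v : V) = w then 1 else 0) - M.bary T v x) := by
    intro t v
    rw [← hX v v.2]
    rfl
  -- The segment from `x` to the vertex `w` stays in the face.
  have hy : ∀ t ∈ Set.Icc (0 : ℝ) 1, ∃ y ∈ M.carrier T, M.baryMap T y = p t := by
    intro t ht
    refine (M.bijOn_bary T hT).surjOn ⟨fun v => ?_, ?_⟩
    · rw [hpv]
      have h1 := M.bary_nonneg hT hxT v.2
      have h2 : 0 ≤ (1 - t) * M.bary T v x := mul_nonneg (sub_nonneg.2 ht.2) h1
      split_ifs <;> nlinarith [ht.1]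
    · simp only [hpv]
      rw [Finset.sum_coe_sort T fun v => M.bary T v x
        + t * ((if v = w then 1 else 0) - M.bary T v x)]
      rw [Finset.sum_add_distrib, ← Finset.mul_sum, Finset.sum_sub_distrib, Finset.sum_ite_eq',
        if_pos hwT, M.sum_baryMap hT hxT]
      ring
  choose! y hyT hyp using hy
  have hyF : ∀ t ∈ Set.Icc (0 : ℝ) 1, y t ∈ M.face T F := by
    intro t ht
    refine ⟨hyT t ht, fun v hv => ?_⟩
    obtain ⟨hvT, hvF⟩ := Finset.mem_sdiff.1 hv
    have h1 : M.bary T v (y t) = p t ⟨v, hvT⟩ := congrFun (hyp t ht) ⟨v, hvT⟩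
    have h2 : M.bary T v x = 0 := hx.2 v hv
    have h3 : v ≠ w := by rintro rfl; exact hvF hwF
    rw [h1, hpv, h2, if_neg h3]
    ring
  have hmem : ∀ᶠ t in nhdsWithin (0 : ℝ) (Set.Ioi 0), t ∈ Set.Icc (0 : ℝ) 1 := by
    filter_upwards [Ioo_mem_nhdsGT (zero_lt_one' ℝ)] with t ht using ⟨ht.1.le, ht.2.le⟩
  have hpc : Filter.Tendsto p (nhdsWithin 0 (Set.Ioi 0)) (nhds (M.baryMap T x)) := by
    have h1 : Continuous p := by fun_prop
    have h2 := h1.tendsto 0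
    rw [show p 0 = M.baryMap T x by simp [hp]] at h2
    exact h2.mono_left nhdsWithin_le_nhds
  have hyx : Filter.Tendsto y (nhdsWithin 0 (Set.Ioi 0)) (nhds x) := by
    refine M.tendsto_of_tendsto_baryMap hT hxT (hmem.mono fun t ht => hyT t ht) ?_
    exact hpc.congr' (hmem.mono fun t ht => (hyp t ht).symm)
  have hzero : ∀ᶠ t in nhdsWithin (0 : ℝ) (Set.Ioi 0), f (φ (A (p t))) = 0 := by
    filter_upwards [hmem, hyx.eventually hinv] with t ht h1
    rw [← hyp t ht, h1]
    exact h0 _ (hyF t ht)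
  have hφx : φ (A (M.baryMap T x)) = x := hinv.self_of_nhds
  -- The curve `φ (A (p t))` has velocity `X` at `x`; for small `t ≥ 0` it runs in the face.
  have hd : HasDerivAt (fun t => f (φ (A (p t)))) (fderiv ℝ f x X) 0 := by
    have h1 : HasDerivAt (fun t => A (p t)) X 0 := by
      have h2 : HasDerivAt p (M.baryDeriv T x X) 0 := by
        have h := ((hasDerivAt_id (0 : ℝ)).smul_const (M.baryDeriv T x X)).const_add
          (M.baryMap T x)
        rw [one_smul] at h
        exact h
      have h3 := A.hasFDerivAt.comp_hasDerivAt (0 : ℝ) h2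
      rwa [hA] at h3
    have hp0 : A (p 0) = A (M.baryMap T x) := by simp [hp]
    have h4 : HasFDerivAt φ (ContinuousLinearMap.id ℝ Pt) (A (p 0)) := by
      rw [hp0]; exact hφ.hasFDerivAt
    have h5 := h4.comp_hasDerivAt (0 : ℝ) h1
    have h6 : HasFDerivAt f (fderiv ℝ f x) (φ (A (p 0))) := by
      rw [hp0, hφx]; exact hf.hasFDerivAt
    exact h6.comp_hasDerivAt (0 : ℝ) h5
  have hd0 : HasDerivWithinAt (fun t => f (φ (A (p t)))) 0 (Set.Ioi 0) 0 := by
    refine (hasDerivWithinAt_const (0 : ℝ) (Set.Ioi 0) (0 : ℝ)).congr_of_eventuallyEq hzero ?_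
    have hp0 : A (p 0) = A (M.baryMap T x) := by simp [hp]
    rw [hp0, hφx]
    exact h0 x hx
  exact (uniqueDiffWithinAt_Ioi (0 : ℝ)).eq_deriv _ hd.hasDerivWithinAt hd0

/-- The tangent plane of a facet does not depend on the adjacent element. -/
theorem fderiv_wall_eq_zero (hT : T ∈ M.cells) (hT' : T' ∈ M.cells) (hF : F ∈ T.powersetCard 3)
    (hFT' : F ⊆ T') (hx : x ∈ M.face T F) {X : Pt} (hX : fderiv ℝ (M.wall T F) x X = 0) :
    fderiv ℝ (M.wall T' F) x X = 0 := by
  have hFT := (Finset.mem_powersetCard.1 hF).1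
  have hface : M.face T F = M.face T' F :=
    M.face_eq T hT T' hT' F (Finset.subset_inter hFT hFT')
  have hx' : x ∈ M.carrier T' := (hface ▸ hx).1
  have h0 : ∀ y ∈ M.face T F, M.wall T' F y = 0 := by
    intro y hy
    rw [hface] at hy
    exact Finset.sum_eq_zero fun v hv => hy.2 v hv
  have hd := fun w (hw : w ∈ F) => M.exists_direction hT hx hw (hFT hw)
    (M.contDiffAt_wall hT' hx' F).diffAt h0
  choose! Y hY hY0 using hd
  obtain ⟨u, hu⟩ := M.sdiff_facet hT hF
  have hXu : fderiv ℝ (M.bary T u) x X = 0 := by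
    rw [← hX, M.fderiv_wall hT hx.1, hu, Finset.sum_singleton]
  have hsum : ∑ w ∈ F, fderiv ℝ (M.bary T w) x X = 0 := by
    have h1 := M.sum_fderiv_bary hT hx.1 X
    rw [← Finset.sum_sdiff hFT, hu, Finset.sum_singleton, hXu, zero_add] at h1
    exact h1
  -- The directions to the vertices of `F` span the tangent plane of `F`.
  have hXY : X = ∑ w ∈ F, fderiv ℝ (M.bary T w) x X • Y w := by
    rw [← sub_eq_zero]
    refine M.immersion_bary T hT x hx.1 _ fun v hv => ?_
    rw [map_sub, map_sum, sub_eq_zero]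
    have h1 : ∀ w ∈ F, fderiv ℝ (M.bary T v) x (fderiv ℝ (M.bary T w) x X • Y w)
        = (if v = w then fderiv ℝ (M.bary T w) x X else 0)
          - fderiv ℝ (M.bary T w) x X * M.bary T v x := by
      intro w hw
      rw [map_smul, hY w hw v hv, smul_eq_mul, mul_sub]
      split_ifs <;> simp
    rw [Finset.sum_congr rfl h1, Finset.sum_sub_distrib, ← Finset.sum_mul, hsum, zero_mul,
      sub_zero, Finset.sum_ite_eq]
    by_cases hvF : v ∈ F
    · rw [if_pos hvF]
    · have : v ∈ T \ F := Finset.mem_sdiff.2 ⟨hv, hvF⟩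
      rw [hu, Finset.mem_singleton] at this
      rw [if_neg hvF, this, hXu]
  rw [hXY, map_sum]
  refine Finset.sum_eq_zero fun w hw => ?_
  rw [map_smul, hY0 w hw, smul_zero]

theorem diff_wall_dotProduct_eq_zero (hT : T ∈ M.cells) (hT' : T' ∈ M.cells)
    (hF : F ∈ T.powersetCard 3) (hFT' : F ⊆ T') (hx : x ∈ M.face T F) {X : Vec}
    (hX : diff (M.wall T F) x ⬝ᵥ X = 0) : diff (M.wall T' F) x ⬝ᵥ X = 0 := by
  rw [diff_dotProduct] at hX ⊢
  exact M.fderiv_wall_eq_zero hT hT' hF hFT' hx hX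

end CurvedTriangulation

/-! ### Smoothness and integrability of facet and edge quantities -/

/-- A matrix field with smooth components near `x`. -/
def SmoothMat (B : Pt → Mat) (x : Pt) : Prop := ∀ i j, ContDiffAt ℝ ∞ (fun y => B y i j) x

/-- A vector field with smooth components near `x`. -/
def SmoothVec (X : Pt → Vec) (x : Pt) : Prop := ∀ i, ContDiffAt ℝ ∞ (fun y => X y i) x

section smooth
variable {B C D G σ : Pt → Mat} {X Y : Pt → Vec} {f lam : Pt → ℝ} {x : Pt}

theorem SmoothMat.mul (hB : SmoothMat B x) (hC : SmoothMat C x) :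
    SmoothMat (fun y => B y * C y) x := fun i j => by
  simp only [Matrix.mul_apply]
  exact ContDiffAt.sum fun k _ => (hB i k).mul (hC k j)

theorem SmoothMat.transpose (hB : SmoothMat B x) : SmoothMat (fun y => (B y)ᵀ) x :=
  fun i j => hB j i

theorem SmoothMat.add (hB : SmoothMat B x) (hC : SmoothMat C x) :
    SmoothMat (fun y => B y + C y) x := fun i j => (hB i j).add (hC i j)

theorem SmoothMat.sub (hB : SmoothMat B x) (hC : SmoothMat C x) :
    SmoothMat (fun y => B y - C y) x := fun i j => (hB i j).sub (hC i j)

theorem SmoothMat.smul (hf : ContDiffAt ℝ ∞ f x) (hB : SmoothMat B x) :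
    SmoothMat (fun y => f y • B y) x := fun i j => hf.mul (hB i j)

theorem SmoothVec.smul (hf : ContDiffAt ℝ ∞ f x) (hX : SmoothVec X x) :
    SmoothVec (fun y => f y • X y) x := fun i => hf.mul (hX i)

theorem SmoothVec.vecMulVec (hX : SmoothVec X x) (hY : SmoothVec Y x) :
    SmoothMat (fun y => Matrix.vecMulVec (X y) (Y y)) x := fun i j => (hX i).mul (hY j)

theorem SmoothMat.mulVec (hB : SmoothMat B x) (hX : SmoothVec X x) :
    SmoothVec (fun y => B y *ᵥ X y) x := fun i => by
  simp only [Matrix.mulVec, dotProduct]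
  exact ContDiffAt.sum fun j _ => (hB i j).mul (hX j)

theorem SmoothMat.ev (hB : SmoothMat B x) (hX : SmoothVec X x) (hY : SmoothVec Y x) :
    ContDiffAt ℝ ∞ (fun y => ev (B y) (X y) (Y y)) x :=
  ContDiffAt.sum fun i _ => ContDiffAt.sum fun j _ => ((hB i j).mul (hX i)).mul (hY j)

theorem SmoothMat.ip (hB : SmoothMat B x) (hC : SmoothMat C x) (hD : SmoothMat D x) :
    ContDiffAt ℝ ∞ (fun y => ip (B y) (C y) (D y)) x :=
  ContDiffAt.sum fun i _ => ContDiffAt.sum fun j _ => ContDiffAt.sum fun k _ =>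
    ContDiffAt.sum fun l _ => (((hC i j).mul (hD k l)).mul (hB i k)).mul (hB j l)

theorem SmoothMat.tr (hB : SmoothMat B x) (hC : SmoothMat C x) :
    ContDiffAt ℝ ∞ (fun y => tr (B y) (C y)) x :=
  ContDiffAt.sum fun i _ => ContDiffAt.sum fun j _ => (hB i j).mul (hC i j)

theorem SmoothMat.flat (hB : SmoothMat B x) (hX : SmoothVec X x) :
    SmoothVec (fun y => flat (B y) (X y)) x := fun j =>
  ContDiffAt.sum fun i _ => (hB i j).mul (hX i)

theorem SmoothMat.proj (hB : SmoothMat B x) (hX : SmoothVec X x) :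
    SmoothMat (fun y => proj (B y) (X y)) x :=
  SmoothMat.sub (fun _ _ => contDiffAt_const) (hX.vecMulVec (hB.flat hX))

theorem SmoothMat.restr (hB : SmoothMat B x) (hX : SmoothVec X x) (hC : SmoothMat C x) :
    SmoothMat (fun y => restr (B y) (X y) (C y)) x :=
  ((hB.proj hX).transpose.mul hC).mul (hB.proj hX)

theorem MetricAt.smoothMat (h : MetricAt ∞ G x) : SmoothMat G x := h.smooth

theorem MetricAt.smoothMat_inv (h : MetricAt ∞ G x) : SmoothMat (fun y => (G y)⁻¹) x :=
  h.contDiffAt_inv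

theorem MetricAt.smooth_invFacet (h : MetricAt ∞ G x) (hX : SmoothVec X x) :
    SmoothMat (fun y => invFacet (G y) (X y)) x :=
  h.smoothMat_inv.sub (hX.vecMulVec hX)

theorem MetricAt.smooth_traceRev (h : MetricAt ∞ G x) (hX : SmoothVec X x)
    (hC : SmoothMat C x) : SmoothMat (fun y => traceRev (G y) (X y) (C y)) x :=
  (h.smoothMat.restr hX hC).sub (SmoothMat.smul
    ((h.smooth_invFacet hX).tr (h.smoothMat.restr hX hC)) (h.smoothMat.restr hX h.smoothMat))

theorem MetricAt.smooth_cross (h : MetricAt ∞ G x) (hX : SmoothVec X x) (hY : SmoothVec Y x) :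
    SmoothVec (fun y => cross (G y) (X y) (Y y)) x := fun i =>
  ContDiffAt.sum fun l _ => ContDiffAt.sum fun a _ => ContDiffAt.sum fun b _ =>
    (h.contDiffAt_inv i l).mul (((((contDiffAt_det h.smooth).sqrt h.det_pos.ne').mul
      contDiffAt_const).mul (hX a)).mul (hY b))

theorem smooth_normalize (hB : SmoothMat B x) (hX : SmoothVec X x)
    (hne : 0 < ev (B x) (X x) (X x)) :
    ContDiffAt ℝ ∞ (fun y => (Real.sqrt (ev (B y) (X y) (X y)))⁻¹) x :=
  ((hB.ev hX hX).sqrt hne.ne').fun_inv (Real.sqrt_pos.2 hne).ne'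

theorem smooth_diff (hl : ContDiffAt ℝ ∞ lam x) : SmoothVec (diff lam) x := fun k => hl.pd k

theorem MetricAt.smooth_normal (h : MetricAt ∞ G x) (hg : (G x).PosDef)
    (hl : ContDiffAt ℝ ∞ lam x) (hℓ : diff lam x ≠ 0) : SmoothVec (normal G lam) x :=
  SmoothVec.smul (smooth_normalize h.smoothMat_inv (smooth_diff hl) (ev_inv_self_pos hg hℓ))
    (h.smoothMat_inv.mulVec (smooth_diff hl))

theorem MetricAt.smooth_secondFF (h : MetricAt ∞ G x) (hn : SmoothVec (normal G lam) x) :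
    SmoothMat (secondFF G lam) x := by
  refine h.smoothMat.restr hn fun i j => ContDiffAt.neg (ContDiffAt.sum fun k _ =>
    ContDiffAt.mul (ContDiffAt.add ((hn k).pd i) (ContDiffAt.sum fun m _ =>
      (h.contDiffAt_christoffel k i m).mul (hn m))) (h.smooth k j))

theorem MetricAt.smooth_flux (h : MetricAt ∞ G x) (hn : SmoothVec (normal G lam) x)
    (hσ : SmoothMat σ x) :
    SmoothMat (fun y => sigmaNN G σ lam y • secondFF G lam y + nablaFnF G σ lam y
      + nablaContr G σ lam y - nablanFF G σ lam y) x := by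
  have h1 : ContDiffAt ℝ ∞ (sigmaNN G σ lam) x := hσ.ev hn hn
  have hN := fun k i j => contDiffAt_cov2 h hσ k i j
  have h2 : SmoothMat (nablaFnF G σ lam) x := h.smoothMat.restr hn fun i j =>
    ContDiffAt.sum fun a _ => (hN i a j).mul (hn a)
  have h3 : SmoothMat (nablanFF G σ lam) x := h.smoothMat.restr hn fun i j =>
    ContDiffAt.sum fun a _ => (hN a i j).mul (hn a)
  have hα : ∀ b, ContDiffAt ℝ ∞ (fun y => ∑ a, normal G lam y a * σ y a b) x := fun b =>
    ContDiffAt.sum fun a _ => (hn a).mul (hσ a b)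
  have h4 : SmoothMat (nablaContr G σ lam) x := h.smoothMat.restr hn fun i j =>
    ContDiffAt.sub ((hα j).pd i) (ContDiffAt.sum fun m _ =>
      (h.contDiffAt_christoffel m i j).mul (hα m))
  exact ((SmoothMat.smul h1 (h.smooth_secondFF hn)).add h2).add h4 |>.sub h3

theorem MetricAt.smooth_areaDensity (h : MetricAt ∞ G x) (hn : SmoothVec (normal G lam) x)
    (hl : ContDiffAt ℝ ∞ lam x) (hℓ : diff lam x ≠ 0) :
    ContDiffAt ℝ ∞ (areaDensity G lam) x := by
  have hd := smooth_diff hl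
  have h1 : ContDiffAt ℝ ∞ (fun y => ∑ i, diff lam y i ^ 2) x :=
    ContDiffAt.sum fun i _ => (hd i).pow 2
  have h2 : 0 < ∑ i, diff lam x i ^ 2 := by
    obtain ⟨i, hi⟩ := Function.ne_iff.1 hℓ
    exact Finset.sum_pos' (fun i _ => sq_nonneg _) ⟨i, Finset.mem_univ i, by
      have : diff lam x i ≠ 0 := hi
      positivity⟩
  exact (((contDiffAt_det h.smooth).sqrt h.det_pos.ne').mul (ContDiffAt.sum fun i _ =>
    (hn i).mul (hd i))).div (h1.sqrt h2.ne') (Real.sqrt_pos.2 h2).ne'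

end smooth

namespace CurvedTriangulation
variable {Ω : Set Pt} {V : Type*} [DecidableEq V] (M : CurvedTriangulation Ω V)
variable {T T' F E S : Finset V} {x : Pt}

theorem isCompact_face (hT : T ∈ M.cells) (S : Finset V) : IsCompact (M.face T S) := by
  have h1 : M.face T S = M.carrier T ∩ M.baryMap T ⁻¹'
      {f | ∀ v : {v // v ∈ T}, (v : V) ∈ T \ S → f v = 0} := by
    ext y
    refine and_congr_right fun _ => ⟨fun h v hv => h v hv, fun h v hv => ?_⟩
    exact h ⟨v, (Finset.mem_sdiff.1 hv).1⟩ hv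
  have h2 : IsClosed {f : {v // v ∈ T} → ℝ | ∀ v : {v // v ∈ T}, (v : V) ∈ T \ S → f v = 0} := by
    simp only [Set.ofPred_forall]
    exact isClosed_iInter fun v => isClosed_iInter fun _ =>
      isClosed_eq (continuous_apply v) continuous_const
  have hc := M.isCompact_carrier T hT
  rw [h1]
  exact hc.of_isClosed_subset ((M.continuousOn_baryMap hT).preimage_isClosed_of_isClosed
    hc.isClosed h2) Set.inter_subset_left

/-- A `d`-dimensional subsimplex has finite `d`-dimensional measure: locally it is a Lipschitz image
of a part of the unit cube. -/
theorem face_measure_lt_top (hT : T ∈ M.cells) (hS : S ⊆ T) {d : ℕ} (hd : S.card = d + 1) :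
    (μHE[d] : Measure Pt) (M.face T S) < ⊤ := by
  have hH : (μH[(d : ℝ)] : Measure Pt) (M.face T S) < ⊤ := by
    refine (M.isCompact_face hT S).measure_lt_top_of_nhdsWithin fun x hx => ?_
    obtain ⟨A, φ, -, hφ, hinv⟩ := M.exists_local_inverse hT hx.1
    obtain ⟨w, hw⟩ : S.Nonempty := by rw [← Finset.card_pos, hd]; omega
    set I := {v // v ∈ S.erase w} with hI
    have hIcard : Fintype.card I = d := by
      simp only [hI]
      rw [Fintype.card_coe, Finset.card_erase_of_mem hw, hd, Nat.add_sub_cancel]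
    -- The simplex with vertex set `S` is a graph over the cube with the coordinates `S \ {w}`.
    set P : (I → ℝ) → ({v // v ∈ T} → ℝ) := fun q v =>
      if h : (v : V) ∈ S.erase w then q ⟨v, h⟩ else if (v : V) = w then 1 - ∑ u, q u else 0 with hP
    set q : Pt → (I → ℝ) := fun y u => M.bary T u y with hq
    have hPc : ContDiff ℝ 1 P := by
      refine contDiff_pi.2 fun v => ?_
      simp only [hP]
      split_ifs <;> fun_prop
    have hPq : ∀ y ∈ M.face T S, P (q y) = M.baryMap T y := by
      intro y hy
      funext v
      simp only [hP, hq, baryMap]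
      split_ifs with h1 h2
      · rfl
      · rw [Finset.sum_coe_sort (S.erase w) fun u => M.bary T u y, h2]
        have h3 := M.sum_baryMap hT hy.1
        rw [← Finset.sum_sdiff hS, Finset.sum_eq_zero fun v hv => hy.2 v hv, zero_add,
          ← Finset.add_sum_erase S _ hw] at h3
        linarith
      · exact (hy.2 v (Finset.mem_sdiff.2 ⟨v.2, fun hvS =>
          h1 (Finset.mem_erase.2 ⟨h2, hvS⟩)⟩)).symm
    have hΦ : HasStrictFDerivAt (fun r => φ (A (P r)))
        ((ContinuousLinearMap.id ℝ Pt).comp (A.comp (fderiv ℝ P (q x)))) (q x) := by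
      have h1 : HasStrictFDerivAt P (fderiv ℝ P (q x)) (q x) :=
        hPc.contDiffAt.hasStrictFDerivAt one_ne_zero
      have h2 := A.hasStrictFDerivAt.comp (q x) h1
      refine HasStrictFDerivAt.comp (q x) (g := φ) ?_ h2
      have : A (P (q x)) = A (M.baryMap T x) := congrArg A (hPq x hx)
      rw [this]
      exact hφ
    obtain ⟨K, s, hs, hK⟩ := hΦ.exists_lipschitzOnWith
    have hqc : ContinuousAt q x := continuousAt_pi.2 fun u =>
      (M.smooth_bary T hT u (hS (Finset.mem_erase.1 u.2).2) x hx.1).continuousAt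
    refine ⟨(M.face T S) ∩ {y | q y ∈ s ∧ φ (A (M.baryMap T y)) = y},
      inter_mem_nhdsWithin _ (Filter.inter_mem (hqc hs) hinv), ?_⟩
    have hsub : (M.face T S) ∩ {y | q y ∈ s ∧ φ (A (M.baryMap T y)) = y}
        ⊆ (fun r => φ (A (P r))) '' (s ∩ Set.Icc 0 1) := by
      rintro y ⟨hy, hys, hye⟩
      refine ⟨q y, ⟨hys, fun u => ?_, fun u => ?_⟩, ?_⟩
      · exact M.bary_nonneg hT hy.1 (hS (Finset.mem_erase.1 u.2).2)
      · have huT := hS (Finset.mem_erase.1 u.2).2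
        rw [Pi.one_apply, ← M.sum_baryMap hT hy.1]
        exact Finset.single_le_sum (f := fun v => M.bary T v y)
          (fun v hv => M.bary_nonneg hT hy.1 hv) huT
      · simp only [hPq y hy, hye]
    refine (measure_mono hsub).trans_lt ?_
    refine ((hK.mono Set.inter_subset_left).hausdorffMeasure_image_le
      (d := (d : ℝ)) (Nat.cast_nonneg d)).trans_lt ?_
    refine ENNReal.mul_lt_top (by finiteness) ?_
    refine (measure_mono Set.inter_subset_right).trans_lt ?_
    rw [← hIcard, hausdorffMeasure_pi_real]
    exact isCompact_Icc.measure_lt_top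
  rw [Measure.euclideanHausdorffMeasure_def, Measure.smul_apply]
  exact ENNReal.mul_lt_top (by simp) hH

theorem integrableOn_face (hT : T ∈ M.cells) (hS : S ⊆ T) {d : ℕ} (hd : S.card = d + 1)
    {f : Pt → ℝ} (hf : ContinuousOn f (M.face T S)) :
    IntegrableOn f (M.face T S) μHE[d] := by
  have hc := M.isCompact_face hT S
  obtain ⟨C, hC⟩ := hc.exists_bound_of_continuousOn hf
  exact ⟨hf.aestronglyMeasurable hc.measurableSet, .restrict_of_bounded (C := C)
    (M.face_measure_lt_top hT hS hd)
    ((ae_restrict_iff' hc.measurableSet).2 (Filter.Eventually.of_forall hC))⟩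

end CurvedTriangulation

/-! ### Traces and trace reversal on a facet -/

theorem ip_comm {h : Mat} (hh : h.IsSymm) (B C : Mat) : ip h B C = ip h C B := by
  simp only [ip, Fin.sum_univ_three, hh.apply 0 1, hh.apply 0 2, hh.apply 1 2]
  ring

section frame
variable {g E : Mat} {n : Vec}

/-- Pairing with `𝕊_F U` in terms of contractions with the inverse facet metric, which are
single-valued. -/
theorem IsFrame.ip_traceRev_right (h : IsFrame g n E) (B U : Mat) :
    ip (invFacet g n) B (traceRev g n U)
      = ip (invFacet g n) B U - tr (invFacet g n) B * tr (invFacet g n) U := by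
  rw [h.ip_invFacet, h.ip_invFacet, h.traceRev_conj, h.tr_invFacet, h.tr_invFacet]
  generalize Eᵀ * U * E = V
  generalize Eᵀ * B * E = C
  simp [planeProj, Fin.sum_univ_three, Matrix.diagonal_apply]
  ring

theorem IsFrame.tr_eq_ip (h : IsFrame g n E) (U : Mat) :
    tr (invFacet g n) U = ip (invFacet g n) g U := by
  rw [h.ip_invFacet, h.tr_invFacet, h.orthonormal]
  simp [Fin.sum_univ_three]

end frame

theorem triple_neg_right (h B C D : Mat) : triple h B C (-D) = -triple h B C D := by
  simp only [triple, Matrix.mul_neg, Matrix.neg_mul, Matrix.trace_neg]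

/-! ### Facets, edges and the elements around them -/

theorem pick_mem {V : Type*} {s : Finset (Finset V)} (h : s.Nonempty) : pick s ∈ s := by
  rw [pick, dif_pos h]
  exact h.choose_spec

namespace CurvedTriangulation
variable {Ω : Set Pt} {V : Type*} [DecidableEq V] {M : CurvedTriangulation Ω V}
variable {T T' F E S : Finset V} {x : Pt} {g U σ : PField V}

theorem mem_star : T ∈ M.star S ↔ T ∈ M.cells ∧ S ⊆ T := Finset.mem_filter

theorem IsReggeMetric.posDef (hg : M.IsReggeMetric g) (hT : T ∈ M.cells)
    (hx : x ∈ M.carrier T) : (g T x).PosDef := hg.2 T hT x hx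

theorem IsReggeMetric.metricAt (hg : M.IsReggeMetric g) (hT : T ∈ M.cells)
    (hx : x ∈ M.carrier T) : MetricAt ∞ (g T) x :=
  ⟨(hg.1.1 T hT).1, (hg.1.1 T hT).2 x hx, (hg.posDef hT hx).det_pos⟩

theorem IsReggeMetric.ev_nor_self (hg : M.IsReggeMetric g) (hT : T ∈ M.cells)
    (hx : x ∈ M.carrier T) (hF : F ∈ T.powersetCard 3) :
    ev (g T x) (M.nor g T F x) (M.nor g T F x) = 1 :=
  ev_normal_self (hg.posDef hT hx) (M.diff_wall_ne_zero hT hx hF)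

theorem IsReggeMetric.exists_frame (hg : M.IsReggeMetric g) (hT : T ∈ M.cells)
    (hx : x ∈ M.carrier T) (hF : F ∈ T.powersetCard 3) :
    ∃ E, IsFrame (g T x) (M.nor g T F x) E :=
  exists_isFrame (hg.posDef hT hx) (hg.ev_nor_self hT hx hF)

theorem mem_facets : F ∈ M.facets ↔ ∃ T ∈ M.cells, F ∈ T.powersetCard 3 := Finset.mem_biUnion

theorem mem_edges : E ∈ M.edges ↔ ∃ T ∈ M.cells, E ∈ T.powersetCard 2 := Finset.mem_biUnion

theorem mem_powersetCard_of_mem_star (hF : F ∈ M.facets) (hT : T ∈ M.star F) :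
    F ∈ T.powersetCard 3 := by
  obtain ⟨T', -, h⟩ := mem_facets.1 hF
  exact Finset.mem_powersetCard.2 ⟨(mem_star.1 hT).2, (Finset.mem_powersetCard.1 h).2⟩

theorem side_mem_star_of_facet (hF : F ∈ M.facets) : M.side F ∈ M.star F := by
  obtain ⟨T, hT, h⟩ := mem_facets.1 hF
  exact pick_mem ⟨T, mem_star.2 ⟨hT, (Finset.mem_powersetCard.1 h).1⟩⟩

theorem side_mem_star_of_edge (hE : E ∈ M.edges) : M.side E ∈ M.star E := by
  obtain ⟨T, hT, h⟩ := mem_edges.1 hE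
  exact pick_mem ⟨T, mem_star.2 ⟨hT, (Finset.mem_powersetCard.1 h).1⟩⟩

theorem mem_facets_of_mem_intFacets (hF : F ∈ M.intFacets) : F ∈ M.facets := by
  classical exact (Finset.mem_filter.1 hF).1

theorem mem_edges_of_mem_intEdges (hE : E ∈ M.intEdges) : E ∈ M.edges := by
  classical exact (Finset.mem_filter.1 hE).1

theorem face_eq_of_mem_star (hT : T ∈ M.star S) (hT' : T' ∈ M.star S) :
    M.face T S = M.face T' S :=
  M.face_eq T (mem_star.1 hT).1 T' (mem_star.1 hT').1 S
    (Finset.subset_inter (mem_star.1 hT).2 (mem_star.1 hT').2)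

theorem tangent_of_diff_wall (hT : T ∈ M.cells) (hx : x ∈ M.carrier T)
    (hF : F ∈ T.powersetCard 3) {X : Vec} (hX : diff (M.wall T F) x ⬝ᵥ X = 0) :
    M.Tangent T F x X := by
  intro v hv
  obtain ⟨u, hu⟩ := M.sdiff_facet hT hF
  rw [diff_dotProduct, M.fderiv_wall hT hx, hu, Finset.sum_singleton] at hX
  rw [hu, Finset.mem_singleton] at hv
  rw [hv]
  exact (diff_dotProduct (M.bary T u) x X).trans hX

/-! ### Single-valued quantities on a facet -/

section facet
variable (hg : M.IsReggeMetric g) (hF : F ∈ M.intFacets) (hT : T ∈ M.star F)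
  (hT' : T' ∈ M.star F) (hx : x ∈ M.face T F)
include hF hT hT' hx

theorem IsRegge.ev_eq_of_tangent (hU : M.IsRegge U) {X Y : Vec}
    (hX : diff (M.wall T F) x ⬝ᵥ X = 0) (hY : diff (M.wall T F) x ⬝ᵥ Y = 0) :
    ev (U T x) X Y = ev (U T' x) X Y := by
  have hFT := mem_powersetCard_of_mem_star (mem_facets_of_mem_intFacets hF) hT
  have hTc := (mem_star.1 hT).1
  exact hU.2 F hF T hT T' hT' x hx X Y (tangent_of_diff_wall hTc hx.1 hFT hX)
    (tangent_of_diff_wall hTc hx.1 hFT hY)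

include hg

theorem IsReggeMetric.ev_eq_of_normal (hU : M.IsRegge U) {X Y : Vec}
    (hX : ev (g T x) X (M.nor g T F x) = 0) (hY : ev (g T x) Y (M.nor g T F x) = 0) :
    ev (U T x) X Y = ev (U T' x) X Y := by
  have hFT := mem_powersetCard_of_mem_star (mem_facets_of_mem_intFacets hF) hT
  have hTc := (mem_star.1 hT).1
  have h := ev_normal_eq_zero_iff (hg.posDef hTc hx.1) (M.diff_wall_ne_zero hTc hx.1 hFT)
  exact IsRegge.ev_eq_of_tangent hF hT hT' hx hU ((h X).1 hX) ((h Y).1 hY)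

theorem IsReggeMetric.invFacet_eq : invFacet (g T x) (M.nor g T F x)
    = invFacet (g T' x) (M.nor g T' F x) := by
  have hFf := mem_facets_of_mem_intFacets hF
  have hFT := mem_powersetCard_of_mem_star hFf hT
  have hFT' := mem_powersetCard_of_mem_star hFf hT'
  have hTc := mem_star.1 hT
  have hTc' := mem_star.1 hT'
  have hx' : x ∈ M.face T' F := face_eq_of_mem_star hT hT' ▸ hx
  refine invFacet_congr (hg.posDef hTc.1 hx.1).isMetric (hg.posDef hTc'.1 hx'.1).isMetric
    (hg.ev_nor_self hTc.1 hx.1 hFT) (hg.ev_nor_self hTc'.1 hx'.1 hFT') (fun X => ?_)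
    (fun X Y hX hY => hg.ev_eq_of_normal hF hT hT' hx hg.1 hX hY)
  refine (ev_normal_eq_zero_iff (hg.posDef hTc.1 hx.1)
    (M.diff_wall_ne_zero hTc.1 hx.1 hFT) X).trans
    (Iff.trans ?_ (ev_normal_eq_zero_iff (hg.posDef hTc'.1 hx'.1)
    (M.diff_wall_ne_zero hTc'.1 hx'.1 hFT') X).symm)
  exact ⟨fun h => M.diff_wall_dotProduct_eq_zero hTc.1 hTc'.1 hFT hTc'.2 hx h,
    fun h => M.diff_wall_dotProduct_eq_zero hTc'.1 hTc.1 hFT' hTc.2 hx' h⟩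

theorem IsReggeMetric.areaDensity_eq :
    areaDensity (g T) (M.wall T F) x = areaDensity (g T') (M.wall T' F) x := by
  have hFf := mem_facets_of_mem_intFacets hF
  have hFT := mem_powersetCard_of_mem_star hFf hT
  have hFT' := mem_powersetCard_of_mem_star hFf hT'
  have hTc := mem_star.1 hT
  have hTc' := mem_star.1 hT'
  have hx' : x ∈ M.face T' F := face_eq_of_mem_star hT hT' ▸ hx
  exact areaDensity_congr (hg.posDef hTc.1 hx.1) (hg.posDef hTc'.1 hx'.1)
    (M.diff_wall_ne_zero hTc.1 hx.1 hFT) (M.diff_wall_ne_zero hTc'.1 hx'.1 hFT')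
    (fun X h => M.diff_wall_dotProduct_eq_zero hTc.1 hTc'.1 hFT hTc'.2 hx h)
    (fun X Y hX hY => IsRegge.ev_eq_of_tangent hF hT hT' hx hg.1 hX hY)

theorem IsReggeMetric.ip_eq (hU : M.IsRegge U) (B : Mat) :
    ip (invFacet (g T x) (M.nor g T F x)) B (U T x)
      = ip (invFacet (g T' x) (M.nor g T' F x)) B (U T' x) := by
  have hFT := mem_powersetCard_of_mem_star (mem_facets_of_mem_intFacets hF) hT
  have hTc := mem_star.1 hT
  rw [← hg.invFacet_eq hF hT hT' hx]
  exact ip_invFacet_congr (hg.posDef hTc.1 hx.1).isMetric (hg.ev_nor_self hTc.1 hx.1 hFT)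
    (fun X Y hX hY => hg.ev_eq_of_normal hF hT hT' hx hU hX hY) B

theorem IsReggeMetric.ip_facetTT_eq (hU : M.IsRegge U) (B : Mat) :
    ip (invFacet (g T x) (M.nor g T F x)) B (M.facetTT g U F T x)
      = ip (invFacet (g T' x) (M.nor g T' F x)) B (M.facetTT g U F T' x) := by
  have hFf := mem_facets_of_mem_intFacets hF
  have hFT := mem_powersetCard_of_mem_star hFf hT
  have hFT' := mem_powersetCard_of_mem_star hFf hT'
  have hTc := mem_star.1 hT
  have hTc' := mem_star.1 hT'
  have hx' : x ∈ M.face T' F := face_eq_of_mem_star hT hT' ▸ hx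
  rw [facetTT, facetTT, ip_invFacet_restr (hg.posDef hTc.1 hx.1).isMetric
    (hg.ev_nor_self hTc.1 hx.1 hFT), ip_invFacet_restr (hg.posDef hTc'.1 hx'.1).isMetric
    (hg.ev_nor_self hTc'.1 hx'.1 hFT'), hg.ip_eq hF hT hT' hx hU]

theorem IsReggeMetric.ip_facetRev_eq (hU : M.IsRegge U) (B : Mat) :
    ip (invFacet (g T x) (M.nor g T F x)) B (M.facetRev g U F T x)
      = ip (invFacet (g T' x) (M.nor g T' F x)) B (M.facetRev g U F T' x) := by
  have hFf := mem_facets_of_mem_intFacets hF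
  have hx' : x ∈ M.face T' F := face_eq_of_mem_star hT hT' ▸ hx
  obtain ⟨E, hE⟩ := hg.exists_frame (mem_star.1 hT).1 hx.1 (mem_powersetCard_of_mem_star hFf hT)
  obtain ⟨E', hE'⟩ := hg.exists_frame (mem_star.1 hT').1 hx'.1
    (mem_powersetCard_of_mem_star hFf hT')
  have htr : tr (invFacet (g T x) (M.nor g T F x)) (U T x)
      = tr (invFacet (g T' x) (M.nor g T' F x)) (U T' x) := by
    rw [hE.tr_eq_ip, hE'.tr_eq_ip, hg.ip_eq hF hT hT' hx hU,
      ip_comm (invFacet_isSymm ((hg.1.1 T' (mem_star.1 hT').1).1 x) _), ← hg.invFacet_eq hF hT hT' hx, hg.ip_eq hF hT hT' hx hg.1,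
      ip_comm (invFacet_isSymm ((hg.1.1 T' (mem_star.1 hT').1).1 x) _), hg.invFacet_eq hF hT hT' hx]
  rw [facetRev, facetRev, hE.ip_traceRev_right, hE'.ip_traceRev_right, htr,
    hg.ip_eq hF hT hT' hx hU, hg.invFacet_eq hF hT hT' hx]

end facet

theorem IsReggeMetric.facetVal_AAf (hg : M.IsReggeMetric g) (hT : T ∈ M.cells)
    (hx : x ∈ M.carrier T) (hF : F ∈ T.powersetCard 3) (hU : M.IsSymTensor U) :
    M.facetVal g (AAf g U) F T x = -M.facetRev g U F T x := by
  obtain ⟨E, hE⟩ := hg.exists_frame hT hx hF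
  exact hE.AFnnF_eq ((hU T hT).1 x)

/-- `(𝔸U)_{FnnF}` is single-valued, as a functional of forms on the facet. -/
theorem IsReggeMetric.ip_facetVal_eq (hg : M.IsReggeMetric g) (hF : F ∈ M.intFacets)
    (hT : T ∈ M.star F) (hT' : T' ∈ M.star F) (hx : x ∈ M.face T F) (hU : M.IsRegge U)
    (B : Mat) :
    ip (invFacet (g T x) (M.nor g T F x)) B (M.facetVal g (AAf g U) F T x)
      = ip (invFacet (g T' x) (M.nor g T' F x)) B (M.facetVal g (AAf g U) F T' x) := by
  have hFf := mem_facets_of_mem_intFacets hF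
  have hx' : x ∈ M.face T' F := face_eq_of_mem_star hT hT' ▸ hx
  rw [hg.facetVal_AAf (mem_star.1 hT).1 hx.1 (mem_powersetCard_of_mem_star hFf hT) hU.1,
    hg.facetVal_AAf (mem_star.1 hT').1 hx'.1 (mem_powersetCard_of_mem_star hFf hT') hU.1,
    ip_neg_right, ip_neg_right, hg.ip_facetRev_eq hF hT hT' hx hU]

/-- Pairing of a sum over the sides of `F` with `(𝔸U)_{FnnF}`, given its value on each side. -/
theorem IsReggeMetric.facetPairing_facetVal (hg : M.IsReggeMetric g) (hF : F ∈ M.intFacets)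
    (hU : M.IsRegge U) {B C : Finset V → Pt → Mat} (c : ℝ)
    (h : ∀ T ∈ M.star F, ∀ x ∈ M.face T F,
      ip (invFacet (g T x) (M.nor g T F x)) (B T x) (M.facetVal g (AAf g U) F T x)
        = c * ip (invFacet (g T x) (M.nor g T F x)) (C T x) (M.facetTT g U F T x)) :
    M.facetPairing g F (M.jump F B) (M.facetVal g (AAf g U) F (M.side F))
      = c * M.facetPairing g F (M.jump F C) (M.facetTT g U F (M.side F)) := by
  have hs := side_mem_star_of_facet (mem_facets_of_mem_intFacets hF)
  rw [facetPairing, facetPairing, facetIntegral, facetIntegral, ← integral_const_mul]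
  refine setIntegral_congr_fun (M.isCompact_face (mem_star.1 hs).1 F).measurableSet fun x hx => ?_
  simp only [jump, ip_sum_left, ← mul_assoc]
  congr 1
  rw [Finset.mul_sum]
  refine Finset.sum_congr rfl fun T hT => ?_
  have hxT : x ∈ M.face T F := face_eq_of_mem_star hs hT ▸ hx
  rw [← hg.ip_facetVal_eq hF hT hs hxT hU, ← hg.ip_facetTT_eq hF hT hs hxT hU, h T hT x hxT]

/-! ### Conormals and tangents of edges -/

theorem card_union_sdiff (hT : T ∈ M.cells) (hF : F ∈ T.powersetCard 3) (hE : E ⊆ F)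
    (hE2 : E.card = 2) : E ∪ (T \ F) ∈ T.powersetCard 3 := by
  have hF' := Finset.mem_powersetCard.1 hF
  refine Finset.mem_powersetCard.2
    ⟨Finset.union_subset (hE.trans hF'.1) Finset.sdiff_subset, ?_⟩
  rw [Finset.card_union_of_disjoint (Finset.disjoint_sdiff.mono_left hE), hE2,
    Finset.card_sdiff_of_subset hF'.1, hF'.2, M.card_cell T hT]

theorem facetOf_mem (hT : T ∈ M.cells) (hE : E ⊆ T) (hE2 : E.card = 2) :
    facetOf T E ∈ T.powersetCard 3 ∧ E ⊆ facetOf T E := by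
  obtain ⟨F, hEF, hFT, hF⟩ := Finset.exists_subsuperset_card_eq hE (n := 3) (by omega)
    (by rw [M.card_cell T hT]; omega)
  exact Finset.mem_filter.1 (pick_mem
    ⟨F, Finset.mem_filter.2 ⟨Finset.mem_powersetCard.2 ⟨hFT, hF⟩, hEF⟩⟩)

/-- The normals of two facets of an element are not parallel. -/
theorem IsReggeMetric.proj_nor_ne_zero (hg : M.IsReggeMetric g) (hT : T ∈ M.cells)
    (hx : x ∈ M.carrier T) (hF : F ∈ T.powersetCard 3) (hE : E ⊆ F) (hE2 : E.card = 2) :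
    proj (g T x) (M.nor g T F x) *ᵥ M.nor g T (E ∪ (T \ F)) x ≠ 0 := by
  have hF' := card_union_sdiff hT hF hE hE2
  have hFT := Finset.mem_powersetCard.1 hF
  obtain ⟨u, hu⟩ := M.sdiff_facet hT hF'
  obtain ⟨w, hw⟩ : E.Nonempty := by rw [← Finset.card_pos, hE2]; norm_num
  have huT : u ∈ T \ (E ∪ (T \ F)) := hu ▸ Finset.mem_singleton_self u
  obtain ⟨huT, hu2⟩ := Finset.mem_sdiff.1 huT
  rw [Finset.mem_union, not_or] at hu2
  obtain ⟨X, hX, hX'⟩ := M.exists_fderiv_wall hT hx (F' := F) hu huT (hFT.1 (hE hw))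
    (Finset.mem_union_left _ hw) hu2.2 fun h => (Finset.mem_sdiff.1 h).2 (hE hw)
  have hp := hg.posDef hT hx
  have h0 : ∀ F, diff (M.wall T F) x ⬝ᵥ WithLp.ofLp X = fderiv ℝ (M.wall T F) x X :=
    fun F => diff_dotProduct _ _ _
  have h1 := (ev_normal_eq_zero_iff hp (M.diff_wall_ne_zero hT hx hF) (WithLp.ofLp X)).2
    ((h0 F).trans hX')
  have h2 := ev_normal_eq_zero_iff hp (M.diff_wall_ne_zero hT hx hF') (WithLp.ofLp X)
  rw [h0, hX] at h2
  intro h3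
  rw [proj_mulVec hp.isMetric.isSymm, sub_eq_zero] at h3
  refine one_ne_zero (h2.1 ?_)
  change ev (g T x) X.ofLp (M.nor g T (E ∪ (T \ F)) x) = 0
  have h4 := ev_smul_smul 1 (ev (g T x) (M.nor g T (E ∪ (T \ F)) x) (M.nor g T F x)) (g T x)
    X.ofLp (M.nor g T F x)
  rw [one_smul] at h4
  rw [h3, h4]
  exact mul_eq_zero_of_right _ h1

theorem IsReggeMetric.ev_conor_self (hg : M.IsReggeMetric g) (hT : T ∈ M.cells)
    (hx : x ∈ M.carrier T) (hF : F ∈ T.powersetCard 3) (hE : E ⊆ F) (hE2 : E.card = 2) :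
    ev (g T x) (M.conor g T F E x) (M.conor g T F E x) = 1 :=
  ev_normalize (hg.posDef hT hx) (hg.proj_nor_ne_zero hT hx hF hE hE2)

theorem IsReggeMetric.ev_nor_conor (hg : M.IsReggeMetric g) (hT : T ∈ M.cells)
    (hx : x ∈ M.carrier T) (hF : F ∈ T.powersetCard 3) (E : Finset V) :
    ev (g T x) (M.nor g T F x) (M.conor g T F E x) = 0 := by
  have hs := (hg.posDef hT hx).isMetric.isSymm
  have h1 := hg.ev_nor_self hT hx hF
  have h : ∀ c : ℝ, ev (g T x) (M.nor g T F x)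
      (c • proj (g T x) (M.nor g T F x) *ᵥ M.nor g T (E ∪ (T \ F)) x) = 0 := by
    intro c
    rw [proj_mulVec hs, ev_eq, Matrix.mulVec_smul, Matrix.mulVec_sub, Matrix.mulVec_smul,
      dotProduct_smul, dotProduct_sub, dotProduct_smul, ← ev_eq, ← ev_eq, h1,
      ev_comm hs (M.nor g T F x)]
    simp
  exact h _

theorem IsReggeMetric.ev_tang_self (hg : M.IsReggeMetric g) (hT : T ∈ M.cells)
    (hx : x ∈ M.carrier T) (hF : F ∈ T.powersetCard 3) (hE : E ⊆ F) (hE2 : E.card = 2) :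
    ev (g T x) (M.tang g T F E x) (M.tang g T F E x) = 1 := by
  rw [tang, ev_cross_self (hg.posDef hT hx).isMetric, hg.ev_nor_self hT hx hF,
    hg.ev_conor_self hT hx hF hE hE2, hg.ev_nor_conor hT hx hF]
  norm_num

theorem IsReggeMetric.smooth_nor (hg : M.IsReggeMetric g) (hT : T ∈ M.cells)
    (hx : x ∈ M.carrier T) (hF : F ∈ T.powersetCard 3) : SmoothVec (M.nor g T F) x :=
  (hg.metricAt hT hx).smooth_normal (hg.posDef hT hx) (M.contDiffAt_wall hT hx F)
    (M.diff_wall_ne_zero hT hx hF)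

theorem IsReggeMetric.smooth_conor (hg : M.IsReggeMetric g) (hT : T ∈ M.cells)
    (hx : x ∈ M.carrier T) (hF : F ∈ T.powersetCard 3) (hE : E ⊆ F) (hE2 : E.card = 2) :
    SmoothVec (M.conor g T F E) x := by
  have hm := (hg.metricAt hT hx).smoothMat
  have hw := (hm.proj (hg.smooth_nor hT hx hF)).mulVec
    (hg.smooth_nor hT hx (card_union_sdiff hT hF hE hE2))
  exact SmoothVec.smul (smooth_normalize hm hw
    (ev_self_pos (hg.posDef hT hx) (hg.proj_nor_ne_zero hT hx hF hE hE2))) hw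

theorem IsReggeMetric.smooth_tang (hg : M.IsReggeMetric g) (hT : T ∈ M.cells)
    (hx : x ∈ M.carrier T) (hF : F ∈ T.powersetCard 3) (hE : E ⊆ F) (hE2 : E.card = 2) :
    SmoothVec (M.tang g T F E) x :=
  (hg.metricAt hT hx).smooth_cross (hg.smooth_nor hT hx hF) (hg.smooth_conor hT hx hF hE hE2)

theorem mem_star_of_mem_edges (hE : E ∈ M.edges) (hT : T ∈ M.star E) :
    T ∈ M.cells ∧ E.card = 2 ∧ facetOf T E ∈ T.powersetCard 3 ∧ E ⊆ facetOf T E := by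
  obtain ⟨T', -, h⟩ := mem_edges.1 hE
  have h2 := (Finset.mem_powersetCard.1 h).2
  have hT := mem_star.1 hT
  exact ⟨hT.1, h2, facetOf_mem hT.1 hT.2 h2⟩

theorem IsReggeMetric.edgeVal_AAf (hg : M.IsReggeMetric g) (hE : E ∈ M.edges)
    (hx : x ∈ M.carrier (M.side E)) (hU : M.IsSymTensor U) :
    M.edgeVal g (AAf g U) E x = M.edgeTT g U E x := by
  obtain ⟨hT, -⟩ := mem_star_of_mem_edges hE (side_mem_star_of_edge hE)
  exact AA_conormal (hg.posDef hT hx).isMetric ((hU _ hT).1 x) _ _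

theorem IsReggeMetric.edgeTrace_eq (hg : M.IsReggeMetric g) (hE : E ∈ M.edges)
    (hx : x ∈ M.carrier (M.side E)) (σ : PField V) :
    M.edgeTrace g σ E x = M.edgeTT g σ E x := by
  obtain ⟨hT, h2, hF, hEF⟩ := mem_star_of_mem_edges hE (side_mem_star_of_edge hE)
  exact tr_edge (hg.posDef hT hx).isMetric (hg.ev_nor_self hT hx hF)
    (hg.ev_conor_self hT hx hF hEF h2) (hg.ev_nor_conor hT hx hF E) _

/-! ### Comparing integrals -/

theorem cellIntegral_congr {f f' : Pt → ℝ} (c : ℝ) (hT : T ∈ M.cells)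
    (h : ∀ x ∈ M.carrier T, f x = c * f' x) :
    M.cellIntegral g T f = c * M.cellIntegral g T f' := by
  rw [cellIntegral, cellIntegral, ← integral_const_mul]
  refine setIntegral_congr_fun (M.isCompact_carrier T hT).measurableSet fun x hx => ?_
  simp only [h x hx, mul_assoc]

theorem facetIntegral_congr {f f' : Pt → ℝ} (c : ℝ) (hT : T ∈ M.cells)
    (h : ∀ x ∈ M.face T F, f x = c * f' x) :
    M.facetIntegral g T F f = c * M.facetIntegral g T F f' := by
  rw [facetIntegral, facetIntegral, ← integral_const_mul]
  refine setIntegral_congr_fun (M.isCompact_face hT F).measurableSet fun x hx => ?_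
  simp only [h x hx, mul_assoc]

theorem edgeIntegral_congr {f f' : Pt → ℝ} (hE : E ∈ M.edges)
    (h : ∀ x ∈ M.face (M.side E) E, f x = f' x) :
    M.edgeIntegral g E f = M.edgeIntegral g E f' := by
  have hT := (mem_star.1 (side_mem_star_of_edge hE)).1
  refine setIntegral_congr_fun (M.isCompact_face hT E).measurableSet fun x hx => ?_
  simp only [h x hx]

/-! ### Regrouping facet and edge terms -/

theorem IsSymTensor.smoothMat (hσ : M.IsSymTensor σ) (hT : T ∈ M.cells)
    (hx : x ∈ M.carrier T) : SmoothMat (σ T) x := (hσ T hT).2 x hx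

/-- Test fields with vanishing boundary values do not see the boundary facets. -/
theorem IsReggeMetric.ip_facetVal_eq_zero (hg : M.IsReggeMetric g) (hU : M.IsReggeZero U)
    (hF : F ∈ M.facets) (hFi : F ∉ M.intFacets) (hT : T ∈ M.star F) (hx : x ∈ M.face T F)
    (B : Mat) :
    ip (invFacet (g T x) (M.nor g T F x)) B (M.facetVal g (AAf g U) F T x) = 0 := by
  have hFT := mem_powersetCard_of_mem_star hF hT
  have hTc := (mem_star.1 hT).1
  have hp := hg.posDef hTc hx.1
  have h0 : ∀ C, ip (invFacet (g T x) (M.nor g T F x)) C (U T x) = 0 := by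
    intro C
    rw [ip_invFacet_congr (C' := 0) hp.isMetric (hg.ev_nor_self hTc hx.1 hFT) _ C, ip_zero_right]
    intro X Y hX hY
    have h := ev_normal_eq_zero_iff hp (M.diff_wall_ne_zero hTc hx.1 hFT)
    rw [hU.2 F hF hFi T hT x hx X Y (tangent_of_diff_wall hTc hx.1 hFT ((h X).1 hX))
      (tangent_of_diff_wall hTc hx.1 hFT ((h Y).1 hY))]
    simp [ev]
  obtain ⟨E, hE⟩ := hg.exists_frame hTc hx.1 hFT
  rw [hg.facetVal_AAf hTc hx.1 hFT hU.1.1, ip_neg_right, facetRev, hE.ip_traceRev_right,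
    hE.tr_eq_ip (U T x), h0, h0]
  simp

/-- The integral of a jump over a facet is the sum of the integrals over its sides. -/
theorem IsReggeMetric.facetPairing_jump (hg : M.IsReggeMetric g) (hF : F ∈ M.intFacets)
    (hU : M.IsRegge U) {B : Finset V → Pt → Mat}
    (hB : ∀ T ∈ M.star F, ∀ x ∈ M.face T F, SmoothMat (B T) x) :
    M.facetPairing g F (M.jump F B) (M.facetVal g (AAf g U) F (M.side F))
      = ∑ T ∈ M.star F, M.facetIntegral g T F (fun x =>
          ip (invFacet (g T x) (M.nor g T F x)) (B T x) (M.facetVal g (AAf g U) F T x)) := by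
  have hFf := mem_facets_of_mem_intFacets hF
  have hs := side_mem_star_of_facet hFf
  have hsum : ∀ x ∈ M.face (M.side F) F,
      ip (invFacet (g (M.side F) x) (M.nor g (M.side F) F x)) (M.jump F B x)
          (M.facetVal g (AAf g U) F (M.side F) x)
        * areaDensity (g (M.side F)) (M.wall (M.side F) F) x
      = ∑ T ∈ M.star F, ip (invFacet (g T x) (M.nor g T F x)) (B T x)
          (M.facetVal g (AAf g U) F T x) * areaDensity (g T) (M.wall T F) x := by
    intro x hx
    rw [jump, ip_sum_left, Finset.sum_mul]
    refine Finset.sum_congr rfl fun T hT => ?_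
    rw [hg.ip_facetVal_eq hF hs hT hx hU, hg.areaDensity_eq hF hs hT hx]
  rw [facetPairing, facetIntegral,
    setIntegral_congr_fun (M.isCompact_face (mem_star.1 hs).1 F).measurableSet hsum,
    integral_finsetSum]
  · refine Finset.sum_congr rfl fun T hT => ?_
    rw [face_eq_of_mem_star hs hT, facetIntegral]
  · intro T hT
    rw [face_eq_of_mem_star hs hT]
    have hFT := mem_powersetCard_of_mem_star hFf hT
    have hTc := (mem_star.1 hT).1
    refine M.integrableOn_face hTc (mem_star.1 hT).2 (Finset.mem_powersetCard.1 hFT).2 ?_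
    have hcont : ContinuousOn (fun x => -ip (invFacet (g T x) (M.nor g T F x)) (B T x)
        (M.facetRev g U F T x) * areaDensity (g T) (M.wall T F) x) (M.face T F) := by
      intro x hx
      have hm := hg.metricAt hTc hx.1
      have hn := hg.smooth_nor hTc hx.1 hFT
      exact ((((hm.smooth_invFacet hn).ip (hB T hT x hx)
        (hm.smooth_traceRev hn (hU.1.smoothMat hTc hx.1))).neg.mul
        (hm.smooth_areaDensity hn (M.contDiffAt_wall hTc hx.1 F)
          (M.diff_wall_ne_zero hTc hx.1 hFT))).continuousAt).continuousWithinAt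
    refine hcont.congr fun x hx => ?_
    simp only [hg.facetVal_AAf hTc hx.1 hFT hU.1, ip_neg_right]

/-- Summation over the boundaries of the elements is summation over the interior facets. -/
theorem IsReggeMetric.sum_boundary (hg : M.IsReggeMetric g) (hU : M.IsReggeZero U)
    {B : Finset V → Finset V → Pt → Mat}
    (hB : ∀ F ∈ M.intFacets, ∀ T ∈ M.star F, ∀ x ∈ M.face T F, SmoothMat (B F T) x) :
    ∑ T ∈ M.cells, ∑ F ∈ T.powersetCard 3, M.facetIntegral g T F (fun x =>
        ip (invFacet (g T x) (M.nor g T F x)) (B F T x) (M.facetVal g (AAf g U) F T x))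
      = ∑ F ∈ M.intFacets,
        M.facetPairing g F (M.jump F (B F)) (M.facetVal g (AAf g U) F (M.side F)) := by
  have h1 : ∀ φ : Finset V → Finset V → ℝ, ∑ T ∈ M.cells, ∑ F ∈ T.powersetCard 3, φ T F
      = ∑ F ∈ M.facets, ∑ T ∈ M.star F, φ T F := fun φ => by
    refine Finset.sum_comm' fun T F => ⟨fun ⟨hT, hF⟩ => ?_, fun ⟨hT, hF⟩ => ?_⟩
    · exact ⟨mem_star.2 ⟨hT, (Finset.mem_powersetCard.1 hF).1⟩, mem_facets.2 ⟨T, hT, hF⟩⟩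
    · exact ⟨(mem_star.1 hT).1, mem_powersetCard_of_mem_star hF hT⟩
  rw [h1, ← Finset.sum_subset (fun F => mem_facets_of_mem_intFacets)]
  · exact Finset.sum_congr rfl fun F hF => (hg.facetPairing_jump hF hU.1 (hB F hF)).symm
  · intro F hF hFi
    refine Finset.sum_eq_zero fun T hT => ?_
    rw [facetIntegral_congr (f' := fun _ => 0) 0 (mem_star.1 hT).1, zero_mul]
    intro x hx
    rw [hg.ip_facetVal_eq_zero hU hF hFi hT hx, zero_mul]

theorem IsReggeMetric.continuousAt_lengthDensity (hg : M.IsReggeMetric g) (hT : T ∈ M.cells)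
    (hx : x ∈ M.carrier T) (hF : F ∈ T.powersetCard 3) (hE : E ⊆ F) (hE2 : E.card = 2) :
    ContinuousAt (fun x => Real.sqrt (ev (g T x)
      ((Real.sqrt (∑ i, M.tang g T F E x i ^ 2))⁻¹ • M.tang g T F E x)
      ((Real.sqrt (∑ i, M.tang g T F E x i ^ 2))⁻¹ • M.tang g T F E x))) x := by
  have hτ := hg.smooth_tang hT hx hF hE hE2
  have hpos : 0 < ∑ i, M.tang g T F E x i ^ 2 := by
    refine (Finset.sum_nonneg fun i _ => sq_nonneg _).lt_of_ne' fun h => ?_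
    rw [Finset.sum_eq_zero_iff_of_nonneg fun i _ => sq_nonneg _] at h
    have h0 : M.tang g T F E x = 0 := funext fun i => by simpa using h i (Finset.mem_univ i)
    have h1 := hg.ev_tang_self hT hx hF hE hE2
    rw [h0] at h1
    simp [ev] at h1
  have hs : ContDiffAt ℝ ∞ (fun x => (Real.sqrt (∑ i, M.tang g T F E x i ^ 2))⁻¹) x :=
    ((ContDiffAt.sum fun i _ => (hτ i).pow 2).sqrt hpos.ne').fun_inv (Real.sqrt_pos.2 hpos).ne'
  have h := hs.continuousAt
  exact Real.continuous_sqrt.continuousAt.comp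
    ((hg.metricAt hT hx).smoothMat.ev (SmoothVec.smul hs hτ) (SmoothVec.smul hs hτ)).continuousAt

theorem IsReggeMetric.edgeIntegral_sum (hg : M.IsReggeMetric g) (hE : E ∈ M.edges)
    {ι : Type*} (s : Finset ι) {f : ι → Pt → ℝ}
    (hf : ∀ i ∈ s, ContinuousOn (f i) (M.face (M.side E) E)) :
    M.edgeIntegral g E (fun x => ∑ i ∈ s, f i x) = ∑ i ∈ s, M.edgeIntegral g E (f i) := by
  have hs := side_mem_star_of_edge hE
  obtain ⟨hT, h2, hF, hEF⟩ := mem_star_of_mem_edges hE hs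
  simp only [edgeIntegral, Finset.sum_mul]
  refine integral_finsetSum _ fun i hi => ?_
  refine M.integrableOn_face hT (mem_star.1 hs).2 h2 ((hf i hi).mul fun x hx => ?_)
  exact (hg.continuousAt_lengthDensity hT hx.1 hF hEF h2).continuousWithinAt

theorem IsReggeMetric.continuousOn_edgeVal (hg : M.IsReggeMetric g) (hE : E ∈ M.edges)
    (hU : M.IsSymTensor U) :
    ContinuousOn (M.edgeVal g (AAf g U) E) (M.face (M.side E) E) := by
  obtain ⟨hT, h2, hF, hEF⟩ := mem_star_of_mem_edges hE (side_mem_star_of_edge hE)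
  have h : ContinuousOn (M.edgeTT g U E) (M.face (M.side E) E) := fun x hx => by
    have hτ := hg.smooth_tang hT hx.1 hF hEF h2
    exact ((hU.smoothMat hT hx.1).ev hτ hτ).continuousAt.continuousWithinAt
  exact h.congr fun x hx => hg.edgeVal_AAf hE hx.1 hU

theorem IsReggeMetric.continuousOn_edgeJump (hg : M.IsReggeMetric g) (hE : E ∈ M.edges)
    (hF : F ∈ M.facetsAt E) (hσ : M.IsSymTensor σ) :
    ContinuousOn (M.edgeJump g σ E F) (M.face (M.side E) E) := by
  have hs := side_mem_star_of_edge hE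
  have h2 := (mem_star_of_mem_edges hE hs).2.1
  obtain ⟨hFf, hEF⟩ := Finset.mem_filter.1 hF
  refine continuousOn_finsetSum _ fun T hT x hx => ?_
  have hTc := mem_star.1 hT
  have hTE : T ∈ M.star E := mem_star.2 ⟨hTc.1, hEF.trans hTc.2⟩
  have hFT := mem_powersetCard_of_mem_star hFf hT
  have hx' : x ∈ M.carrier T := (face_eq_of_mem_star hs hTE ▸ hx : x ∈ M.face T E).1
  exact ((hσ.smoothMat hTc.1 hx').ev (hg.smooth_nor hTc.1 hx' hFT)
    (hg.smooth_conor hTc.1 hx' hFT hEF h2)).continuousAt.continuousWithinAt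

/-! ### The identities for the generalized curvature and the bilinear forms -/

theorem IsReggeMetric.riemannFunctional_eq (hg : M.IsReggeMetric g) (hU : M.IsRegge U) :
    1 / 4 * M.riemannFunctional g (AAf g U)
      = ∑ T ∈ M.cells, M.cellIntegral g T (fun x => ip (g T x)⁻¹ (curvOp (g T) x) (U T x))
        - ∑ F ∈ M.intFacets,
            M.facetPairing g F (M.jump F (M.IIbar g F)) (M.facetTT g U F (M.side F))
        + ∑ E ∈ M.intEdges,
            M.edgeIntegral g E (fun x => M.deficit g E x * M.edgeTT g U E x) := by
  have hc : ∀ T ∈ M.cells,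
      M.cellIntegral g T (fun x => ip4 (g T x)⁻¹ (riemann (g T) x) (AAf g U T x))
        = 4 * M.cellIntegral g T (fun x => ip (g T x)⁻¹ (curvOp (g T) x) (U T x)) :=
    fun T hT => cellIntegral_congr 4 hT fun x hx => by
      rw [curvOp_eq]
      exact ip4_AA_curvature (hg.posDef hT hx).isMetric ((hU.1 T hT).1 x) _
  have hf : ∀ F ∈ M.intFacets,
      M.facetPairing g F (M.jump F (M.II g F)) (M.facetVal g (AAf g U) F (M.side F))
        = -1 * M.facetPairing g F (M.jump F (M.IIbar g F)) (M.facetTT g U F (M.side F)) := by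
    intro F hF
    refine hg.facetPairing_facetVal hF hU (-1) fun T hT x hx => ?_
    have hFT := mem_powersetCard_of_mem_star (mem_facets_of_mem_intFacets hF) hT
    have hTc := (mem_star.1 hT).1
    obtain ⟨E, hE⟩ := hg.exists_frame hTc hx.1 hFT
    rw [hg.facetVal_AAf hTc hx.1 hFT hU.1, ip_neg_right, facetRev, hE.ip_traceRev, neg_one_mul,
      IIbar, facetTT]
  have he : ∀ E ∈ M.intEdges,
      M.edgeIntegral g E (fun x => M.deficit g E x * M.edgeVal g (AAf g U) E x)
        = M.edgeIntegral g E (fun x => M.deficit g E x * M.edgeTT g U E x) := by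
    intro E hE
    have hE := mem_edges_of_mem_intEdges hE
    exact edgeIntegral_congr hE fun x hx => by rw [hg.edgeVal_AAf hE hx.1 hU.1]
  rw [riemannFunctional, Finset.sum_congr rfl hc, Finset.sum_congr rfl hf,
    Finset.sum_congr rfl he, ← Finset.mul_sum, ← Finset.mul_sum]
  ring

theorem IsReggeMetric.aForm_eq (hg : M.IsReggeMetric g) (hU : M.IsRegge U)
    (hσ : M.IsRegge σ) :
    M.aForm g σ U
      = -2 * ∑ T ∈ M.cells, M.cellIntegral g T
            (fun x => triple (g T x)⁻¹ (curvOp (g T) x) (σ T x) (U T x))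
        - 2 * ∑ F ∈ M.intFacets, M.facetIntegral g (M.side F) F (fun x =>
            triple (invFacet (g (M.side F) x) (M.nor g (M.side F) F x))
              (M.jump F (M.II g F) x) (M.facetRev g σ F (M.side F) x)
              (M.facetRev g U F (M.side F) x))
        - 2 * ∑ E ∈ M.intEdges, M.edgeIntegral g E
            (fun x => M.deficit g E x * M.edgeTT g σ E x * M.edgeTT g U E x) := by
  have hc : ∀ T ∈ M.cells, M.cellIntegral g T (fun x =>
      ip4 (g T x)⁻¹ (actFirst (g T x) (σ T x) (riemann (g T) x)) (AAf g U T x)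
        - 1 / 2 * tr (g T x)⁻¹ (σ T x) * ip4 (g T x)⁻¹ (riemann (g T) x) (AAf g U T x))
      = -2 * M.cellIntegral g T
          (fun x => triple (g T x)⁻¹ (curvOp (g T) x) (σ T x) (U T x)) :=
    fun T hT => cellIntegral_congr (-2) hT fun x hx => by
      have hm := hg.metricAt hT hx
      rw [← AA_curvOp hm, AAf]
      exact ip4_actFirst_AA hm.isMetric (curvOp_isSymm hm) ((hσ.1 T hT).1 x) ((hU.1 T hT).1 x)
  have hf : ∀ F ∈ M.intFacets, M.facetIntegral g (M.side F) F (fun x =>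
      triple (invFacet (g (M.side F) x) (M.nor g (M.side F) F x)) (M.jump F (M.II g F) x)
        (M.facetRev g σ F (M.side F) x) (M.facetVal g (AAf g U) F (M.side F) x))
      = -1 * M.facetIntegral g (M.side F) F (fun x =>
            triple (invFacet (g (M.side F) x) (M.nor g (M.side F) F x))
              (M.jump F (M.II g F) x) (M.facetRev g σ F (M.side F) x)
              (M.facetRev g U F (M.side F) x)) := by
    intro F hF
    have hFf := mem_facets_of_mem_intFacets hF
    have hs := side_mem_star_of_facet hFf
    have hT := (mem_star.1 hs).1
    refine facetIntegral_congr (-1) hT fun x hx => ?_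
    rw [hg.facetVal_AAf hT hx.1 (mem_powersetCard_of_mem_star hFf hs) hU.1, triple_neg_right,
      neg_one_mul]
  have he : ∀ E ∈ M.intEdges, M.edgeIntegral g E
        (fun x => M.edgeTrace g σ E x * M.deficit g E x * M.edgeVal g (AAf g U) E x)
      = M.edgeIntegral g E
        (fun x => M.deficit g E x * M.edgeTT g σ E x * M.edgeTT g U E x) := by
    intro E hE
    have hE := mem_edges_of_mem_intEdges hE
    exact edgeIntegral_congr hE fun x hx => by
      rw [hg.edgeVal_AAf hE hx.1 hU.1, hg.edgeTrace_eq hE hx.1, mul_comm (M.deficit g E x)]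
  simp only [aForm]
  rw [Finset.sum_congr rfl hc, Finset.sum_congr rfl hf, Finset.sum_congr rfl he,
    ← Finset.mul_sum, ← Finset.mul_sum]
  ring

theorem IsReggeMetric.bForm_eq (hg : M.IsReggeMetric g) (hU : M.IsRegge U)
    (hσ : M.IsRegge σ) (s : ℝ) :
    M.bForm g s σ U
      = -2 * ∑ T ∈ M.cells, M.cellIntegral g T
            (fun x => ip (g T x)⁻¹ (inc (g T) (σ T) x) (U T x))
        + 2 * ∑ F ∈ M.intFacets, M.facetPairing g F
            (M.jump F (fun T x => curlCross (g T) (σ T) (M.wall T F) x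
              - sigmaNN (g T) (σ T) (M.wall T F) x • M.IIbar g F T x
              - traceRev (g T x) (M.nor g T F x)
                  (nablaContr (g T) (σ T) (M.wall T F) x)))
            (M.facetTT g U F (M.side F))
        + s * (2 * ∑ E ∈ M.intEdges, M.edgeIntegral g E (fun x =>
            (∑ F ∈ M.facetsAt E, M.edgeJump g σ E F x) * M.edgeTT g U E x)) := by
  have hc : ∀ T ∈ M.cells, M.cellIntegral g T (fun x =>
      ip4 (g T x)⁻¹ (cov2cov2 (g T) (σ T) x) (swap23 (AAf g U T x)))
      = -1 * M.cellIntegral g T (fun x => ip (g T x)⁻¹ (inc (g T) (σ T) x) (U T x)) :=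
    fun T hT => cellIntegral_congr (-1) hT fun x hx => by
      have hm := hg.metricAt hT hx
      rw [inc_eq hm ((hσ.1 T hT).2 x hx), neg_one_mul]
      exact ip4_swap23_AA hm.isMetric ((hU.1 T hT).1 x) _
  have hf : ∀ F ∈ M.intFacets, M.facetPairing g F (M.jump F (M.facetFlux g σ F))
        (M.facetVal g (AAf g U) F (M.side F))
      = 1 * M.facetPairing g F
            (M.jump F (fun T x => curlCross (g T) (σ T) (M.wall T F) x
              - sigmaNN (g T) (σ T) (M.wall T F) x • M.IIbar g F T x
              - traceRev (g T x) (M.nor g T F x)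
                  (nablaContr (g T) (σ T) (M.wall T F) x)))
            (M.facetTT g U F (M.side F)) := by
    intro F hF
    refine hg.facetPairing_facetVal hF hU 1 fun T hT x hx => ?_
    have hFT := mem_powersetCard_of_mem_star (mem_facets_of_mem_intFacets hF) hT
    have hTc := (mem_star.1 hT).1
    rw [one_mul]
    exact ip_flux_AFnnF (hg.metricAt hTc hx.1) (hg.posDef hTc hx.1)
      (hg.ev_nor_self hTc hx.1 hFT) (hσ.1 T hTc).1 ((hσ.1 T hTc).2 x hx.1) ((hU.1 T hTc).1 x)
  have he : ∀ E ∈ M.intEdges, M.edgeIntegral g E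
        (fun x => (∑ F ∈ M.facetsAt E, M.edgeJump g σ E F x) * M.edgeVal g (AAf g U) E x)
      = M.edgeIntegral g E
        (fun x => (∑ F ∈ M.facetsAt E, M.edgeJump g σ E F x) * M.edgeTT g U E x) := by
    intro E hE
    have hE := mem_edges_of_mem_intEdges hE
    exact edgeIntegral_congr hE fun x hx => by rw [hg.edgeVal_AAf hE hx.1 hU.1]
  simp only [bForm]
  rw [Finset.sum_congr rfl hc, Finset.sum_congr rfl hf, Finset.sum_congr rfl he,
    ← Finset.mul_sum, ← Finset.mul_sum]
  ring

theorem IsReggeMetric.bForm_eq_incTilde (hg : M.IsReggeMetric g) (hU : M.IsReggeZero U)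
    (hσ : M.IsRegge σ) (s : ℝ) : M.bForm g s σ U = -2 * M.incTilde g s σ U := by
  have hc : ∀ T ∈ M.cells, M.cellIntegral g T (fun x =>
      ip4 (g T x)⁻¹ (INC (g T) (σ T) x) (AAf g U T x))
      = -1 * M.cellIntegral g T (fun x =>
        ip4 (g T x)⁻¹ (cov2cov2 (g T) (σ T) x) (swap23 (AAf g U T x))) :=
    fun T hT => cellIntegral_congr (-1) hT fun x hx => by
      rw [neg_one_mul]
      exact ip4_INC_AA (hg.posDef hT hx).isMetric ((hU.1.1 T hT).1 x) _
  have hf := hg.sum_boundary hU (B := M.facetFlux g σ) fun F hF T hT x hx => by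
    have hFT := mem_powersetCard_of_mem_star (mem_facets_of_mem_intFacets hF) hT
    have hTc := (mem_star.1 hT).1
    exact (hg.metricAt hTc hx.1).smooth_flux (hg.smooth_nor hTc hx.1 hFT)
      (hσ.1.smoothMat hTc hx.1)
  have he : ∀ E ∈ M.intEdges, M.edgeIntegral g E
        (fun x => (∑ F ∈ M.facetsAt E, M.edgeJump g σ E F x) * M.edgeVal g (AAf g U) E x)
      = ∑ F ∈ M.facetsAt E, M.edgeIntegral g E
        (fun x => M.edgeJump g σ E F x * M.edgeVal g (AAf g U) E x) := by
    intro E hE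
    have hE := mem_edges_of_mem_intEdges hE
    simp only [Finset.sum_mul]
    exact hg.edgeIntegral_sum hE _ fun F hF =>
      (hg.continuousOn_edgeJump hE hF hσ.1).mul (hg.continuousOn_edgeVal hE hU.1.1)
  simp only [bForm, incTilde, INCtilde]
  rw [Finset.sum_sub_distrib, Finset.sum_congr rfl hc, Finset.sum_congr rfl he, hf,
    ← Finset.mul_sum]
  ring

end CurvedTriangulation

end Regge3D

end

open Regge3D in
theorem mainTheorem7 {V : Type*} [DecidableEq V] (Ω : Set Pt) (hΩ : IsOpen Ω)
    (M : CurvedTriangulation Ω V) (g : PField V) (hg : M.IsReggeMetric g) :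
    -- the curvature operator `Q` is the unique symmetric 2-tensor with `𝔸 Q = R`
    (∀ T ∈ M.cells, ∀ x ∈ M.carrier T, (curvOp (g T) x).IsSymm ∧
      ∀ W : Mat, W.IsSymm → (AA (g T x) W = riemann (g T) x ↔ W = curvOp (g T) x)) ∧
    ∀ U : PField V, M.IsReggeZero U →
      -- the generalized curvature, rescaled by the factor 4
      (1 / 4 * M.riemannFunctional g (CurvedTriangulation.AAf g U)
        = ∑ T ∈ M.cells, M.cellIntegral g T (fun x => ip (g T x)⁻¹ (curvOp (g T) x) (U T x))
          - ∑ F ∈ M.intFacets,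
              M.facetPairing g F (M.jump F (M.IIbar g F)) (M.facetTT g U F (M.side F))
          + ∑ E ∈ M.intEdges,
              M.edgeIntegral g E (fun x => M.deficit g E x * M.edgeTT g U E x)) ∧
      ∀ σ : PField V, M.IsRegge σ →
        -- the form `a`
        (M.aForm g σ U
          = -2 * ∑ T ∈ M.cells, M.cellIntegral g T
                (fun x => triple (g T x)⁻¹ (curvOp (g T) x) (σ T x) (U T x))
            - 2 * ∑ F ∈ M.intFacets, M.facetIntegral g (M.side F) F (fun x =>
                triple (invFacet (g (M.side F) x) (M.nor g (M.side F) F x))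
                  (M.jump F (M.II g F) x) (M.facetRev g σ F (M.side F) x)
                  (M.facetRev g U F (M.side F) x))
            - 2 * ∑ E ∈ M.intEdges, M.edgeIntegral g E
                (fun x => M.deficit g E x * M.edgeTT g σ E x * M.edgeTT g U E x)) ∧
        -- the form `b`, with either sign `s` of its edge term
        ∀ s : ℝ, s = 1 ∨ s = -1 →
          (M.bForm g s σ U
            = -2 * ∑ T ∈ M.cells, M.cellIntegral g T
                  (fun x => ip (g T x)⁻¹ (inc (g T) (σ T) x) (U T x))
              + 2 * ∑ F ∈ M.intFacets, M.facetPairing g F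
                  (M.jump F (fun T x => curlCross (g T) (σ T) (M.wall T F) x
                    - sigmaNN (g T) (σ T) (M.wall T F) x • M.IIbar g F T x
                    - traceRev (g T x) (M.nor g T F x)
                        (nablaContr (g T) (σ T) (M.wall T F) x)))
                  (M.facetTT g U F (M.side F))
              + s * (2 * ∑ E ∈ M.intEdges, M.edgeIntegral g E (fun x =>
                  (∑ F ∈ M.facetsAt E, M.edgeJump g σ E F x) * M.edgeTT g U E x))) ∧
          M.bForm g s σ U = -2 * M.incTilde g s σ U := by
  refine ⟨fun T hT x hx => ?_, fun U hU => ⟨hg.riemannFunctional_eq hU.1, fun σ hσ =>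
    ⟨hg.aForm_eq hU.1 hσ, fun s _ => ⟨hg.bForm_eq hU.1 hσ s, hg.bForm_eq_incTilde hU hσ s⟩⟩⟩⟩
  have hm := hg.metricAt hT hx
  exact ⟨curvOp_isSymm hm, fun W hW => AA_eq_riemann_iff hm hW⟩
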